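/- Let $\Bbbk$ be an algebraically closed field of characteristic $0$, let $r\ge 1$, and let $q\in\Bbbk^\times$ not be a root of unity. Let $B_r(q)$ be the $r\times r$ upper bidiagonal matrix with $q$ on the diagonal and $1$ on the superdiagonal, let $\mathbb D_{2r}(q)=\begin{pmatrix}0&I_r\\ B_r(q)&0\end{pmatrix}=(e_{ij})$, and let $A=A_{D_q}=\Bbbk\langle v_1,\dots,v_{2r}\rangle/\big(\sum_{i,j}e_{ij}v_iv_j\big)$. **Quantum groups.** Let $\mathcal O_A(M)$ be the bialgebra generated by $a_{ij}$ ($1\le i,j\le 2r$) with relations $\sum_{i,j,p,l}e_{ij}d_{pl}a_{pi}a_{lj}=0$ for all $(d_{pl})$ with $\sum_{p,l} d_{pl}e_{pl}=0$, and with $\Delta(a_{ij})=\sum_s a_{is}\otimes a_{sj}$, $\varepsilon(a_{ij})=\delta_{ij}$. Let $\mathcal O_A(GL)$ be its Hopf envelope, which coacts on $A$ by the algebra map $v_i\mapsto\sum_s v_s\otimes a_{si}$. Let $\mathsf D\in\mathcal O_A(GL)$ be the homological codeterminant of this coaction: the group-like element by which $\mathcal O_A(GL)$ coacts on the one-dimensional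 space $\mathrm{Ext}^2_A(\Bbbk,\Bbbk)$, $\mathfrak e\mapsto\mathsf D\otimes\mathfrak e$. Put $\mathcal O^c_A(GL)=\mathcal O_A(GL)/(a\mathsf D-\mathsf Da : a\in\mathcal O_A(GL))$ and $\mathcal O_A(SL)=\mathcal O_A(GL)/(\mathsf D-1)$. For a Hopf algebra $H$ with antipode $S$ and $m\ge1$ let $H_m=H/(S^{2m}(a)-a : a\in H)$. Let $\mathcal O^c_A(GL/S^\infty)$, respectively $\mathcal O_A(SL/S^\infty)$, be the projective limit, in the category of coalgebras, of the Hopf algebras $H_m$ over the positive integers ordered by divisibility, with the canonical maps $H_{m'}\to H_m$ for $m\mid m'$, where $H=\mathcal O^c_A(GL)$, respectively $H=\mathcal O_A(SL)$; it is a Hopf algebra such that the projections to the $H_m$ are Hopf algebra maps. **Noncommutative symmetric functions.** Let $\mathsf{NSymm}(n)=\Bbbk\langle x_1,\dots,x_n\rangle$ be the free algebra with $\Delta(x_i)=\sum_{j+l=i}x_j\otimes x_l$ ($x_0=1$), $\varepsilon(x_i)=0$ for $i\geq 1$, and antipode $S(x_i)=-\sum_{1\le j\le i}x_jS(x_{i-j})$.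 Let $\varphi$ be its Hopf algebra automorphism given inductively by $\varphi(x_i)=-\sum_{1\le j\le i}x_j\varphi(x_{i-j})$ for $1\le i\le n$; then $\varphi^2=\mathrm{id}$. Let $\mathsf{FNSymm}(n)=\coprod_{s\in\mathbb Z}\mathsf{NSymm}(n)^{[s]}$ be the free product of copies of $\mathsf{NSymm}(n)$ indexed by $s\in\mathbb Z$, with the Hopf algebra structure for which the copies, generated by $x_1^{[s]},\dots,x_n^{[s]}$, are Hopf subalgebras. Let $\mathbb Z\times\mathbb Z$, with generators $g,h$, act on $\mathsf{FNSymm}(n)$ by Hopf algebra automorphisms with $g^k(x_i^{[s]})=\varphi^k(x_i^{[s+k]})$ and $h^k(x_i^{[s]})=\varphi^k(x_i^{[s-k]})$ for $k\in\mathbb Z$. As $gh$ acts trivially, this induces an action of $\mathbb Z=(\mathbb Z\times\mathbb Z)/\langle gh\rangle$, whose generator acts by $g$. **Statement.** The projective limits $\mathcal O^c_A(GL/S^\infty)$ and $\mathcal O_A(SL/S^\infty)$ exist, and there are isomorphisms of Hopf algebras $$\mathcal O^c_A(GL/S^\infty)\cong\mathsf{FNSymm}(r-1)\#\Bbbk[\mathbb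 Z\times\mathbb Z],\qquad \mathcal O_A(SL/S^\infty)\cong\mathsf{FNSymm}(r-1)\#\Bbbk\mathbb Z ,$$ where $\#$ denotes the smash product for the actions above. -/

import Mathlib

universe u v w

open scoped TensorProduct

noncomputable section

namespace QG

section Prelim

variable {k : Type u} [Field k]

/-- The two-sided ideal generated by a set. -/
def idealOf {R : Type v} [Ring R] (s : Set R) : Ideal R := (TwoSidedIdeal.span s).asIdeal

instance {R : Type v} [Ring R] (s : Set R) : (idealOf s).IsTwoSided :=
  inferInstanceAs (TwoSidedIdeal.span s).asIdeal.IsTwoSided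

theorem subset_idealOf {R : Type v} [Ring R] {s : Set R} {x : R} (hx : x ∈ s) : x ∈ idealOf s :=
  TwoSidedIdeal.mem_asIdeal.2 (TwoSidedIdeal.subset_span hx)

theorem idealOf_map_eq_zero {R : Type v} [Ring R] {s : Set R} {T : Type w} [Ring T] (F : R →+* T)
    (h : ∀ x ∈ s, F x = 0) {x : R} (hx : x ∈ idealOf s) : F x = 0 := by
  have : TwoSidedIdeal.span s ≤ TwoSidedIdeal.ker F :=
    TwoSidedIdeal.span_le.2 fun y hy => by simpa [TwoSidedIdeal.mem_ker] using h y hy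
  simpa [TwoSidedIdeal.mem_ker] using this (TwoSidedIdeal.mem_asIdeal.1 hx)

theorem mk_eq_zero_of_mem {R : Type v} [Ring R] {s : Set R} {x : R} (hx : x ∈ s) :
    Ideal.Quotient.mk (idealOf s) x = 0 :=
  Ideal.Quotient.eq_zero_iff_mem.2 (subset_idealOf hx)

variable (k) in
/-- The map `(π ⊗ π) ∘ Δ`, where `π` is the projection modulo the ideal generated by `s`. -/
def quotComul {H : Type v} [Ring H] [Bialgebra k H] (s : Set H) :
    H →ₐ[k] (H ⧸ idealOf s) ⊗[k] (H ⧸ idealOf s) :=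
  (Algebra.TensorProduct.map (Ideal.Quotient.mkₐ k (idealOf s))
    (Ideal.Quotient.mkₐ k (idealOf s))).comp (Bialgebra.comulAlgHom k H)

theorem isCoideal_idealOf {H : Type v} [Ring H] [Bialgebra k H] {s : Set H}
    (h1 : ∀ x ∈ s, Coalgebra.counit (R := k) x = 0) (h2 : ∀ x ∈ s, quotComul k s x = 0) :
    ((idealOf s).restrictScalars k).IsCoideal where
  counit_eq_zero x hx := idealOf_map_eq_zero (Bialgebra.counitAlgHom k H : H →+* k) h1 hx
  map_mkQ_comul_eq_zero x hx := by
    have := idealOf_map_eq_zero (quotComul k s).toRingHom h2 (x := x) hx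
    exact this

theorem isHopfIdeal_idealOf {H : Type v} [Ring H] [HopfAlgebra k H] {s : Set H}
    (h1 : ∀ x ∈ s, Coalgebra.counit (R := k) x = 0) (h2 : ∀ x ∈ s, quotComul k s x = 0)
    (h3 : ∀ x ∈ s, HopfAlgebra.antipode k x ∈ idealOf s) :
    (idealOf s).IsHopfIdeal k where
  __ := isCoideal_idealOf h1 h2
  antipode_mem x hx := by
    have := idealOf_map_eq_zero (s := s)
      (((AlgHom.op (Ideal.Quotient.mkₐ k (idealOf s))).comp
        (HopfAlgebra.antipodeAlgHomOp k H) : H →ₐ[k] _) : H →+* (H ⧸ idealOf s)ᵐᵒᵖ)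
      (fun y hy => by
        have := Ideal.Quotient.eq_zero_iff_mem.2 (h3 y hy)
        simp [this]) hx
    simpa [Ideal.Quotient.eq_zero_iff_mem] using this

/-- The candidate antipode as a linear map. -/
def unopLin {H : Type v} [Ring H] [Algebra k H] {B : Type w} [Ring B] [Algebra k B]
    (S : B →ₐ[k] Hᵐᵒᵖ) : B →ₗ[k] H :=
  (MulOpposite.opLinearEquiv k).symm.toLinearMap ∘ₗ S.toLinearMap

@[simp] theorem unopLin_apply {H : Type v} [Ring H] [Algebra k H] {B : Type w} [Ring B]
    [Algebra k B] (S : B →ₐ[k] Hᵐᵒᵖ) (x : B) : unopLin S x = (S x).unop := rfl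

/-- For an anti-endomorphism of a bialgebra, the antipode axioms have to be checked only on
algebra generators. -/
abbrev hopfOfGenerators {H : Type v} [Ring H] [Bialgebra k H] (S : H →ₐ[k] Hᵐᵒᵖ) (G : Set H)
    (hG : Algebra.adjoin k G = ⊤)
    (hl : ∀ x ∈ G, LinearMap.mul' k H ((unopLin S).rTensor H (Coalgebra.comul x)) =
      algebraMap k H (Coalgebra.counit x))
    (hr : ∀ x ∈ G, LinearMap.mul' k H ((unopLin S).lTensor H (Coalgebra.comul x)) =
      algebraMap k H (Coalgebra.counit x)) :
    HopfAlgebra k H where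
  antipode := unopLin S
  mul_antipode_rTensor_comul := by
    have key (t : H ⊗[k] H) (c : k)
        (h : LinearMap.mul' k H ((unopLin S).rTensor H t) = algebraMap k H c) (v : H ⊗[k] H) :
        LinearMap.mul' k H ((unopLin S).rTensor H (t * v)) =
          algebraMap k H c * LinearMap.mul' k H ((unopLin S).rTensor H v) := by
      induction v with
      | zero => simp
      | add x y hx hy => rw [mul_add, map_add, map_add, hx, hy, map_add, map_add, mul_add]
      | tmul p q =>
        have : LinearMap.mul' k H ((unopLin S).rTensor H (t * p ⊗ₜ q)) =
            (S p).unop * LinearMap.mul' k H ((unopLin S).rTensor H t) * q := by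
          clear h
          induction t with
          | zero => simp
          | add x y hx hy => rw [add_mul, map_add, map_add, hx, hy, map_add, map_add, mul_add, add_mul]
          | tmul x y => simp [mul_assoc]
        rw [this, h, ← Algebra.commutes]
        simp [mul_assoc]
    ext x
    have hx : x ∈ Algebra.adjoin k G := hG ▸ Algebra.mem_top
    simp only [LinearMap.comp_apply, Algebra.linearMap_apply]
    induction hx using Algebra.adjoin_induction with
    | mem x hx => exact hl x hx
    | algebraMap r => simp [Algebra.TensorProduct.algebraMap_apply]
    | add x y _ _ hx hy => simp only [map_add, hx, hy]
    | mul x y _ _ hx hy => rw [Bialgebra.comul_mul, key _ _ hx, hy, Bialgebra.counit_mul, map_mul]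
  mul_antipode_lTensor_comul := by
    have key (t : H ⊗[k] H) (c : k)
        (h : LinearMap.mul' k H ((unopLin S).lTensor H t) = algebraMap k H c) (v : H ⊗[k] H) :
        LinearMap.mul' k H ((unopLin S).lTensor H (v * t)) =
          algebraMap k H c * LinearMap.mul' k H ((unopLin S).lTensor H v) := by
      induction v with
      | zero => simp
      | add x y hx hy => rw [add_mul, map_add, map_add, hx, hy, map_add, map_add, mul_add]
      | tmul p q =>
        have : LinearMap.mul' k H ((unopLin S).lTensor H (p ⊗ₜ q * t)) =
            p * LinearMap.mul' k H ((unopLin S).lTensor H t) * (S q).unop := by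
          clear h
          induction t with
          | zero => simp
          | add x y hx hy => rw [mul_add, map_add, map_add, hx, hy, map_add, map_add, mul_add, add_mul]
          | tmul x y => simp [mul_assoc]
        rw [this, h, ← Algebra.commutes]
        simp [mul_assoc]
    ext x
    have hx : x ∈ Algebra.adjoin k G := hG ▸ Algebra.mem_top
    simp only [LinearMap.comp_apply, Algebra.linearMap_apply]
    induction hx using Algebra.adjoin_induction with
    | mem x hx => exact hr x hx
    | algebraMap r => simp [Algebra.TensorProduct.algebraMap_apply]
    | add x y _ _ hx hy => simp only [map_add, hx, hy]
    | mul x y _ _ hx hy =>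
      rw [Bialgebra.comul_mul, key _ _ hy, hx, Bialgebra.counit_mul, map_mul, ← Algebra.commutes]

section Convolution

open Coalgebra LinearMap WithConv

variable {C : Type v} [AddCommGroup C] [Module k C] [Coalgebra k C] {Q : Type w} [Ring Q]
  [Algebra k Q]

theorem conv_inl_inr (f : C →ₗ[k] Q) :
    toConv ((Algebra.TensorProduct.includeLeft : Q →ₐ[k] Q ⊗[k] Q).toLinearMap ∘ₗ f) *
      toConv ((Algebra.TensorProduct.includeRight : Q →ₐ[k] Q ⊗[k] Q).toLinearMap ∘ₗ f) =
      toConv (TensorProduct.map f f ∘ₗ comul) := by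
  apply WithConv.ext
  rw [LinearMap.convMul_def]
  simp only [← comp_assoc]
  congr 1
  ext x y
  simp

theorem conv_inr_inl (f : C →ₗ[k] Q) :
    toConv ((Algebra.TensorProduct.includeRight : Q →ₐ[k] Q ⊗[k] Q).toLinearMap ∘ₗ f) *
      toConv ((Algebra.TensorProduct.includeLeft : Q →ₐ[k] Q ⊗[k] Q).toLinearMap ∘ₗ f) =
      toConv (TensorProduct.map f f ∘ₗ (TensorProduct.comm k C C).toLinearMap ∘ₗ comul) := by
  apply WithConv.ext
  rw [LinearMap.convMul_def]
  simp only [← comp_assoc]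
  congr 1
  ext x y
  simp

theorem conv_algHom (F : Q →ₐ[k] Q ⊗[k] Q) {f g : C →ₗ[k] Q} (h : toConv f * toConv g = 1) :
    toConv (F.toLinearMap ∘ₗ f) * toConv (F.toLinearMap ∘ₗ g) = 1 := by
  have h1 := algHom_comp_convMul_distrib F (toConv f) (toConv g)
  rw [h] at h1
  apply WithConv.ext
  have h2 : (toConv (F.toLinearMap ∘ₗ f) * toConv (F.toLinearMap ∘ₗ g)).ofConv =
    F.toLinearMap ∘ₗ (1 : WithConv (C →ₗ[k] Q)).ofConv := h1.symm
  rw [h2]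
  ext x
  simp

theorem mul_mul_mul_eq_one {M : Type v} [Monoid M] {a b c d : M} (h : b * c = 1) (h' : a * d = 1) :
    a * b * (c * d) = 1 := by
  rw [mul_assoc, ← mul_assoc b, h, one_mul, h']

theorem conv_cancel₁ {f g : C →ₗ[k] Q} (h : toConv f * toConv g = 1) :
    toConv (TensorProduct.map f f ∘ₗ (TensorProduct.comm k C C).toLinearMap ∘ₗ comul) *
      toConv (TensorProduct.map g g ∘ₗ comul) = 1 := by
  rw [← conv_inl_inr, ← conv_inr_inl]
  exact mul_mul_mul_eq_one (conv_algHom _ h) (conv_algHom _ h)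

theorem conv_cancel₂ {f g : C →ₗ[k] Q} (h : toConv f * toConv g = 1) :
    toConv (TensorProduct.map f f ∘ₗ comul) *
      toConv (TensorProduct.map g g ∘ₗ (TensorProduct.comm k C C).toLinearMap ∘ₗ comul) = 1 := by
  rw [← conv_inl_inr, ← conv_inr_inl]
  exact mul_mul_mul_eq_one (conv_algHom _ h) (conv_algHom _ h)

end Convolution

open Coalgebra LinearMap HopfAlgebra in
/-- The antipode is an anti-endomorphism of the coalgebra. -/
theorem comul_antipode {C : Type v} [Ring C] [HopfAlgebra k C] (a : C) :
    (comul (antipode k a) : C ⊗[k] C) =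
      TensorProduct.map (antipode k) (antipode k) (TensorProduct.comm k C C (comul a)) := by
  have h := conv_cancel₁ (LinearMap.antipode_mul_id (R := k) (C := C))
  rw [TensorProduct.map_id, LinearMap.id_comp] at h
  have := left_inv_eq_right_inv h (LinearMap.comul_right_inv (R := k) (C := C))
  exact (LinearMap.congr_fun (WithConv.toConv_injective this) a).symm

/-! ### Hopf quotients -/

section HopfQuotients

variable (k) (H : Type v) [Ring H] [HopfAlgebra k H]

open Coalgebra HopfAlgebra

/-- The elements `S^{2m}(a) - a`. -/
def sPowRel (m : ℕ) : Set H := {x | ∃ a : H, x = (antipode k ^ (2 * m) : H →ₗ[k] H) a - a}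

theorem counit_antipode_pow (m : ℕ) (a : H) :
    counit (R := k) ((antipode k ^ m : H →ₗ[k] H) a) = counit a := by
  induction m with
  | zero => simp
  | succ m ih => rw [pow_succ', Module.End.mul_apply, counit_antipode, ih]

theorem comul_antipode_pow (m : ℕ) (a : H) :
    (comul ((antipode k ^ (2 * m) : H →ₗ[k] H) a) : H ⊗[k] H) =
      TensorProduct.map (antipode k ^ (2 * m)) (antipode k ^ (2 * m)) (comul a) := by
  induction m generalizing a with
  | zero => simp [Module.End.one_eq_id]
  | succ m ih =>
    rw [mul_add, mul_one, pow_add, Module.End.mul_apply, ih, pow_two, Module.End.mul_apply,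
      comul_antipode, comul_antipode]
    generalize (comul a : H ⊗[k] H) = t
    induction t with
    | zero => simp
    | add p q hp hq => simp only [map_add, hp, hq]
    | tmul p q => simp

theorem mk_antipode_pow (m : ℕ) (a : H) :
    Ideal.Quotient.mkₐ k (idealOf (sPowRel k H m)) ((antipode k ^ (2 * m) : H →ₗ[k] H) a) =
      Ideal.Quotient.mkₐ k (idealOf (sPowRel k H m)) a := by
  rw [← sub_eq_zero, ← map_sub]
  exact mk_eq_zero_of_mem ⟨a, rfl⟩

instance (m : ℕ) : (idealOf (sPowRel k H m)).IsHopfIdeal k := by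
  apply isHopfIdeal_idealOf
  · rintro _ ⟨a, rfl⟩
    rw [map_sub, counit_antipode_pow, sub_self]
  · rintro _ ⟨a, rfl⟩
    rw [map_sub, sub_eq_zero]
    change Algebra.TensorProduct.map _ _ (comul _) = Algebra.TensorProduct.map _ _ (comul a)
    rw [comul_antipode_pow]
    generalize (comul a : H ⊗[k] H) = t
    induction t with
    | zero => simp
    | add p q hp hq => simp only [map_add, hp, hq]
    | tmul p q =>
      rw [TensorProduct.map_tmul, Algebra.TensorProduct.map_tmul, mk_antipode_pow, mk_antipode_pow,
        Algebra.TensorProduct.map_tmul]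
  · rintro _ ⟨a, rfl⟩
    apply subset_idealOf
    refine ⟨antipode k a, ?_⟩
    rw [map_sub, ← Module.End.mul_apply, ← Module.End.mul_apply, ← pow_succ, ← pow_succ']

/-- The largest Hopf quotient `H / (S^{2m}(a) - a : a ∈ H)` of `H` in which `S^{2m}` becomes the
identity. -/
abbrev SQuot (m : ℕ) : Type v := H ⧸ idealOf (sPowRel k H m)

theorem sPow_le {m m' : ℕ} (h : m ∣ m') :
    idealOf (sPowRel k H m') ≤ idealOf (sPowRel k H m) := by
  intro x hx
  rw [← Ideal.Quotient.eq_zero_iff_mem]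
  refine idealOf_map_eq_zero (Ideal.Quotient.mk (idealOf (sPowRel k H m))) ?_ hx
  rintro _ ⟨a, rfl⟩
  clear hx
  obtain ⟨j, rfl⟩ := h
  rw [map_sub, sub_eq_zero]
  induction j with
  | zero => simp
  | succ j ih =>
    rw [mul_add, mul_one, mul_add, add_comm, pow_add, Module.End.mul_apply]
    exact (mk_antipode_pow k H m _).trans ih

/-- The transition map `H / (S^{2m'} - 1) → H / (S^{2m} - 1)` for `m ∣ m'`. -/
def sTrans {m m' : ℕ} (h : m ∣ m') : SQuot k H m' →+* SQuot k H m :=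
  Ideal.Quotient.factor (sPow_le k H h)

/-- `(L, π)` is the projective limit, in the category of coalgebras, of the system of Hopf algebras
`H / (S^{2m}(a) - a : a ∈ H)`, `m ≥ 1`, indexed by the positive integers ordered by divisibility. -/
structure IsSInftyLimit {H : Type u} [Ring H] [HopfAlgebra k H] {L : Type u} [Ring L]
    [HopfAlgebra k L] (π : ∀ m : ℕ+, L →ₐc[k] SQuot k H m) : Prop where
  compat : ∀ (m m' : ℕ+) (h : (m : ℕ) ∣ m') (x : L), sTrans k H h (π m' x) = π m x
  existsUnique_lift : ∀ (C : Type u) [AddCommGroup C] [Module k C] [Coalgebra k C]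
    (τ : ∀ m : ℕ+, C →ₗc[k] SQuot k H m),
    (∀ (m m' : ℕ+) (h : (m : ℕ) ∣ m') (x : C), sTrans k H h (τ m' x) = τ m x) →
      ∃! t : C →ₗc[k] L, ∀ (m : ℕ+) (x : C), π m (t x) = τ m x

variable {H}

/-- The elements `a D - D a` for `a ∈ H` and `D` a group-like element with the property `P`. -/
def centralRel (P : H → Prop) : Set H :=
  {x | ∃ D a : H, IsGroupLikeElem k D ∧ P D ∧ x = a * D - D * a}

/-- The elements `D - 1` for `D` a group-like element with the property `P`. -/
def trivialRel (P : H → Prop) : Set H := {x | ∃ D : H, IsGroupLikeElem k D ∧ P D ∧ x = D - 1}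

instance (P : H → Prop) : (idealOf (centralRel k P)).IsHopfIdeal k := by
  apply isHopfIdeal_idealOf
  · rintro _ ⟨D, a, hD, -, rfl⟩
    simp [Bialgebra.counit_mul, hD.counit_eq_one]
  · rintro _ ⟨D, a, hD, hP, rfl⟩
    have hc (y : H) : Ideal.Quotient.mkₐ k (idealOf (centralRel k P)) (y * D) =
        Ideal.Quotient.mkₐ k (idealOf (centralRel k P)) (D * y) := by
      rw [← sub_eq_zero, ← map_sub]
      exact mk_eq_zero_of_mem ⟨D, y, hD, hP, rfl⟩
    rw [map_sub, sub_eq_zero]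
    change Algebra.TensorProduct.map _ _ (comul _) = Algebra.TensorProduct.map _ _ (comul _)
    rw [Bialgebra.comul_mul, Bialgebra.comul_mul, hD.comul_eq_tmul_self]
    generalize (comul a : H ⊗[k] H) = t
    induction t with
    | zero => simp
    | add p q hp hq => simp only [map_add, hp, hq, add_mul, mul_add]
    | tmul p q => simp only [Algebra.TensorProduct.tmul_mul_tmul, Algebra.TensorProduct.map_tmul, hc]
  · rintro _ ⟨D, a, hD, hP, rfl⟩
    have h1 : D * antipode k D = 1 := hD.mul_antipode_cancel
    have h2 : antipode k D * D = 1 := hD.antipode_mul_cancel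
    have : antipode k (a * D - D * a) =
        antipode k D * (antipode k a * D - D * antipode k a) * antipode k D := by
      rw [map_sub, antipode_mul_antidistrib, antipode_mul_antidistrib, mul_sub, sub_mul]
      congr 1
      · rw [mul_assoc, mul_assoc, h1, mul_one]
      · rw [← mul_assoc, h2, one_mul]
    rw [this]
    exact Ideal.mul_mem_right _ _ (Ideal.mul_mem_left _ _
      (subset_idealOf ⟨D, antipode k a, hD, hP, rfl⟩))

instance (P : H → Prop) : (idealOf (trivialRel k P)).IsHopfIdeal k := by
  apply isHopfIdeal_idealOf
  · rintro _ ⟨D, hD, -, rfl⟩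
    simp [hD.counit_eq_one]
  · rintro _ ⟨D, hD, hP, rfl⟩
    have hc : Ideal.Quotient.mkₐ k (idealOf (trivialRel k P)) D = 1 := by
      rw [← map_one (Ideal.Quotient.mkₐ k (idealOf (trivialRel k P))), ← sub_eq_zero, ← map_sub]
      exact mk_eq_zero_of_mem ⟨D, hD, hP, rfl⟩
    rw [map_sub, sub_eq_zero, map_one]
    change Algebra.TensorProduct.map _ _ (comul _) = _
    rw [hD.comul_eq_tmul_self, Algebra.TensorProduct.map_tmul, hc, Algebra.TensorProduct.one_def]
  · rintro _ ⟨D, hD, hP, rfl⟩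
    have h2 : antipode k D * D = 1 := hD.antipode_mul_cancel
    have : antipode k (D - 1) = - (antipode k D * (D - 1)) := by
      rw [map_sub, mul_sub, h2, antipode_one]; simp
    rw [this]
    exact neg_mem (Ideal.mul_mem_left _ _ (subset_idealOf ⟨D, hD, hP, rfl⟩))

end HopfQuotients

end Prelim

section Manin

theorem sum_swap₄ {ι : Type} [Fintype ι] {M : Type v} [AddCommMonoid M] (f : ι → ι → ι → ι → M) :
    ∑ i, ∑ j, ∑ s, ∑ t, f i j s t = ∑ s, ∑ t, ∑ i, ∑ j, f i j s t := by
  calc _ = ∑ i, ∑ s, ∑ j, ∑ t, f i j s t := Finset.sum_congr rfl fun i _ => Finset.sum_comm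
    _ = ∑ s, ∑ i, ∑ j, ∑ t, f i j s t := Finset.sum_comm
    _ = ∑ s, ∑ i, ∑ t, ∑ j, f i j s t :=
      Finset.sum_congr rfl fun s _ => Finset.sum_congr rfl fun i _ => Finset.sum_comm
    _ = _ := Finset.sum_congr rfl fun s _ => Finset.sum_comm

variable (k : Type u) [Field k] {ι : Type}

variable (ι) in
/-- The free algebra on the entries `a_{ij}` of a generic square matrix. -/
def FreeMat : Type u := FreeAlgebra k (ι × ι)

instance : Ring (FreeMat k ι) := inferInstanceAs (Ring (FreeAlgebra k (ι × ι)))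
instance : Algebra k (FreeMat k ι) := inferInstanceAs (Algebra k (FreeAlgebra k (ι × ι)))

namespace FreeMat

/-- The generator `a_{ij}`. -/
def X (i j : ι) : FreeMat k ι := FreeAlgebra.ι k (i, j)

/-- The algebra homomorphism given by a matrix of images of the generators. -/
def lift {B : Type v} [Ring B] [Algebra k B] (f : ι → ι → B) : FreeMat k ι →ₐ[k] B :=
  FreeAlgebra.lift k fun p : ι × ι => f p.1 p.2

@[simp] theorem lift_X {B : Type v} [Ring B] [Algebra k B] (f : ι → ι → B) (i j : ι) :
    lift k f (X k i j) = f i j := FreeAlgebra.lift_ι_apply _ _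

theorem hom_ext {B : Type v} [Ring B] [Algebra k B] {F G : FreeMat k ι →ₐ[k] B}
    (h : ∀ i j, F (X k i j) = G (X k i j)) : F = G :=
  FreeAlgebra.hom_ext (funext fun p => h p.1 p.2)

/-- `Δ(a_{ij}) = ∑ₛ a_{is} ⊗ a_{sj}` and `ε(a_{ij}) = δ_{ij}`. -/
instance [Fintype ι] [DecidableEq ι] : Bialgebra k (FreeMat k ι) :=
  Bialgebra.ofAlgHom (lift k fun i j => ∑ s, X k i s ⊗ₜ[k] X k s j)
    (lift k fun i j => if i = j then 1 else 0)
    (hom_ext k fun i j => by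
      simp only [AlgHom.comp_apply, lift_X, map_sum, Algebra.TensorProduct.map_tmul,
        AlgHom.id_apply, TensorProduct.sum_tmul, TensorProduct.tmul_sum]
      rw [Finset.sum_comm]
      rfl)
    (hom_ext k fun i j => by
      simp [TensorProduct.ite_tmul])
    (hom_ext k fun i j => by
      simp [TensorProduct.tmul_ite])

variable [Fintype ι] [DecidableEq ι]

@[simp] theorem comul_X (i j : ι) :
    Coalgebra.comul (R := k) (X k i j) = ∑ s, X k i s ⊗ₜ[k] X k s j := lift_X k _ i j

@[simp] theorem counit_X (i j : ι) :
    Coalgebra.counit (R := k) (X k i j) = if i = j then 1 else 0 := lift_X k _ i j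

end FreeMat

variable {k} [Fintype ι] (E : Matrix ι ι k)

/-- The relations `∑ e_{ij} d_{pl} a_{pi} a_{lj} = 0`, for all `(d_{pl})` with `∑ d_{ij} e_{ij} = 0`
(these `d` are the relations of the quadratic dual of `A(E)`). -/
def maninRel : Set (FreeMat k ι) :=
  {x | ∃ d : Matrix ι ι k, (∑ i, ∑ j, d i j * E i j = 0) ∧
    x = ∑ p, ∑ l, d p l • ∑ i, ∑ j, E i j • (FreeMat.X k p i * FreeMat.X k l j)}

/-- The quantum matrix space `O_A(M)` associated to `A = A(E)`. -/
abbrev OM : Type u := FreeMat k ι ⧸ idealOf (maninRel E)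

namespace OM

/-- The generator `a_{ij}` of `O_A(M)`. -/
def a (i j : ι) : OM E := Ideal.Quotient.mkₐ k (idealOf (maninRel E)) (FreeMat.X k i j)

variable [DecidableEq ι]

theorem exists_qdet : ∃ D : OM E, ∀ p l, ∑ i, ∑ j, E i j • (a E p i * a E l j) = E p l • D := by
  have key (d : Matrix ι ι k) (hd : ∑ i, ∑ j, d i j * E i j = 0) :
      ∑ p, ∑ l, d p l • ∑ i, ∑ j, E i j • (a E p i * a E l j) = 0 := by
    have := mk_eq_zero_of_mem (s := maninRel E) ⟨d, hd, rfl⟩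
    change Ideal.Quotient.mkₐ k (idealOf (maninRel E)) _ = 0 at this
    simp only [map_sum, map_smul, map_mul] at this
    exact this
  by_cases h : ∃ p₀ l₀, E p₀ l₀ ≠ 0
  · obtain ⟨p₀, l₀, h⟩ := h
    refine ⟨(E p₀ l₀)⁻¹ • ∑ i, ∑ j, E i j • (a E p₀ i * a E l₀ j), fun p l => ?_⟩
    have := key (Matrix.single p l 1 - Matrix.single p₀ l₀ ((E p₀ l₀)⁻¹ * E p l)) (by
      simp only [Matrix.sub_apply, sub_mul, Finset.sum_sub_distrib, Matrix.single_apply, ite_mul,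
        zero_mul, ite_and, Finset.sum_ite_eq, Finset.mem_univ, if_true, Finset.sum_ite_irrel,
        Finset.sum_const_zero]
      field_simp
      simp)
    simp only [Matrix.sub_apply, sub_smul, Finset.sum_sub_distrib, Matrix.single_apply, ite_smul,
        zero_smul, ite_and, Finset.sum_ite_eq, Finset.mem_univ, if_true, Finset.sum_ite_irrel,
        Finset.sum_const_zero, one_smul] at this
    rw [sub_eq_zero] at this
    rw [this, smul_smul, mul_comm]
  · push Not at h
    exact ⟨0, fun p l => by simp [h]⟩

instance : ((idealOf (maninRel E)).restrictScalars k).IsCoideal := by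
  apply isCoideal_idealOf
  · rintro _ ⟨d, hd, rfl⟩
    simp only [map_sum, map_smul, Bialgebra.counit_mul, FreeMat.counit_X, mul_ite, mul_one,
      mul_zero, smul_eq_mul, Finset.sum_ite_eq, Finset.mem_univ,
      if_true]
    simpa using hd
  · rintro _ ⟨d, hd, rfl⟩
    obtain ⟨D, hD⟩ := exists_qdet E
    have hX (i j : ι) : quotComul k (maninRel E) (FreeMat.X k i j) =
        ∑ s, a E i s ⊗ₜ[k] a E s j := by
      change Algebra.TensorProduct.map _ _ (Coalgebra.comul _) = _
      simp only [FreeMat.comul_X, map_sum, Algebra.TensorProduct.map_tmul]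
      rfl
    have h1 (p l : ι) : ∑ i, ∑ j, E i j •
        ((∑ s, a E p s ⊗ₜ[k] a E s i) * ∑ t, a E l t ⊗ₜ[k] a E t j) =
        (E p l • D) ⊗ₜ[k] D := by
      rw [← hD]
      simp only [Finset.sum_mul_sum, Algebra.TensorProduct.tmul_mul_tmul, Finset.smul_sum,
        TensorProduct.sum_tmul]
      have h2 (s t : ι) : ∑ i, ∑ j, E i j • ((a E p s * a E l t) ⊗ₜ[k] (a E s i * a E t j)) =
          (E s t • (a E p s * a E l t)) ⊗ₜ[k] D := by
        rw [TensorProduct.smul_tmul, ← hD]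
        simp only [TensorProduct.tmul_sum, TensorProduct.tmul_smul]
      simp only [← h2]
      rw [sum_swap₄]
    simp only [map_sum, map_smul, map_mul, hX, h1]
    have := Ideal.Quotient.eq_zero_iff_mem.2 (subset_idealOf (s := maninRel E) ⟨d, hd, rfl⟩)
    simp only [← TensorProduct.smul_tmul', smul_smul, ← Finset.sum_smul, hd, zero_smul]

end OM

/-- The algebra `A(E) = k⟨v_i⟩ / (∑ e_{ij} v_i v_j)`. -/
abbrev QuadAlg : Type u :=
  FreeAlgebra k ι ⧸ idealOf {∑ i, ∑ j, E i j • (FreeAlgebra.ι k i * FreeAlgebra.ι k j)}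

namespace QuadAlg

/-- The generator `v_i` of `A(E)`. -/
def v (i : ι) : QuadAlg E := Ideal.Quotient.mkₐ k _ (FreeAlgebra.ι k i)

theorem rel : ∑ i, ∑ j, E i j • (v E i * v E j) = 0 := by
  have := mk_eq_zero_of_mem (s := {∑ i, ∑ j, E i j • (FreeAlgebra.ι k i * FreeAlgebra.ι k j)}) rfl
  change Ideal.Quotient.mkₐ k (idealOf _) _ = 0 at this
  simp only [map_sum, map_smul, map_mul] at this
  exact this

/-- The algebra homomorphism from `A(E)` given by images of the generators. -/
def lift {B : Type v} [Ring B] [Algebra k B] (f : ι → B)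
    (hf : ∑ i, ∑ j, E i j • (f i * f j) = 0) : QuadAlg E →ₐ[k] B :=
  Ideal.Quotient.liftₐ _ (FreeAlgebra.lift k f) fun x hx =>
    idealOf_map_eq_zero (FreeAlgebra.lift k f : _ →+* B)
      (by rintro _ rfl; simpa [map_sum] using hf) hx

@[simp] theorem lift_v {B : Type v} [Ring B] [Algebra k B] (f : ι → B)
    (hf : ∑ i, ∑ j, E i j • (f i * f j) = 0) (i : ι) : lift E f hf (v E i) = f i := by
  exact (Ideal.Quotient.liftₐ_apply _ _ _ _).trans (FreeAlgebra.lift_ι_apply _ _)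

/-- The augmentation `A(E) → k`, `v_i ↦ 0`. -/
def aug : QuadAlg E →ₐ[k] k := lift E 0 (by simp)

/-- The right coaction `v_i ↦ ∑ₛ v_s ⊗ a_{si}` of `O_A(M)` on `A(E)`. -/
def coactM [DecidableEq ι] : QuadAlg E →ₐ[k] QuadAlg E ⊗[k] OM E :=
  lift E (fun i => ∑ s, v E s ⊗ₜ OM.a E s i) (by
    obtain ⟨D, hD⟩ := OM.exists_qdet E
    have h : ∑ i, ∑ j, E i j • ((∑ s, v E s ⊗ₜ[k] OM.a E s i) * ∑ t, v E t ⊗ₜ[k] OM.a E t j) =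
        ∑ s, ∑ t, (v E s * v E t) ⊗ₜ[k] (E s t • D) := by
      simp only [Finset.sum_mul_sum, Algebra.TensorProduct.tmul_mul_tmul, Finset.smul_sum, ← hD,
        TensorProduct.tmul_sum, TensorProduct.tmul_smul]
      rw [sum_swap₄]
    rw [h]
    simp only [← TensorProduct.smul_tmul, ← TensorProduct.sum_tmul, rel, TensorProduct.zero_tmul])

end QuadAlg
end Manin

section Envelope

open Coalgebra LinearMap

variable (k : Type u) [Field k] (B : Type u) [Ring B] [Bialgebra k B]

/-- The identity of `B ⊗ B` for even `i`, the flip for odd `i`. -/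
def tw (i : ℕ) : B ⊗[k] B →ₗ[k] B ⊗[k] B :=
  if Even i then LinearMap.id else (TensorProduct.comm k B B).toLinearMap

theorem tw_succ (i : ℕ) (t : B ⊗[k] B) : tw k B (i + 1) t = TensorProduct.comm k B B (tw k B i t) := by
  by_cases h : Even i
  · simp [tw, h, Nat.even_add_one]
  · simp [tw, h, Nat.even_add_one]

/-- The coalgebra `B` for even `i`, the co-opposite coalgebra for odd `i`. -/
abbrev twCoalgebra (i : ℕ) : Coalgebra k B where
  comul := tw k B i ∘ₗ comul
  counit := counit
  coassoc := by
    by_cases h : Even i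
    · simp only [tw, h, if_true, LinearMap.id_comp]; exact Coalgebra.coassoc
    · simp only [tw, h, if_false]
      ext a
      simp only [LinearMap.comp_apply, LinearEquiv.coe_coe]
      let F : B ⊗[k] (B ⊗[k] B) →ₗ[k] B ⊗[k] (B ⊗[k] B) :=
        (TensorProduct.assoc k B B B).toLinearMap ∘ₗ (TensorProduct.comm k B (B ⊗[k] B)).toLinearMap ∘ₗ
          (TensorProduct.comm k B B).toLinearMap.lTensor B
      have h1 : (TensorProduct.assoc k B B B).toLinearMap ∘ₗ
          ((TensorProduct.comm k B B).toLinearMap ∘ₗ comul).rTensor B ∘ₗ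
            (TensorProduct.comm k B B).toLinearMap = F ∘ₗ (comul : B →ₗ[k] _).lTensor B := by
        ext x y
        simp [F]
      have h2 : ((TensorProduct.comm k B B).toLinearMap ∘ₗ comul).lTensor B ∘ₗ
            (TensorProduct.comm k B B).toLinearMap =
          F ∘ₗ (TensorProduct.assoc k B B B).toLinearMap ∘ₗ (comul : B →ₗ[k] _).rTensor B := by
        ext x y
        simp only [TensorProduct.AlgebraTensorModule.curry_apply, TensorProduct.curry_apply,
          LinearMap.coe_restrictScalars, LinearMap.comp_apply, LinearEquiv.coe_coe,
          TensorProduct.comm_tmul, lTensor_tmul, rTensor_tmul]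
        generalize (comul x : B ⊗[k] B) = t
        induction t with
        | zero => simp
        | add p q hp hq => simp only [map_add, TensorProduct.tmul_add, TensorProduct.add_tmul, hp, hq]
        | tmul p q => simp [F]
      have e1 := LinearMap.congr_fun h1 (comul a)
      have e2 := LinearMap.congr_fun h2 (comul a)
      simp only [LinearMap.comp_apply, LinearEquiv.coe_coe] at e1 e2
      rw [e1, e2, coassoc_apply]
  rTensor_counit_comp_comul := by
    by_cases h : Even i
    · simp only [tw, h, if_true, LinearMap.id_comp]; exact Coalgebra.rTensor_counit_comp_comul
    · simp only [tw, h, if_false]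
      have : (counit : B →ₗ[k] k).rTensor B ∘ₗ (TensorProduct.comm k B B).toLinearMap =
        (TensorProduct.comm k B k).toLinearMap ∘ₗ (counit : B →ₗ[k] k).lTensor B := by
        ext; simp
      rw [← LinearMap.comp_assoc, this, LinearMap.comp_assoc, lTensor_counit_comp_comul]
      ext; simp
  lTensor_counit_comp_comul := by
    by_cases h : Even i
    · simp only [tw, h, if_true, LinearMap.id_comp]; exact Coalgebra.lTensor_counit_comp_comul
    · simp only [tw, h, if_false]
      have : (counit : B →ₗ[k] k).lTensor B ∘ₗ (TensorProduct.comm k B B).toLinearMap =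
        (TensorProduct.comm k k B).toLinearMap ∘ₗ (counit : B →ₗ[k] k).rTensor B := by
        ext; simp
      rw [← LinearMap.comp_assoc, this, LinearMap.comp_assoc, rTensor_counit_comp_comul]
      ext; simp

/-- The tensor algebra on countably many copies of `B`. -/
def EnvT : Type u := TensorAlgebra k (ℕ →₀ B)

instance : Ring (EnvT k B) := inferInstanceAs (Ring (TensorAlgebra k (ℕ →₀ B)))
instance : Algebra k (EnvT k B) := inferInstanceAs (Algebra k (TensorAlgebra k (ℕ →₀ B)))

namespace EnvT

/-- The inclusion of the `i`-th copy of `B`. -/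
def gen (i : ℕ) : B →ₗ[k] EnvT k B := TensorAlgebra.ι k ∘ₗ Finsupp.lsingle i

variable {B} in
/-- The algebra homomorphism given by linear maps on the copies of `B`. -/
def lift {Q : Type v} [Ring Q] [Algebra k Q] (f : ℕ → B →ₗ[k] Q) : EnvT k B →ₐ[k] Q :=
  TensorAlgebra.lift k (Finsupp.lsum k f)

@[simp] theorem lift_gen {Q : Type v} [Ring Q] [Algebra k Q] (f : ℕ → B →ₗ[k] Q) (i : ℕ) (b : B) :
    lift k f (gen k B i b) = f i b := by
  refine (TensorAlgebra.lift_ι_apply _ _).trans ?_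
  simp

variable {k B} in
theorem hom_ext {Q : Type v} [Ring Q] [Algebra k Q] {F G : EnvT k B →ₐ[k] Q}
    (h : ∀ i b, F (gen k B i b) = G (gen k B i b)) : F = G := by
  apply TensorAlgebra.hom_ext
  ext i b
  exact h i b

/-- The `i`-th copy of `B` is a subcoalgebra, with the comultiplication flipped for odd `i`. -/
instance : Bialgebra k (EnvT k B) :=
  Bialgebra.ofAlgHom
    (lift k fun i => TensorProduct.map (gen k B i) (gen k B i) ∘ₗ tw k B i ∘ₗ comul)
    (lift k fun _ => counit)
    (hom_ext fun i b => by
      have h := LinearMap.congr_fun (twCoalgebra k B i).coassoc b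
      simp only [LinearMap.comp_apply, LinearEquiv.coe_coe] at h
      simp only [AlgHom.comp_apply, lift_gen, LinearMap.comp_apply]
      generalize tw k B i (comul b) = t at h ⊢
      have h' := congrArg (TensorProduct.map (gen k B i)
        (TensorProduct.map (gen k B i) (gen k B i))) h
      refine Eq.trans ?_ (h'.trans ?_)
      · clear h h'
        induction t with
        | zero => simp
        | add p q hp hq => simp only [map_add, hp, hq]
        | tmul x y =>
          simp only [TensorProduct.map_tmul, rTensor_tmul, Algebra.TensorProduct.map_tmul, lift_gen,
            AlgHom.id_apply, LinearMap.comp_apply]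
          generalize tw k B i (comul x) = t
          induction t with
          | zero => simp
          | add p q hp hq => simp only [map_add, TensorProduct.add_tmul, hp, hq]
          | tmul x y => simp
      · clear h h'
        induction t with
        | zero => simp
        | add p q hp hq => simp only [map_add, hp, hq]
        | tmul x y =>
          simp only [TensorProduct.map_tmul, lTensor_tmul, Algebra.TensorProduct.map_tmul, lift_gen,
            AlgHom.id_apply, LinearMap.comp_apply]
          rfl)
    (hom_ext fun i b => by
      have h := LinearMap.congr_fun (twCoalgebra k B i).rTensor_counit_comp_comul b
      simp only [LinearMap.comp_apply] at h
      simp only [AlgHom.comp_apply, lift_gen, LinearMap.comp_apply]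
      generalize tw k B i (comul b) = t at h ⊢
      have h' := congrArg ((gen k B i).lTensor k) h
      refine Eq.trans ?_ (h'.trans ?_)
      · clear h h'
        induction t with
        | zero => simp
        | add p q hp hq => simp only [map_add, hp, hq]
        | tmul x y => simp; rfl
      · simp)
    (hom_ext fun i b => by
      have h := LinearMap.congr_fun (twCoalgebra k B i).lTensor_counit_comp_comul b
      simp only [LinearMap.comp_apply] at h
      simp only [AlgHom.comp_apply, lift_gen, LinearMap.comp_apply]
      generalize tw k B i (comul b) = t at h ⊢
      have h' := congrArg ((gen k B i).rTensor k) h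
      refine Eq.trans ?_ (h'.trans ?_)
      · clear h h'
        induction t with
        | zero => simp
        | add p q hp hq => simp only [map_add, hp, hq]
        | tmul x y => simp; rfl
      · simp)

@[simp] theorem comul_gen (i : ℕ) (b : B) : comul (R := k) (gen k B i b) =
    TensorProduct.map (gen k B i) (gen k B i) (tw k B i (comul b)) := lift_gen k B _ i b

@[simp] theorem counit_gen (i : ℕ) (b : B) : counit (R := k) (gen k B i b) = counit b :=
  lift_gen k B _ i b

/-- The relations of the Hopf envelope: the `i`-th copy of `B` is a copy of the algebra `B` for even
`i` and of the opposite algebra for odd `i`, and the copies `i + 1` and `i` are inverse to each other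
with respect to convolution. -/
inductive Rel : EnvT k B → Prop
  | one (i : ℕ) : Rel (gen k B i 1 - 1)
  | mul (i : ℕ) (t : B ⊗[k] B) : Rel (gen k B i (mul' k B t) -
      mul' k (EnvT k B) (TensorProduct.map (gen k B i) (gen k B i) (tw k B i t)))
  | left (i : ℕ) (b : B) : Rel (mul' k (EnvT k B)
      (TensorProduct.map (gen k B (i + 1)) (gen k B i) (tw k B i (comul b))) -
        algebraMap k (EnvT k B) (counit b))
  | right (i : ℕ) (b : B) : Rel (mul' k (EnvT k B)
      (TensorProduct.map (gen k B i) (gen k B (i + 1)) (tw k B i (comul b))) -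
        algebraMap k (EnvT k B) (counit b))

end EnvT

/-- The Hopf envelope of the bialgebra `B`. -/
abbrev HopfEnvelope : Type u := EnvT k B ⧸ idealOf {x | EnvT.Rel k B x}

namespace HopfEnvelope

/-- The projection from the tensor algebra. -/
def π : EnvT k B →ₐ[k] HopfEnvelope k B := Ideal.Quotient.mkₐ k _

/-- The image of the `i`-th copy of `B`. -/
def j (i : ℕ) : B →ₗ[k] HopfEnvelope k B := (π k B).toLinearMap ∘ₗ EnvT.gen k B i


theorem π_rel {x : EnvT k B} (h : EnvT.Rel k B x) : π k B x = 0 :=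
  mk_eq_zero_of_mem (s := {x | EnvT.Rel k B x}) h

theorem π_mul' (f g : B →ₗ[k] EnvT k B) (t : B ⊗[k] B) :
    π k B (mul' k _ (TensorProduct.map f g t)) =
      mul' k _ (TensorProduct.map ((π k B).toLinearMap ∘ₗ f) ((π k B).toLinearMap ∘ₗ g) t) := by
  induction t with
  | zero => simp
  | add p q hp hq => simp only [map_add, hp, hq]
  | tmul x y => simp

theorem j_one (i : ℕ) : j k B i 1 = 1 := by
  have := π_rel k B (EnvT.Rel.one i)
  rw [map_sub, sub_eq_zero] at this
  exact this.trans (map_one _)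

theorem j_mul (i : ℕ) (t : B ⊗[k] B) :
    j k B i (mul' k B t) = mul' k _ (TensorProduct.map (j k B i) (j k B i) (tw k B i t)) := by
  have := π_rel k B (EnvT.Rel.mul i t)
  rwa [map_sub, sub_eq_zero, π_mul'] at this

theorem j_left (i : ℕ) (b : B) :
    mul' k _ (TensorProduct.map (j k B (i + 1)) (j k B i) (tw k B i (comul b))) =
      algebraMap k (HopfEnvelope k B) (counit b) := by
  have := π_rel k B (EnvT.Rel.left i b)
  rwa [map_sub, sub_eq_zero, π_mul', AlgHom.commutes] at this

theorem j_right (i : ℕ) (b : B) :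
    mul' k _ (TensorProduct.map (j k B i) (j k B (i + 1)) (tw k B i (comul b))) =
      algebraMap k (HopfEnvelope k B) (counit b) := by
  have := π_rel k B (EnvT.Rel.right i b)
  rwa [map_sub, sub_eq_zero, π_mul', AlgHom.commutes] at this

theorem quotComul_gen (i : ℕ) (b : B) : quotComul k {x | EnvT.Rel k B x} (EnvT.gen k B i b) =
    TensorProduct.map (j k B i) (j k B i) (tw k B i (comul b)) := by
  change Algebra.TensorProduct.map _ _ (comul (EnvT.gen k B i b)) = _
  rw [EnvT.comul_gen]
  generalize tw k B i (comul b) = t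
  induction t with
  | zero => simp
  | add p q hp hq => simp only [map_add, hp, hq]
  | tmul x y => simp; rfl

theorem map_j_tw_mul (i : ℕ) (s t : B ⊗[k] B) :
    TensorProduct.map (j k B i) (j k B i) (tw k B i (s * t)) =
      mul' k _ (TensorProduct.map (TensorProduct.map (j k B i) (j k B i) ∘ₗ tw k B i)
        (TensorProduct.map (j k B i) (j k B i) ∘ₗ tw k B i) (if Even i then s ⊗ₜ t else t ⊗ₜ s)) := by
  have hj (x y : B) := j_mul k B i (x ⊗ₜ y)
  induction s with
  | zero => simp
  | add p q hp hq =>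
    rw [add_mul, map_add, map_add, hp, hq, TensorProduct.add_tmul, TensorProduct.tmul_add]
    split_ifs <;> simp only [map_add]
  | tmul x y =>
    induction t with
    | zero => simp
    | add p q hp hq =>
      rw [mul_add, map_add, map_add, hp, hq, TensorProduct.add_tmul, TensorProduct.tmul_add]
      split_ifs <;> simp only [map_add]
    | tmul z w =>
      by_cases h : Even i <;> simp [tw, h] at hj ⊢ <;> simp [hj]

theorem j_conv_left (i : ℕ) : letI := twCoalgebra k B i
    WithConv.toConv (j k B (i + 1)) * WithConv.toConv (j k B i) = 1 := by
  let := twCoalgebra k B i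
  apply WithConv.ext
  ext b
  exact j_left k B i b

theorem j_conv_right (i : ℕ) : letI := twCoalgebra k B i
    WithConv.toConv (j k B i) * WithConv.toConv (j k B (i + 1)) = 1 := by
  let := twCoalgebra k B i
  apply WithConv.ext
  ext b
  exact j_right k B i b

theorem map_j_left (i : ℕ) (b : B) :
    mul' k _ (TensorProduct.map
      (TensorProduct.map (j k B (i + 1)) (j k B (i + 1)) ∘ₗ tw k B (i + 1) ∘ₗ comul)
      (TensorProduct.map (j k B i) (j k B i) ∘ₗ tw k B i ∘ₗ comul) (tw k B i (comul b))) =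
      algebraMap k (HopfEnvelope k B ⊗[k] HopfEnvelope k B) (counit b) := by
  have h1 : tw k B (i + 1) = (TensorProduct.comm k B B).toLinearMap ∘ₗ tw k B i := by
    ext1; ext; simp [tw_succ]
  rw [h1]
  let := twCoalgebra k B i
  exact LinearMap.congr_fun (congrArg WithConv.ofConv (conv_cancel₁ (j_conv_left k B i))) b

theorem map_j_right (i : ℕ) (b : B) :
    mul' k _ (TensorProduct.map
      (TensorProduct.map (j k B i) (j k B i) ∘ₗ tw k B i ∘ₗ comul)
      (TensorProduct.map (j k B (i + 1)) (j k B (i + 1)) ∘ₗ tw k B (i + 1) ∘ₗ comul)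
      (tw k B i (comul b))) =
      algebraMap k (HopfEnvelope k B ⊗[k] HopfEnvelope k B) (counit b) := by
  have h1 : tw k B (i + 1) = (TensorProduct.comm k B B).toLinearMap ∘ₗ tw k B i := by
    ext1; ext; simp [tw_succ]
  rw [h1]
  let := twCoalgebra k B i
  exact LinearMap.congr_fun (congrArg WithConv.ofConv (conv_cancel₂ (j_conv_right k B i))) b

instance : ((idealOf {x | EnvT.Rel k B x}).restrictScalars k).IsCoideal := by
  have hmul (f g : B →ₗ[k] EnvT k B) (t : B ⊗[k] B) {Q : Type u} [Ring Q] [Algebra k Q]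
      (F : EnvT k B →ₐ[k] Q) : F (mul' k _ (TensorProduct.map f g t)) =
        mul' k _ (TensorProduct.map (F.toLinearMap ∘ₗ f) (F.toLinearMap ∘ₗ g) t) := by
    induction t with
    | zero => simp
    | add p q hp hq => simp only [map_add, hp, hq]
    | tmul x y => simp
  have hg (i : ℕ) : (Bialgebra.counitAlgHom k (EnvT k B)).toLinearMap ∘ₗ EnvT.gen k B i = counit := by
    ext b; exact EnvT.counit_gen k B i b
  have hΔ (i : ℕ) : (quotComul k {x | EnvT.Rel k B x}).toLinearMap ∘ₗ EnvT.gen k B i =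
      TensorProduct.map (j k B i) (j k B i) ∘ₗ tw k B i ∘ₗ comul := by
    ext b; exact quotComul_gen k B i b
  have hε (i : ℕ) (b : B) : mul' k k (TensorProduct.map (counit (R := k)) (counit (R := k))
      (tw k B i (comul b))) = counit b := by
    have h := LinearMap.congr_fun (twCoalgebra k B i).rTensor_counit_comp_comul b
    simp only [LinearMap.comp_apply] at h
    have h' := congrArg (mul' k k ∘ₗ (counit (R := k) (A := B)).lTensor k) h
    refine Eq.trans ?_ (h'.trans (by simp))
    generalize tw k B i (comul b) = t
    induction t with
    | zero => simp
    | add p q hp hq => simp only [map_add, hp, hq]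
    | tmul x y =>
      simp
      exact Or.inl rfl
  apply isCoideal_idealOf
  · intro x hx
    change Bialgebra.counitAlgHom k (EnvT k B) x = 0
    cases hx with
    | one i => simp
    | mul i t =>
      rw [map_sub, sub_eq_zero, hmul, hg]
      simp only [Bialgebra.counitAlgHom_apply, EnvT.counit_gen]
      induction t with
      | zero => simp
      | add p q hp hq => simp only [map_add, hp, hq]
      | tmul x y => by_cases h : Even i <;> simp [tw, h, mul_comm]
    | left i b => rw [map_sub, sub_eq_zero, hmul, hg, hg, hε, AlgHom.commutes]; rfl
    | right i b => rw [map_sub, sub_eq_zero, hmul, hg, hg, hε, AlgHom.commutes]; rfl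
  · intro x hx
    cases hx with
    | one i =>
      rw [map_sub, sub_eq_zero, quotComul_gen, Bialgebra.comul_one,
        map_one (quotComul k {x | EnvT.Rel k B x})]
      by_cases h : Even i <;> simp [tw, h, Algebra.TensorProduct.one_def, j_one]
    | mul i t =>
      rw [map_sub, sub_eq_zero, hmul, hΔ, quotComul_gen]
      induction t with
      | zero => simp
      | add p q hp hq => simp only [map_add, hp, hq]
      | tmul x y =>
        rw [mul'_apply, Bialgebra.comul_mul, map_j_tw_mul]
        by_cases h : Even i <;> simp [tw, h]
    | left i b =>
      rw [map_sub, sub_eq_zero, hmul, hΔ, hΔ, AlgHom.commutes]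
      exact map_j_left k B i b
    | right i b =>
      rw [map_sub, sub_eq_zero, hmul, hΔ, hΔ, AlgHom.commutes]
      exact map_j_right k B i b

theorem unop_mul' {Q : Type v} [Ring Q] [Algebra k Q] (f g : B →ₗ[k] Q) (t : B ⊗[k] B) :
    mul' k Qᵐᵒᵖ (TensorProduct.map ((MulOpposite.opLinearEquiv k).toLinearMap ∘ₗ f)
      ((MulOpposite.opLinearEquiv k).toLinearMap ∘ₗ g) t) =
      MulOpposite.op (mul' k Q (TensorProduct.map g f (TensorProduct.comm k B B t))) := by
  induction t with
  | zero => simp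
  | add p q hp hq => simp only [map_add, hp, hq, MulOpposite.op_add]
  | tmul x y => simp

theorem lift_mul' {Q : Type v} [Ring Q] [Algebra k Q] (F : EnvT k B →ₐ[k] Q)
    (f g : B →ₗ[k] EnvT k B) (t : B ⊗[k] B) : F (mul' k _ (TensorProduct.map f g t)) =
        mul' k _ (TensorProduct.map (F.toLinearMap ∘ₗ f) (F.toLinearMap ∘ₗ g) t) := by
  induction t with
  | zero => simp
  | add p q hp hq => simp only [map_add, hp, hq]
  | tmul x y => simp

/-- The antipode sends the `i`-th copy of `B` identically to the copy `i + 1`. -/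
def antipodeOp : HopfEnvelope k B →ₐ[k] (HopfEnvelope k B)ᵐᵒᵖ :=
  Ideal.Quotient.liftₐ _ (EnvT.lift k fun i =>
    (MulOpposite.opLinearEquiv k).toLinearMap ∘ₗ j k B (i + 1)) (by
    set F : EnvT k B →ₐ[k] (HopfEnvelope k B)ᵐᵒᵖ := EnvT.lift k fun i =>
      (MulOpposite.opLinearEquiv k).toLinearMap ∘ₗ j k B (i + 1) with hF
    have hFg (i : ℕ) : F.toLinearMap ∘ₗ EnvT.gen k B i =
        (MulOpposite.opLinearEquiv k).toLinearMap ∘ₗ j k B (i + 1) := by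
      ext b; exact EnvT.lift_gen k B _ i b
    intro x hx
    refine idealOf_map_eq_zero (F : EnvT k B →+* (HopfEnvelope k B)ᵐᵒᵖ) ?_ hx
    clear hx
    intro x hx
    change F x = 0
    cases hx with
    | one i =>
      rw [map_sub, sub_eq_zero, EnvT.lift_gen, map_one F]
      simp [j_one]
    | mul i t =>
      rw [map_sub, sub_eq_zero, lift_mul', hFg, unop_mul', EnvT.lift_gen, LinearMap.comp_apply,
        j_mul, tw_succ]
      rfl
    | left i b =>
      rw [map_sub, sub_eq_zero, lift_mul', hFg, hFg, unop_mul', ← tw_succ, j_right,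
        AlgHom.commutes]
      rfl
    | right i b =>
      rw [map_sub, sub_eq_zero, lift_mul', hFg, hFg, unop_mul', ← tw_succ, j_left,
        AlgHom.commutes]
      rfl)

theorem antipodeOp_j (i : ℕ) (b : B) : (antipodeOp k B (j k B i b)).unop = j k B (i + 1) b := by
  have : antipodeOp k B (j k B i b) = MulOpposite.op (j k B (i + 1) b) :=
    (Ideal.Quotient.liftₐ_apply _ _ _ _).trans (EnvT.lift_gen k B _ i b)
  rw [this, MulOpposite.unop_op]

theorem adjoin_j : Algebra.adjoin k {x : HopfEnvelope k B | ∃ i b, x = j k B i b} = ⊤ := by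
  set A := Algebra.adjoin k {x : HopfEnvelope k B | ∃ i b, x = j k B i b} with hA
  let f (i : ℕ) : B →ₗ[k] A := (j k B i).codRestrict (Subalgebra.toSubmodule A)
    fun b => Algebra.subset_adjoin ⟨i, b, rfl⟩
  have h : A.val.comp (EnvT.lift k f) = π k B := EnvT.hom_ext fun i b => by
    rw [AlgHom.comp_apply, EnvT.lift_gen]
    rfl
  rw [eq_top_iff]
  intro x _
  obtain ⟨y, rfl⟩ := Ideal.Quotient.mk_surjective x
  have h2 := AlgHom.congr_fun h y
  change ((EnvT.lift k f y : A) : HopfEnvelope k B) = Ideal.Quotient.mk _ y at h2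
  rw [← h2]
  exact Subtype.property _

theorem comul_j (i : ℕ) (b : B) : comul (R := k) (j k B i b) =
    TensorProduct.map (j k B i) (j k B i) (tw k B i (comul b)) := quotComul_gen k B i b

theorem counit_j (i : ℕ) (b : B) : counit (R := k) (j k B i b) = counit b :=
  EnvT.counit_gen k B i b

theorem unopLin_antipodeOp_j (i : ℕ) : unopLin (antipodeOp k B) ∘ₗ j k B i = j k B (i + 1) := by
  ext b; exact antipodeOp_j k B i b

instance : HopfAlgebra k (HopfEnvelope k B) :=
  hopfOfGenerators (antipodeOp k B) {x | ∃ i b, x = j k B i b} (adjoin_j k B)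
    (by
      rintro _ ⟨i, b, rfl⟩
      rw [comul_j, counit_j, ← j_left k B i b, ← LinearMap.comp_apply (rTensor _ _),
        rTensor_comp_map, unopLin_antipodeOp_j])
    (by
      rintro _ ⟨i, b, rfl⟩
      rw [comul_j, counit_j, ← j_right k B i b, ← LinearMap.comp_apply (lTensor _ _),
        lTensor_comp_map, unopLin_antipodeOp_j])

/-- The canonical map from a bialgebra to its Hopf envelope. -/
def ι : B →ₐc[k] HopfEnvelope k B :=
  BialgHom.ofAlgHom
    (AlgHom.ofLinearMap (j k B 0) (j_one k B 0) fun x y => by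
      have := j_mul k B 0 (x ⊗ₜ y)
      simpa [tw] using this)
    (AlgHom.ext fun b => counit_j k B 0 b)
    (AlgHom.ext fun b => by
      have := comul_j k B 0 b
      simp only [tw, Even.zero, if_true, LinearMap.id_apply] at this
      refine Eq.trans ?_ this.symm
      simp only [AlgHom.comp_apply, Bialgebra.comulAlgHom_apply]
      generalize (comul b : B ⊗[k] B) = t
      induction t with
      | zero => simp
      | add p q hp hq => simp only [map_add, hp, hq]
      | tmul x y => simp)

end HopfEnvelope

end Envelope

namespace HopfEnvelope

open Coalgebra LinearMap

section Universal

variable {k : Type u} [Field k] {B : Type u} [Ring B] [Bialgebra k B] {H : Type v} [Ring H]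
  [HopfAlgebra k H]

variable (ψ : B →ₐc[k] H)

/-- The maps `S^i ∘ ψ`. -/
def sPow (i : ℕ) : B →ₗ[k] H :=
  (HopfAlgebra.antipode k ^ i : H →ₗ[k] H) ∘ₗ (ψ : B →ₐ[k] H).toLinearMap

theorem sPow_succ (i : ℕ) (b : B) : sPow ψ (i + 1) b = HopfAlgebra.antipode k (sPow ψ i b) := by
  rw [sPow, pow_succ']; rfl

theorem antipode_mul_map (f g : B →ₗ[k] H) (t : B ⊗[k] B) :
    HopfAlgebra.antipode k (mul' k H (TensorProduct.map f g t)) =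
      mul' k H (TensorProduct.map (HopfAlgebra.antipode k ∘ₗ g) (HopfAlgebra.antipode k ∘ₗ f)
        (TensorProduct.comm k B B t)) := by
  induction t with
  | zero => simp
  | add p q hp hq => simp only [map_add, hp, hq]
  | tmul x y => simp [HopfAlgebra.antipode_mul_antidistrib]

theorem sPow_succ' (i : ℕ) : HopfAlgebra.antipode k ∘ₗ sPow ψ i = sPow ψ (i + 1) := by
  ext b; exact (sPow_succ ψ i b).symm

theorem sPow_one (i : ℕ) : sPow ψ i 1 = 1 := by
  induction i with
  | zero => exact map_one ψ
  | succ i ih => rw [sPow_succ, ih, HopfAlgebra.antipode_one]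

theorem sPow_mul (i : ℕ) (t : B ⊗[k] B) : sPow ψ i (mul' k B t) =
    mul' k H (TensorProduct.map (sPow ψ i) (sPow ψ i) (tw k B i t)) := by
  induction i with
  | zero =>
    induction t with
    | zero => simp
    | add p q hp hq => simp only [map_add, hp, hq]
    | tmul x y => exact map_mul ψ x y
  | succ i ih => rw [sPow_succ, ih, antipode_mul_map, sPow_succ', tw_succ]

theorem sPow_comul (i : ℕ) (b : B) : comul (R := k) (sPow ψ i b) =
    TensorProduct.map (sPow ψ i) (sPow ψ i) (tw k B i (comul b)) := by
  induction i with
  | zero => exact (CoalgHomClass.map_comp_comul_apply ψ b).symm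
  | succ i ih =>
    rw [sPow_succ, comul_antipode, ih, tw_succ]
    generalize tw k B i (comul b) = t
    induction t with
    | zero => simp
    | add p q hp hq => simp only [map_add, hp, hq]
    | tmul x y => simp [sPow_succ]

theorem sPow_counit (i : ℕ) (b : B) : counit (R := k) (sPow ψ i b) = counit b := by
  induction i with
  | zero => exact CoalgHomClass.counit_comp_apply ψ b
  | succ i ih => rw [sPow_succ, HopfAlgebra.counit_antipode, ih]

theorem sPow_conv (i : ℕ) (b : B) :
    mul' k H (TensorProduct.map (sPow ψ (i + 1)) (sPow ψ i) (tw k B i (comul b))) =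
        algebraMap k H (counit b) ∧
    mul' k H (TensorProduct.map (sPow ψ i) (sPow ψ (i + 1)) (tw k B i (comul b))) =
        algebraMap k H (counit b) := by
  induction i with
  | zero =>
    have hc : tw k B 0 (comul b) = comul b := by simp [tw]
    have h1 : sPow ψ 0 = (ψ : B →ₐ[k] H).toLinearMap := rfl
    rw [hc, ← sPow_succ', h1, ← CoalgHomClass.counit_comp_apply ψ b]
    constructor
    · rw [← HopfAlgebra.mul_antipode_rTensor_comul_apply, ← CoalgHomClass.map_comp_comul_apply,
        ← LinearMap.comp_apply (rTensor _ _), rTensor_comp_map]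
      rfl
    · rw [← HopfAlgebra.mul_antipode_lTensor_comul_apply, ← CoalgHomClass.map_comp_comul_apply,
        ← LinearMap.comp_apply (lTensor _ _), lTensor_comp_map]
      rfl
  | succ i ih =>
    have ha : HopfAlgebra.antipode k (algebraMap k H (counit b)) = algebraMap k H (counit b) := by
      rw [Algebra.algebraMap_eq_smul_one, map_smul, HopfAlgebra.antipode_one]
    constructor
    · have := congrArg (HopfAlgebra.antipode k) ih.2
      rwa [antipode_mul_map, sPow_succ', sPow_succ', ← tw_succ, ha] at this
    · have := congrArg (HopfAlgebra.antipode k) ih.1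
      rwa [antipode_mul_map, sPow_succ', sPow_succ', ← tw_succ, ha] at this

theorem algHom_ext {Q : Type v} [Ring Q] [Algebra k Q] {F G : HopfEnvelope k B →ₐ[k] Q}
    (h : ∀ i b, F (j k B i b) = G (j k B i b)) : F = G :=
  Ideal.Quotient.algHom_ext k (EnvT.hom_ext h)

/-- The algebra homomorphism with `j i b ↦ S^i (ψ b)`. -/
def liftHom : HopfEnvelope k B →ₐ[k] H :=
  Ideal.Quotient.liftₐ _ (EnvT.lift k (sPow ψ)) (by
    have hg (i : ℕ) : (EnvT.lift k (sPow ψ)).toLinearMap ∘ₗ EnvT.gen k B i = sPow ψ i := by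
      ext b; exact EnvT.lift_gen k B _ i b
    intro x hx
    refine idealOf_map_eq_zero (EnvT.lift k (sPow ψ) : EnvT k B →+* H) ?_ hx
    clear hx
    intro x hx
    change EnvT.lift k (sPow ψ) x = 0
    cases hx with
    | one i =>
      rw [map_sub, sub_eq_zero, EnvT.lift_gen, map_one (EnvT.lift k (sPow ψ)), sPow_one]
    | mul i t => rw [map_sub, sub_eq_zero, lift_mul', hg, EnvT.lift_gen, sPow_mul]
    | left i b => rw [map_sub, sub_eq_zero, lift_mul', hg, hg, (sPow_conv ψ i b).1, AlgHom.commutes]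
    | right i b =>
      rw [map_sub, sub_eq_zero, lift_mul', hg, hg, (sPow_conv ψ i b).2, AlgHom.commutes])

theorem liftHom_j (i : ℕ) (b : B) : liftHom ψ (j k B i b) = sPow ψ i b :=
  (Ideal.Quotient.liftₐ_apply _ _ _ _).trans (EnvT.lift_gen k B _ i b)

theorem antipode_j (i : ℕ) (b : B) : HopfAlgebra.antipode k (j k B i b) = j k B (i + 1) b :=
  antipodeOp_j k B i b

theorem map_antipode {C : Type v} [Ring C] [HopfAlgebra k C] {H : Type w} [Ring H]
    [HopfAlgebra k H] (F : C →ₐc[k] H) (x : C) :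
    F (HopfAlgebra.antipode k x) = HopfAlgebra.antipode k (F x) := by
  have e1 : WithConv.toConv ((F : C →ₐ[k] H).toLinearMap ∘ₗ HopfAlgebra.antipode k) *
      WithConv.toConv (F : C →ₐ[k] H).toLinearMap = 1 := by
    apply WithConv.ext
    ext a
    refine Eq.trans ?_ ((congrArg F (HopfAlgebra.mul_antipode_rTensor_comul_apply (R := k) a)).trans
      ((F : C →ₐ[k] H).commutes _))
    change mul' k H (TensorProduct.map _ _ (comul a)) = _
    generalize (comul a : C ⊗[k] C) = t
    induction t with
    | zero => simp
    | add p q hp hq => simp only [map_add, hp, hq]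
    | tmul x y => simp
  have e2 : WithConv.toConv (F : C →ₐ[k] H).toLinearMap *
      WithConv.toConv (HopfAlgebra.antipode k ∘ₗ (F : C →ₐ[k] H).toLinearMap) = 1 := by
    apply WithConv.ext
    ext a
    have := HopfAlgebra.mul_antipode_lTensor_comul_apply (R := k) (F a)
    rw [← CoalgHomClass.map_comp_comul_apply, CoalgHomClass.counit_comp_apply,
      ← LinearMap.comp_apply (lTensor _ _), lTensor_comp_map] at this
    exact this
  exact LinearMap.congr_fun (WithConv.toConv_injective (left_inv_eq_right_inv e1 e2)) x

/-- The universal property of the Hopf envelope. -/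
theorem existsUnique_lift : ∃! F : HopfEnvelope k B →ₐc[k] H, ∀ b, F (ι k B b) = ψ b := by
  refine ⟨BialgHom.ofAlgHom (liftHom ψ) ?_ ?_, fun b => liftHom_j ψ 0 b, ?_⟩
  · exact algHom_ext fun i b => by
      simp only [AlgHom.comp_apply, Bialgebra.counitAlgHom_apply, liftHom_j, sPow_counit, counit_j]
  · exact algHom_ext fun i b => by
      simp only [AlgHom.comp_apply, Bialgebra.comulAlgHom_apply, liftHom_j, sPow_comul, comul_j]
      generalize tw k B i (comul b) = t
      induction t with
      | zero => simp
      | add p q hp hq => simp only [map_add, hp, hq]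
      | tmul x y => simp [liftHom_j]
  · intro F hF
    have : (F : HopfEnvelope k B →ₐ[k] H) = liftHom ψ := algHom_ext fun i b => by
      rw [liftHom_j]
      change F _ = _
      induction i with
      | zero => exact hF b
      | succ i ih => rw [← antipode_j, map_antipode, ih, sPow_succ]
    ext x
    exact AlgHom.congr_fun this x

end Universal

end HopfEnvelope

section LinearGroups

open LinearMap

variable {k : Type u} [Field k] {ι : Type} [Fintype ι] [DecidableEq ι] (E : Matrix ι ι k)

/-- `O_A(GL)`, the Hopf envelope of `O_A(M)`, for `A = A(E)`. -/
abbrev OGL : Type u := HopfEnvelope k (OM E)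

/-- The right coaction of `O_A(GL)` on `A(E)`. -/
def coactGL : QuadAlg E →ₐ[k] QuadAlg E ⊗[k] OGL E :=
  (Algebra.TensorProduct.map (AlgHom.id k _) (HopfEnvelope.ι k (OM E) : OM E →ₐ[k] OGL E)).comp
    (QuadAlg.coactM E)

section Ext

variable {R : Type u} [Ring R] [Algebra k R] (ε : R →ₐ[k] k) {H : Type u} [Ring H] [Algebra k H]

/-- The coboundary in degree `1` of the bar complex computing `Ext_R(k, W)` for a trivial module `W`
over the augmented algebra `(R, ε)`: a cochain of degree `n` is a linear map `R^{⊗ n} → W`. -/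
def barD₁ {W : Type u} [AddCommGroup W] [Module k W] (g : R →ₗ[k] W) (a b : R) : W :=
  ε a • g b - g (a * b) + ε b • g a

/-- The `2`-cocycles of the bar complex computing `Ext_R(k, k)`. -/
def IsBarCocycle₂ (f : R ⊗[k] R →ₗ[k] k) : Prop :=
  ∀ a b c : R, ε a * f (b ⊗ₜ c) - f ((a * b) ⊗ₜ c) + f (a ⊗ₜ (b * c)) - f (a ⊗ₜ b) * ε c = 0

/-- The left coaction on cochains which is dual to a right coaction `ρ` on `R`; it sends `f` to
`a ⊗ b ↦ ∑ f(a₀ ⊗ b₀) a₁ b₁`, which is an element of `Hom(R ⊗ R, H)`, a completion of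
`H ⊗ Hom(R ⊗ R, k)`. -/
def barCoact (ρ : R →ₐ[k] R ⊗[k] H) (f : R ⊗[k] R →ₗ[k] k) : R ⊗[k] R →ₗ[k] H :=
  (TensorProduct.lid k H).toLinearMap ∘ₗ TensorProduct.map f (mul' k H) ∘ₗ
    (TensorProduct.tensorTensorTensorComm k R H R H).toLinearMap ∘ₗ
      TensorProduct.map ρ.toLinearMap ρ.toLinearMap

/-- `D` is the homological codeterminant of the right coaction `ρ` of `H` on an augmented algebra `R`
of global dimension `2` with one-dimensional `Ext²_R(k, k)`: the dual left coaction on `Ext²_R(k, k)`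
is `e ↦ D ⊗ e`, that is, the coaction sends a cocycle `f` to `D ⊗ f` modulo coboundaries. For `R = A(E)` this `D` is
the group-like element with `ρ(r) = r ⊗ D`, where `r` is the relation; other identifications of left
and right coactions replace `D` by its inverse, which does not affect the quotients `OcGL` and `OSL`
below. -/
def IsHomCodet (ρ : R →ₐ[k] R ⊗[k] H) (D : H) : Prop :=
  ∀ f : R ⊗[k] R →ₗ[k] k, IsBarCocycle₂ ε f →
    ∃ g : R →ₗ[k] H, ∀ a b : R, barCoact ρ f (a ⊗ₜ b) = f (a ⊗ₜ b) • D + barD₁ ε g a b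

end Ext

/-- `O^c_A(GL)`, the quotient of `O_A(GL)` by the relations `a D = D a`, where `D` is the homological
codeterminant of the coaction on `A = A(E)`. -/
abbrev OcGL : Type u :=
  OGL E ⧸ idealOf (centralRel k (IsHomCodet (QuadAlg.aug E) (coactGL E)))

/-- `O_A(SL)`, the quotient of `O_A(GL)` by the relation `D = 1`, where `D` is the homological
codeterminant of the coaction on `A = A(E)`. -/
abbrev OSL : Type u :=
  OGL E ⧸ idealOf (trivialRel k (IsHomCodet (QuadAlg.aug E) (coactGL E)))

end LinearGroups

/-- The upper bidiagonal matrix with `q` on the diagonal and `1` on the superdiagonal. -/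
def Bmat {k : Type u} [Field k] (r : ℕ) (q : k) : Matrix (Fin r) (Fin r) k :=
  Matrix.of fun i j => if i = j then q else if (i : ℕ) + 1 = j then 1 else 0

/-- The block matrix with rows `(0, 1)` and `(B, 0)`, where `B` is `Bmat r q`. -/
def Dmat {k : Type u} [Field k] (r : ℕ) (q : k) : Matrix (Fin r ⊕ Fin r) (Fin r ⊕ Fin r) k :=
  Matrix.fromBlocks 0 1 (Bmat r q) 0

section NSymm

open Coalgebra LinearMap Finset

section InvSeq

variable {R : Type u} [Ring R]

/-- The sequence `y` with `y₀ = 1` and `yᵢ = - ∑_{1 ≤ j ≤ i} uⱼ yᵢ₋ⱼ` for `i ≥ 1`. -/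
def invSeq (u : ℕ → R) : ℕ → R
  | 0 => 1
  | m + 1 => - ∑ j : Fin (m + 1), u (j + 1) * invSeq u (m - j)
decreasing_by omega

theorem invSeq_zero (u : ℕ → R) : invSeq u 0 = 1 := by rw [invSeq]

theorem invSeq_succ (u : ℕ → R) (m : ℕ) :
    invSeq u (m + 1) = - ∑ j ∈ range (m + 1), u (j + 1) * invSeq u (m - j) := by
  rw [invSeq, Fin.sum_univ_eq_sum_range (fun j => u (j + 1) * invSeq u (m - j)) (m + 1)]

theorem mk_mul_mk_invSeq (u : ℕ → R) (hu : u 0 = 1) :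
    PowerSeries.mk u * PowerSeries.mk (invSeq u) = 1 := by
  ext m
  rw [PowerSeries.coeff_mul, PowerSeries.coeff_one]
  simp only [PowerSeries.coeff_mk]
  rw [Nat.sum_antidiagonal_eq_sum_range_succ (fun i j => u i * invSeq u j)]
  cases m with
  | zero => simp [hu, invSeq_zero]
  | succ m =>
    rw [sum_range_succ']
    simp [hu, invSeq_succ]

theorem mk_invSeq_mul_mk (u : ℕ → R) (hu : u 0 = 1) :
    PowerSeries.mk (invSeq u) * PowerSeries.mk u = 1 := by
  have h1 := mk_mul_mk_invSeq u hu
  have h2 := mk_mul_mk_invSeq (invSeq u) (invSeq_zero u)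
  rwa [← left_inv_eq_right_inv h1 h2] at h2

theorem sum_mul_invSeq (u : ℕ → R) (hu : u 0 = 1) (m : ℕ) :
    ∑ p ∈ antidiagonal m, u p.1 * invSeq u p.2 = if m = 0 then 1 else 0 := by
  have := congrArg (PowerSeries.coeff m) (mk_mul_mk_invSeq u hu)
  simpa only [PowerSeries.coeff_mul, PowerSeries.coeff_one, PowerSeries.coeff_mk] using this

theorem sum_invSeq_mul (u : ℕ → R) (hu : u 0 = 1) (m : ℕ) :
    ∑ p ∈ antidiagonal m, invSeq u p.1 * u p.2 = if m = 0 then 1 else 0 := by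
  have := congrArg (PowerSeries.coeff m) (mk_invSeq_mul_mk u hu)
  simpa only [PowerSeries.coeff_mul, PowerSeries.coeff_one, PowerSeries.coeff_mk] using this

end InvSeq

variable (k : Type u) [Field k] (n : ℕ)

/-- Noncommutative symmetric functions on `n` variables: the free algebra `k⟨x₁, …, xₙ⟩`. -/
def NSymm : Type u := FreeAlgebra k (Fin n)

instance : Ring (NSymm k n) := inferInstanceAs (Ring (FreeAlgebra k (Fin n)))
instance : Algebra k (NSymm k n) := inferInstanceAs (Algebra k (FreeAlgebra k (Fin n)))

namespace NSymm

/-- The generators `x₁, …, xₙ`, together with `x₀ = 1`, and `xᵢ = 0` for `i > n`. -/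
def x : ℕ → NSymm k n
  | 0 => 1
  | i + 1 => if h : i < n then FreeAlgebra.ι k (⟨i, h⟩ : Fin n) else 0

variable {k n} in
/-- The algebra homomorphism with `xᵢ ↦ f i` for `1 ≤ i ≤ n`. -/
def lift {B : Type v} [Ring B] [Algebra k B] (f : ℕ → B) : NSymm k n →ₐ[k] B :=
  FreeAlgebra.lift k fun i : Fin n => f (i + 1)

theorem lift_x {B : Type v} [Ring B] [Algebra k B] {f : ℕ → B} (hf : f 0 = 1) {i : ℕ} (hi : i ≤ n) :
    lift f (x k n i) = f i := by
  cases i with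
  | zero => rw [hf]; exact map_one _
  | succ i =>
    have h : x k n (i + 1) = FreeAlgebra.ι k (⟨i, hi⟩ : Fin n) := dif_pos (show i < n from hi)
    rw [h]
    exact FreeAlgebra.lift_ι_apply _ _

variable {k n} in
theorem hom_ext {B : Type v} [Ring B] [Algebra k B] {F G : NSymm k n →ₐ[k] B}
    (h : ∀ i ≤ n, F (x k n i) = G (x k n i)) : F = G :=
  FreeAlgebra.hom_ext (funext fun i => by
    have h1 : x k n (i + 1) = FreeAlgebra.ι k i := dif_pos i.2
    have := h (i + 1) i.2
    rwa [h1] at this)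

theorem fst_le_of_mem {i : ℕ} {p : ℕ × ℕ} (hp : p ∈ antidiagonal i) : p.1 ≤ i :=
  HasAntidiagonal.mem_antidiagonal.1 hp ▸ Nat.le_add_right _ _

theorem snd_le_of_mem {i : ℕ} {p : ℕ × ℕ} (hp : p ∈ antidiagonal i) : p.2 ≤ i :=
  HasAntidiagonal.mem_antidiagonal.1 hp ▸ Nat.le_add_left _ _

theorem sum_antidiagonal₃ {M : Type u} [AddCommMonoid M] (f : ℕ → ℕ → ℕ → M) (m : ℕ) :
    ∑ p ∈ antidiagonal m, ∑ q ∈ antidiagonal p.1, f q.1 q.2 p.2 =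
      ∑ p ∈ antidiagonal m, ∑ q ∈ antidiagonal p.2, f p.1 q.1 q.2 := by
  rw [sum_sigma', sum_sigma']
  refine sum_nbij' (fun p => ⟨(p.2.1, p.2.2 + p.1.2), (p.2.2, p.1.2)⟩)
    (fun p => ⟨(p.1.1 + p.2.1, p.2.2), (p.1.1, p.2.1)⟩) ?_ ?_ ?_ ?_ ?_ <;>
    rintro ⟨⟨a, b⟩, ⟨c, d⟩⟩ h <;> simp only [mem_sigma, HasAntidiagonal.mem_antidiagonal] at h ⊢
  · exact ⟨by omega, trivial⟩
  · exact ⟨by omega, trivial⟩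
  · obtain ⟨h1, rfl⟩ := h; rfl
  · obtain ⟨h1, rfl⟩ := h; rfl

theorem one_term {i : ℕ} {M : Type u} [AddCommMonoid M] (f : ℕ → ℕ → M) :
    (∑ p ∈ antidiagonal i, if p.1 = 0 then f p.1 p.2 else 0) = f 0 i := by
  rw [sum_eq_single (0, i)]
  · simp
  · rintro ⟨a, b⟩ h h'
    simp only [HasAntidiagonal.mem_antidiagonal] at h
    rw [if_neg]
    rintro rfl
    exact h' (by simpa using h)
  · intro h; simp at h

theorem one_term' {i : ℕ} {M : Type u} [AddCommMonoid M] (f : ℕ → ℕ → M) :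
    (∑ p ∈ antidiagonal i, if p.2 = 0 then f p.1 p.2 else 0) = f i 0 := by
  rw [sum_eq_single (i, 0)]
  · simp
  · rintro ⟨a, b⟩ h h'
    simp only [HasAntidiagonal.mem_antidiagonal] at h
    rw [if_neg]
    rintro rfl
    exact h' (by simpa using h)
  · intro h; simp at h

/-- `Δ(xᵢ) = ∑_{j + l = i} xⱼ ⊗ xₗ` and `ε(xᵢ) = 0` for `1 ≤ i ≤ n`. -/
instance : Bialgebra k (NSymm k n) :=
  have hΔ {i : ℕ} (hi : i ≤ n) : lift (fun i => ∑ p ∈ antidiagonal i, x k n p.1 ⊗ₜ[k] x k n p.2)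
      (x k n i) = ∑ p ∈ antidiagonal i, x k n p.1 ⊗ₜ[k] x k n p.2 :=
    lift_x k n (f := fun i => ∑ p ∈ antidiagonal i, x k n p.1 ⊗ₜ[k] x k n p.2)
      (by simp [x, Algebra.TensorProduct.one_def]) hi
  have hε {i : ℕ} (hi : i ≤ n) : lift (fun i => if i = 0 then 1 else 0) (x k n i) =
      if i = 0 then (1 : k) else 0 :=
    lift_x k n (f := fun i => if i = 0 then (1 : k) else 0) (by simp) hi
  have h1 {i : ℕ} (hi : i ≤ n) {p : ℕ × ℕ} (hp : p ∈ antidiagonal i) : p.1 ≤ n :=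
    (fst_le_of_mem hp).trans hi
  have h2 {i : ℕ} (hi : i ≤ n) {p : ℕ × ℕ} (hp : p ∈ antidiagonal i) : p.2 ≤ n :=
    (snd_le_of_mem hp).trans hi
  Bialgebra.ofAlgHom
    (lift fun i => ∑ p ∈ antidiagonal i, x k n p.1 ⊗ₜ[k] x k n p.2)
    (lift fun i => if i = 0 then 1 else 0)
    (hom_ext fun i hi => by
      simp only [AlgHom.comp_apply, hΔ hi, map_sum, Algebra.TensorProduct.map_tmul,
        AlgHom.id_apply]
      refine (sum_congr rfl fun p hp => ?_).trans
        ((sum_antidiagonal₃ (fun a b c => x k n a ⊗ₜ[k] (x k n b ⊗ₜ[k] x k n c)) i).trans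
          (sum_congr rfl fun p hp => ?_))
      · rw [hΔ (h1 hi hp), TensorProduct.sum_tmul, map_sum]
        rfl
      · rw [hΔ (h2 hi hp), TensorProduct.tmul_sum])
    (hom_ext fun i hi => by
      simp only [AlgHom.comp_apply, hΔ hi, map_sum, Algebra.TensorProduct.map_tmul,
        AlgHom.id_apply]
      rw [sum_congr rfl fun p hp => by rw [hε (h1 hi hp), TensorProduct.ite_tmul]]
      exact one_term fun a b => 1 ⊗ₜ[k] x k n b)
    (hom_ext fun i hi => by
      simp only [AlgHom.comp_apply, hΔ hi, map_sum, Algebra.TensorProduct.map_tmul,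
        AlgHom.id_apply]
      rw [sum_congr rfl fun p hp => by rw [hε (h2 hi hp), TensorProduct.tmul_ite]]
      exact one_term' fun a b => x k n a ⊗ₜ[k] 1)

theorem comul_x {i : ℕ} (hi : i ≤ n) :
    comul (R := k) (x k n i) = ∑ p ∈ antidiagonal i, x k n p.1 ⊗ₜ[k] x k n p.2 :=
  lift_x k n (f := fun i => ∑ p ∈ antidiagonal i, x k n p.1 ⊗ₜ[k] x k n p.2)
    (by simp [x, Algebra.TensorProduct.one_def]) hi

theorem counit_x {i : ℕ} (hi : i ≤ n) : counit (R := k) (x k n i) = if i = 0 then 1 else 0 :=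
  lift_x k n (f := fun i => if i = 0 then (1 : k) else 0) (by simp) hi

/-- The anti-endomorphism with `xᵢ ↦ yᵢ`, where `y = invSeq x`. -/
def antipodeOp : NSymm k n →ₐ[k] (NSymm k n)ᵐᵒᵖ :=
  lift fun i => MulOpposite.op (invSeq (x k n) i)

theorem antipodeOp_x {i : ℕ} (hi : i ≤ n) :
    (antipodeOp k n (x k n i)).unop = invSeq (x k n) i :=
  congrArg MulOpposite.unop (lift_x k n (f := fun i => MulOpposite.op (invSeq (x k n) i))
    (by simp [invSeq_zero]) hi)

theorem adjoin_x : Algebra.adjoin k {y : NSymm k n | ∃ i ≤ n, y = x k n i} = ⊤ := by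
  set A := Algebra.adjoin k {y : NSymm k n | ∃ i ≤ n, y = x k n i}
  have h : A.val.comp (lift fun i =>
      if h : i ≤ n then (⟨x k n i, Algebra.subset_adjoin ⟨i, h, rfl⟩⟩ : A) else 0) =
      AlgHom.id k (NSymm k n) := hom_ext fun i hi => by
    rw [AlgHom.comp_apply, lift_x k n (by simp; rfl) hi, dif_pos hi]
    rfl
  rw [eq_top_iff]
  intro y _
  rw [← AlgHom.id_apply (R := k) y, ← h]
  exact Subtype.property _

/-- `S(xᵢ) = - ∑_{1 ≤ j ≤ i} xⱼ S(xᵢ₋ⱼ)` for `1 ≤ i ≤ n`. -/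
instance : HopfAlgebra k (NSymm k n) :=
  hopfOfGenerators (antipodeOp k n) {y | ∃ i ≤ n, y = x k n i} (adjoin_x k n)
    (by
      rintro _ ⟨i, hi, rfl⟩
      simp only [comul_x k n hi, counit_x k n hi, map_sum, rTensor_tmul, mul'_apply, unopLin_apply]
      rw [sum_congr rfl fun p hp => by rw [antipodeOp_x k n ((fst_le_of_mem hp).trans hi)],
        sum_invSeq_mul _ rfl]
      split_ifs <;> simp)
    (by
      rintro _ ⟨i, hi, rfl⟩
      simp only [comul_x k n hi, counit_x k n hi, map_sum, lTensor_tmul, mul'_apply, unopLin_apply]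
      rw [sum_congr rfl fun p hp => by rw [antipodeOp_x k n ((snd_le_of_mem hp).trans hi)],
        sum_mul_invSeq _ rfl]
      split_ifs <;> simp)

theorem antipode_x {i : ℕ} (hi : i ≤ n) :
    HopfAlgebra.antipode k (x k n i) = invSeq (x k n) i := antipodeOp_x k n hi

/-- The algebra endomorphism with `xᵢ ↦ yᵢ`, where `y = invSeq x`. -/
def phiHom : NSymm k n →ₐ[k] NSymm k n := lift fun i => invSeq (x k n) i

theorem phiHom_x {i : ℕ} (hi : i ≤ n) : phiHom k n (x k n i) = invSeq (x k n) i :=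
  lift_x k n (invSeq_zero _) hi

theorem phiHom_invSeq (i : ℕ) (hi : i ≤ n) : phiHom k n (invSeq (x k n) i) = x k n i := by
  induction i using Nat.strong_induction_on with
  | _ i ih =>
  cases i with
  | zero => rw [invSeq_zero]; exact map_one _
  | succ m =>
    have h := sum_invSeq_mul (x k n) rfl (m + 1)
    rw [Nat.sum_antidiagonal_eq_sum_range_succ (fun i j => invSeq (x k n) i * x k n j),
      sum_range_succ', if_neg (Nat.succ_ne_zero m), invSeq_zero, one_mul, tsub_zero] at h
    rw [invSeq_succ, map_neg, map_sum, neg_eq_iff_eq_neg, ← add_eq_zero_iff_eq_neg, ← h]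
    congr 1
    refine sum_congr rfl fun j hj => ?_
    rw [mem_range] at hj
    rw [map_mul, phiHom_x k n (by omega), ih (m - j) (by omega) (by omega),
      show m + 1 - (j + 1) = m - j by omega]

/-- The automorphism `φ` with `φ(xᵢ) = - ∑_{1 ≤ j ≤ i} xⱼ φ(xᵢ₋ⱼ)` for `1 ≤ i ≤ n`. -/
def phi : NSymm k n ≃ₐ[k] NSymm k n :=
  have h : (phiHom k n).comp (phiHom k n) = AlgHom.id k _ := hom_ext fun i hi => by
    rw [AlgHom.comp_apply, phiHom_x k n hi, phiHom_invSeq k n i hi]; rfl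
  AlgEquiv.ofAlgHom (phiHom k n) (phiHom k n) h h

theorem phi_x {i : ℕ} (hi : i ≤ n) : phi k n (x k n i) = invSeq (x k n) i := phiHom_x k n hi

theorem comul_invSeq {i : ℕ} (hi : i ≤ n) : comul (R := k) (invSeq (x k n) i) =
    ∑ p ∈ antidiagonal i, invSeq (x k n) p.1 ⊗ₜ[k] invSeq (x k n) p.2 := by
  rw [← antipode_x k n hi, comul_antipode, comul_x k n hi]
  simp only [map_sum, TensorProduct.comm_tmul, TensorProduct.map_tmul]
  rw [← Nat.sum_antidiagonal_swap]
  refine sum_congr rfl fun p hp => ?_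
  rw [Prod.fst_swap, Prod.snd_swap, antipode_x k n ((fst_le_of_mem hp).trans hi),
    antipode_x k n ((snd_le_of_mem hp).trans hi)]

theorem comul_phi (y : NSymm k n) : comul (R := k) (phi k n y) =
    TensorProduct.map (phi k n).toLinearMap (phi k n).toLinearMap (comul y) := by
  have : (Bialgebra.comulAlgHom k _).comp (phi k n : NSymm k n →ₐ[k] NSymm k n) =
      (Algebra.TensorProduct.map (phi k n : NSymm k n →ₐ[k] NSymm k n)
        (phi k n : NSymm k n →ₐ[k] NSymm k n)).comp (Bialgebra.comulAlgHom k _) :=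
    hom_ext fun i hi => by
      simp only [AlgHom.comp_apply, Bialgebra.comulAlgHom_apply, AlgEquiv.coe_toAlgHom,
        phi_x k n hi, comul_invSeq k n hi, comul_x k n hi, map_sum, Algebra.TensorProduct.map_tmul]
      refine sum_congr rfl fun p hp => ?_
      rw [phi_x k n ((fst_le_of_mem hp).trans hi),
        phi_x k n ((snd_le_of_mem hp).trans hi)]
  exact AlgHom.congr_fun this y

theorem counit_phi (y : NSymm k n) : counit (R := k) (phi k n y) = counit y := by
  have : (Bialgebra.counitAlgHom k _).comp (phi k n : NSymm k n →ₐ[k] NSymm k n) =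
      Bialgebra.counitAlgHom k _ :=
    hom_ext fun i hi => by
      simp only [AlgHom.comp_apply, Bialgebra.counitAlgHom_apply, AlgEquiv.coe_toAlgHom,
        phi_x k n hi]
      rw [← antipode_x k n hi, HopfAlgebra.counit_antipode]
  exact AlgHom.congr_fun this y

end NSymm
end NSymm

section FreeProducts

open Coalgebra LinearMap

variable (k : Type u) [Field k] (I : Type) [DecidableEq I] (A : Type u) [Ring A]

/-- The free product of copies of the algebra `A`, indexed by `I`. -/
def FreePow [Algebra k A] : Type u := LinearAlgebra.FreeProduct k fun _ : I => A

namespace FreePow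

section Alg

variable [Algebra k A]

instance : Ring (FreePow k I A) := inferInstanceAs (Ring (LinearAlgebra.FreeProduct k fun _ : I => A))
instance : Algebra k (FreePow k I A) :=
  inferInstanceAs (Algebra k (LinearAlgebra.FreeProduct k fun _ : I => A))

/-- The inclusion of the copy with index `i`. -/
def inc (i : I) : A →ₐ[k] FreePow k I A := LinearAlgebra.FreeProduct.ι k (fun _ : I => A) i

variable {k I A}

/-- The algebra homomorphism given by algebra homomorphisms on the copies of `A`. -/
def lift {B : Type v} [Ring B] [Algebra k B] (f : I → A →ₐ[k] B) : FreePow k I A →ₐ[k] B :=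
  LinearAlgebra.FreeProduct.lift k (fun _ : I => A) fun {i} => f i

@[simp] theorem lift_inc {B : Type v} [Ring B] [Algebra k B] (f : I → A →ₐ[k] B) (i : I) (a : A) :
    lift f (inc k I A i a) = f i a :=
  AlgHom.congr_fun (LinearAlgebra.FreeProduct.lift_comp_ι k (fun _ : I => A)
    (maps := fun {i} => f i)) a

theorem hom_ext {B : Type v} [Ring B] [Algebra k B] {F G : FreePow k I A →ₐ[k] B}
    (h : ∀ i a, F (inc k I A i a) = G (inc k I A i a)) : F = G :=
  (LinearAlgebra.FreeProduct.lift_unique k (fun _ : I => A)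
    (maps := fun {i} => G.comp (inc k I A i)) F fun i => AlgHom.ext (h i)).trans
  (LinearAlgebra.FreeProduct.lift_unique k (fun _ : I => A)
    (maps := fun {i} => G.comp (inc k I A i)) G fun _ => rfl).symm

variable (k I A) in
theorem adjoin_inc : Algebra.adjoin k {y : FreePow k I A | ∃ i a, y = inc k I A i a} = ⊤ := by
  set S := Algebra.adjoin k {y : FreePow k I A | ∃ i a, y = inc k I A i a}
  have h : S.val.comp (lift fun i => (inc k I A i).codRestrict S fun a =>
      Algebra.subset_adjoin ⟨i, a, rfl⟩) = AlgHom.id k (FreePow k I A) := hom_ext fun i a => by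
    rw [AlgHom.comp_apply, lift_inc]
    rfl
  rw [eq_top_iff]
  intro y _
  rw [← AlgHom.id_apply (R := k) y, ← h]
  exact Subtype.property _

end Alg

/-- The copies of `A` are subbialgebras. -/
instance [Bialgebra k A] : Bialgebra k (FreePow k I A) :=
  Bialgebra.ofAlgHom
    (lift fun i => (Algebra.TensorProduct.map (inc k I A i) (inc k I A i)).comp
      (Bialgebra.comulAlgHom k A))
    (lift fun _ => Bialgebra.counitAlgHom k A)
    (hom_ext fun i a => by
      simp only [AlgHom.comp_apply, lift_inc, Bialgebra.comulAlgHom_apply]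
      have h' := congrArg (TensorProduct.map (inc k I A i).toLinearMap
        (TensorProduct.map (inc k I A i).toLinearMap (inc k I A i).toLinearMap))
          (coassoc_apply (R := k) a)
      refine Eq.trans ?_ (h'.trans ?_)
      · clear h'
        generalize (comul a : A ⊗[k] A) = t
        induction t with
        | zero => simp
        | add p q hp hq => simp only [map_add, hp, hq]
        | tmul x y =>
          simp only [rTensor_tmul, Algebra.TensorProduct.map_tmul, lift_inc,
            AlgHom.id_apply, AlgHom.comp_apply, Bialgebra.comulAlgHom_apply]
          generalize (comul x : A ⊗[k] A) = t
          induction t with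
          | zero => simp
          | add p q hp hq => simp only [map_add, TensorProduct.add_tmul, hp, hq]
          | tmul x y => simp
      · clear h'
        generalize (comul a : A ⊗[k] A) = t
        induction t with
        | zero => simp
        | add p q hp hq => simp only [map_add, hp, hq]
        | tmul x y =>
          simp only [TensorProduct.map_tmul, lTensor_tmul, Algebra.TensorProduct.map_tmul, lift_inc,
            AlgHom.id_apply, AlgHom.comp_apply, Bialgebra.comulAlgHom_apply]
          rfl)
    (hom_ext fun i a => by
      simp only [AlgHom.comp_apply, lift_inc, Bialgebra.comulAlgHom_apply]
      have h' := congrArg ((inc k I A i).toLinearMap.lTensor k) (rTensor_counit_comul (R := k) a)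
      refine Eq.trans ?_ (h'.trans ?_)
      · clear h'
        generalize (comul a : A ⊗[k] A) = t
        induction t with
        | zero => simp
        | add p q hp hq => simp only [map_add, hp, hq]
        | tmul x y => simp
      · simp)
    (hom_ext fun i a => by
      simp only [AlgHom.comp_apply, lift_inc, Bialgebra.comulAlgHom_apply]
      have h' := congrArg ((inc k I A i).toLinearMap.rTensor k) (lTensor_counit_comul (R := k) a)
      refine Eq.trans ?_ (h'.trans ?_)
      · clear h'
        generalize (comul a : A ⊗[k] A) = t
        induction t with
        | zero => simp
        | add p q hp hq => simp only [map_add, hp, hq]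
        | tmul x y => simp
      · simp)

theorem comul_inc [Bialgebra k A] (i : I) (a : A) : comul (R := k) (inc k I A i a) =
    TensorProduct.map (inc k I A i).toLinearMap (inc k I A i).toLinearMap (comul a) :=
  lift_inc (fun i => (Algebra.TensorProduct.map (inc k I A i) (inc k I A i)).comp
      (Bialgebra.comulAlgHom k A)) i a

theorem counit_inc [Bialgebra k A] (i : I) (a : A) :
    counit (R := k) (inc k I A i a) = counit a :=
  lift_inc (fun _ => Bialgebra.counitAlgHom k A) i a

/-- The anti-endomorphism which restricts to the antipode on the copies of `A`. -/
def antipodeOp [HopfAlgebra k A] : FreePow k I A →ₐ[k] (FreePow k I A)ᵐᵒᵖ :=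
  lift fun i => (AlgHom.op (inc k I A i)).comp (HopfAlgebra.antipodeAlgHomOp k A)

theorem antipodeOp_inc [HopfAlgebra k A] (i : I) : unopLin (antipodeOp k I A) ∘ₗ
    (inc k I A i).toLinearMap = (inc k I A i).toLinearMap ∘ₗ HopfAlgebra.antipode k := by
  ext a
  exact congrArg MulOpposite.unop (lift_inc
    (fun i => (AlgHom.op (inc k I A i)).comp (HopfAlgebra.antipodeAlgHomOp k A)) i a)

instance [HopfAlgebra k A] : HopfAlgebra k (FreePow k I A) :=
  hopfOfGenerators (antipodeOp k I A) {y | ∃ i a, y = inc k I A i a} (adjoin_inc k I A)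
    (by
      rintro _ ⟨i, a, rfl⟩
      rw [comul_inc, counit_inc, ← LinearMap.comp_apply (rTensor _ _), rTensor_comp_map,
        antipodeOp_inc, ← (inc k I A i).commutes, ← HopfAlgebra.mul_antipode_rTensor_comul_apply]
      generalize (comul a : A ⊗[k] A) = t
      induction t with
      | zero => simp
      | add p q hp hq => simp only [map_add, hp, hq]
      | tmul x y => simp)
    (by
      rintro _ ⟨i, a, rfl⟩
      rw [comul_inc, counit_inc, ← LinearMap.comp_apply (lTensor _ _), lTensor_comp_map,
        antipodeOp_inc, ← (inc k I A i).commutes, ← HopfAlgebra.mul_antipode_lTensor_comul_apply]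
      generalize (comul a : A ⊗[k] A) = t
      induction t with
      | zero => simp
      | add p q hp hq => simp only [map_add, hp, hq]
      | tmul x y => simp)

end FreePow

end FreeProducts

section Smash

open Coalgebra LinearMap SkewMonoidAlgebra

variable (k : Type u) [Field k] (A : Type u) [Ring A] (G : Type) [Group G]
  [MulSemiringAction G A]

/-- A group acts on a bialgebra by automorphisms of bialgebras. -/
class BialgAction [Bialgebra k A] [SMulCommClass G k A] : Prop where
  comul_smul : ∀ (g : G) (a : A), comul (R := k) (g • a) =
    TensorProduct.map (DistribSMul.toLinearMap k A g) (DistribSMul.toLinearMap k A g) (comul a)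
  counit_smul : ∀ (g : G) (a : A), counit (R := k) (g • a) = counit a

/-- The smash product `A # k[G]`: formal sums of the elements `a g` for `a ∈ A` and `g ∈ G`, with
multiplication `(a g) (b h) = (a (g • b)) (g h)`. -/
abbrev Smash : Type u := SkewMonoidAlgebra A G

namespace Smash

section Alg

variable [Algebra k A] [SMulCommClass G k A]

/-- The inclusion of `A`. -/
def inA : A →ₐ[k] Smash A G where
  toFun a := single 1 a
  map_one' := rfl
  map_mul' a b := by rw [single_mul_single, one_smul, one_mul]
  map_zero' := single_zero 1
  map_add' := single_add 1
  commutes' _ := rfl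

/-- The inclusion of `G`. -/
def inG : G →* Smash A G where
  toFun g := single g 1
  map_one' := rfl
  map_mul' g h := by rw [single_mul_single, smul_one, mul_one]

theorem single_eq (g : G) (a : A) : single g a = inA k A G a * inG A G g := by
  change _ = single 1 a * single g 1
  rw [single_mul_single, one_smul, one_mul, mul_one]

theorem inG_mul_inA (g : G) (a : A) : inG A G g * inA k A G a = inA k A G (g • a) * inG A G g := by
  rw [← single_eq]
  change single g 1 * single 1 a = _
  rw [single_mul_single, one_mul, mul_one]

variable {k A G} {B : Type v} [Ring B] [Algebra k B]

/-- The algebra homomorphism given by compatible homomorphisms on `A` and `G`. -/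
def lift (f : A →ₐ[k] B) (γ : G →* B) (h : ∀ g a, γ g * f a = f (g • a) * γ g) :
    Smash A G →ₐ[k] B := liftNCAlgHom f γ fun {a g} => (h g a).symm

theorem lift_single (f : A →ₐ[k] B) (γ : G →* B) (h : ∀ g a, γ g * f a = f (g • a) * γ g)
    (g : G) (a : A) : lift f γ h (single g a) = f a * γ g :=
  liftNC_single _ _ _ _

@[simp] theorem lift_inA (f : A →ₐ[k] B) (γ : G →* B) (h : ∀ g a, γ g * f a = f (g • a) * γ g)
    (a : A) : lift f γ h (inA k A G a) = f a :=
  (lift_single f γ h 1 a).trans (by rw [map_one, mul_one])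

@[simp] theorem lift_inG (f : A →ₐ[k] B) (γ : G →* B) (h : ∀ g a, γ g * f a = f (g • a) * γ g)
    (g : G) : lift f γ h (inG A G g) = γ g :=
  (lift_single f γ h g 1).trans (by rw [map_one, one_mul])

theorem hom_ext {F F' : Smash A G →ₐ[k] B} (h1 : ∀ a, F (inA k A G a) = F' (inA k A G a))
    (h2 : ∀ g, F (inG A G g) = F' (inG A G g)) : F = F' := by
  have : (F : Smash A G →+ B) = (F' : Smash A G →+ B) := addHom_ext fun g a => by
    change F (single g a) = F' (single g a)
    rw [single_eq k A G, map_mul, map_mul, h1, h2]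
  exact AlgHom.ext fun x => DFunLike.congr_fun this x

variable (k A G) in
theorem adjoin_eq : Algebra.adjoin k
    ({y : Smash A G | ∃ a, y = inA k A G a} ∪ {y | ∃ g, y = inG A G g}) = ⊤ := by
  rw [eq_top_iff]
  intro y _
  induction y using SkewMonoidAlgebra.induction_on with
  | zero => exact zero_mem _
  | single g a =>
    rw [single_eq k A G]
    exact mul_mem (Algebra.subset_adjoin (Or.inl ⟨a, rfl⟩)) (Algebra.subset_adjoin (Or.inr ⟨g, rfl⟩))
  | add f g hf hg => exact add_mem (hf trivial) (hg trivial)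

end Alg

section Bialg

variable [Bialgebra k A] [SMulCommClass G k A] [BialgAction k A G]

/-- The comultiplication `a g ↦ ∑ a₁ g ⊗ a₂ g`. -/
def comulHom : Smash A G →ₐ[k] Smash A G ⊗[k] Smash A G :=
  lift ((Algebra.TensorProduct.map (inA k A G) (inA k A G)).comp (Bialgebra.comulAlgHom k A))
    { toFun := fun g => inG A G g ⊗ₜ[k] inG A G g
      map_one' := by simp [Algebra.TensorProduct.one_def]
      map_mul' := fun g h => by rw [map_mul, Algebra.TensorProduct.tmul_mul_tmul] }
    (fun g a => by
      simp only [AlgHom.comp_apply, Bialgebra.comulAlgHom_apply, MonoidHom.coe_mk, OneHom.coe_mk,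
        BialgAction.comul_smul]
      generalize (comul a : A ⊗[k] A) = t
      induction t with
      | zero => simp
      | add p q hp hq => simp only [map_add, mul_add, add_mul, hp, hq]
      | tmul x y => simp [inG_mul_inA])

/-- The counit `a g ↦ ε(a)`. -/
def counitHom : Smash A G →ₐ[k] k :=
  lift (Bialgebra.counitAlgHom k A) 1 (fun g a => by simp [BialgAction.counit_smul])

theorem comulHom_inA (a : A) : comulHom k A G (inA k A G a) =
    TensorProduct.map (inA k A G).toLinearMap (inA k A G).toLinearMap (comul a) := lift_inA _ _ _ a

theorem comulHom_inG (g : G) : comulHom k A G (inG A G g) = inG A G g ⊗ₜ inG A G g :=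
  lift_inG _ _ _ g

theorem counitHom_inA (a : A) : counitHom k A G (inA k A G a) = counit a := lift_inA _ _ _ a

theorem counitHom_inG (g : G) : counitHom k A G (inG A G g) = 1 := lift_inG _ _ _ g

instance : Bialgebra k (Smash A G) :=
  Bialgebra.ofAlgHom (comulHom k A G) (counitHom k A G)
    (hom_ext (fun a => by
      simp only [AlgHom.comp_apply, comulHom_inA]
      have h' := congrArg (TensorProduct.map (inA k A G).toLinearMap
        (TensorProduct.map (inA k A G).toLinearMap (inA k A G).toLinearMap))
          (coassoc_apply (R := k) a)
      refine Eq.trans ?_ (h'.trans ?_)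
      · clear h'
        generalize (comul a : A ⊗[k] A) = t
        induction t with
        | zero => simp
        | add p q hp hq => simp only [map_add, hp, hq]
        | tmul x y =>
          simp only [rTensor_tmul, TensorProduct.map_tmul, Algebra.TensorProduct.map_tmul,
            AlgHom.toLinearMap_apply, AlgHom.id_apply, comulHom_inA]
          generalize (comul x : A ⊗[k] A) = t
          induction t with
          | zero => simp
          | add p q hp hq => simp only [map_add, TensorProduct.add_tmul, hp, hq]
          | tmul x y => simp
      · clear h'
        generalize (comul a : A ⊗[k] A) = t
        induction t with
        | zero => simp
        | add p q hp hq => simp only [map_add, hp, hq]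
        | tmul x y =>
          simp only [TensorProduct.map_tmul, lTensor_tmul, Algebra.TensorProduct.map_tmul,
            AlgHom.toLinearMap_apply, AlgHom.id_apply, comulHom_inA])
      (fun g => by simp [comulHom_inG]))
    (hom_ext (fun a => by
      simp only [AlgHom.comp_apply, comulHom_inA]
      have h' := congrArg ((inA k A G).toLinearMap.lTensor k) (rTensor_counit_comul (R := k) a)
      refine Eq.trans ?_ (h'.trans ?_)
      · clear h'
        generalize (comul a : A ⊗[k] A) = t
        induction t with
        | zero => simp
        | add p q hp hq => simp only [map_add, hp, hq]
        | tmul x y => simp [counitHom_inA]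
      · simp)
      (fun g => by simp [comulHom_inG, counitHom_inG]))
    (hom_ext (fun a => by
      simp only [AlgHom.comp_apply, comulHom_inA]
      have h' := congrArg ((inA k A G).toLinearMap.rTensor k) (lTensor_counit_comul (R := k) a)
      refine Eq.trans ?_ (h'.trans ?_)
      · clear h'
        generalize (comul a : A ⊗[k] A) = t
        induction t with
        | zero => simp
        | add p q hp hq => simp only [map_add, hp, hq]
        | tmul x y => simp [counitHom_inA]
      · simp)
      (fun g => by simp [comulHom_inG, counitHom_inG]))

end Bialg

section Hopf

open HopfAlgebra

variable [HopfAlgebra k A] [SMulCommClass G k A] [BialgAction k A G]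

variable {k A G} in
theorem antipode_smul (g : G) (a : A) : antipode k (g • a) = g • antipode k a := by
  let γ : A →ₗ[k] A := DistribSMul.toLinearMap k A g
  have e1 : WithConv.toConv (antipode k ∘ₗ γ) * WithConv.toConv γ = 1 := by
    apply WithConv.ext
    ext a
    have := mul_antipode_rTensor_comul_apply (R := k) (g • a)
    rw [BialgAction.comul_smul, BialgAction.counit_smul, ← LinearMap.comp_apply (rTensor _ _),
      rTensor_comp_map] at this
    exact this
  have e2 : WithConv.toConv γ * WithConv.toConv (γ ∘ₗ antipode k) = 1 := by
    apply WithConv.ext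
    ext a
    have := congrArg γ (mul_antipode_lTensor_comul_apply (R := k) a)
    refine Eq.trans ?_ (this.trans ?_)
    · change mul' k A (TensorProduct.map γ (γ ∘ₗ antipode k) (comul a)) = _
      generalize (comul a : A ⊗[k] A) = t
      induction t with
      | zero => simp
      | add p q hp hq => simp only [map_add, hp, hq]
      | tmul x y => simp [γ]
    · exact smul_algebraMap g _
  exact LinearMap.congr_fun (WithConv.toConv_injective (left_inv_eq_right_inv e1 e2)) a

/-- The antipode `a g ↦ g⁻¹ S(a)`. -/
def antipodeOp : Smash A G →ₐ[k] (Smash A G)ᵐᵒᵖ :=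
  lift ((AlgHom.op (inA k A G)).comp (antipodeAlgHomOp k A))
    { toFun := fun g => MulOpposite.op (inG A G g⁻¹)
      map_one' := by simp
      map_mul' := fun g h => by rw [mul_inv_rev, map_mul, MulOpposite.op_mul] }
    (fun g a => by
      apply MulOpposite.unop_injective
      have := inG_mul_inA k A G g⁻¹ (antipode k (g • a))
      rw [antipode_smul, inv_smul_smul] at this
      simpa [antipode_smul] using this.symm)

theorem antipodeOp_inA (a : A) : (antipodeOp k A G (inA k A G a)).unop =
    inA k A G (antipode k a) := congrArg MulOpposite.unop (lift_inA _ _ _ a)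

theorem antipodeOp_inG (g : G) : (antipodeOp k A G (inG A G g)).unop = inG A G g⁻¹ :=
  congrArg MulOpposite.unop (lift_inG _ _ _ g)

instance : HopfAlgebra k (Smash A G) :=
  hopfOfGenerators (antipodeOp k A G) ({y | ∃ a, y = inA k A G a} ∪ {y | ∃ g, y = inG A G g})
    (adjoin_eq k A G)
    (by
      rintro _ (⟨a, rfl⟩ | ⟨g, rfl⟩)
      · change mul' k _ (rTensor _ _ (comulHom k A G _)) = algebraMap k _ (counitHom k A G _)
        rw [comulHom_inA, counitHom_inA, ← (inA k A G).commutes, ← mul_antipode_rTensor_comul_apply]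
        generalize (comul a : A ⊗[k] A) = t
        induction t with
        | zero => simp
        | add p q hp hq => simp only [map_add, hp, hq]
        | tmul x y => simp [antipodeOp_inA]
      · change mul' k _ (rTensor _ _ (comulHom k A G _)) = algebraMap k _ (counitHom k A G _)
        rw [comulHom_inG, counitHom_inG]
        simp [antipodeOp_inG, ← map_mul])
    (by
      rintro _ (⟨a, rfl⟩ | ⟨g, rfl⟩)
      · change mul' k _ (lTensor _ _ (comulHom k A G _)) = algebraMap k _ (counitHom k A G _)
        rw [comulHom_inA, counitHom_inA, ← (inA k A G).commutes, ← mul_antipode_lTensor_comul_apply]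
        generalize (comul a : A ⊗[k] A) = t
        induction t with
        | zero => simp
        | add p q hp hq => simp only [map_add, hp, hq]
        | tmul x y => simp [antipodeOp_inA]
      · change mul' k _ (lTensor _ _ (comulHom k A G _)) = algebraMap k _ (counitHom k A G _)
        rw [comulHom_inG, counitHom_inG]
        simp [antipodeOp_inG, ← map_mul])

end Hopf

end Smash

end Smash

section FNSymm

open Coalgebra LinearMap

variable (k : Type u) [Field k] (n : ℕ)

/-- The free product of copies `NSymm(n)^{[s]}` of `NSymm(n)`, indexed by `s ∈ ℤ`. -/
abbrev FNSymm : Type u := FreePow k ℤ (NSymm k n)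

namespace FNSymm

/-- The endomorphism `g^a h^b`, that sends `x_i^{[s]}` to `φ^{a+b}(x_i^{[s+a-b]})`. -/
def act (a b : ℤ) : FNSymm k n →ₐ[k] FNSymm k n :=
  FreePow.lift fun s => (FreePow.inc k ℤ (NSymm k n) (s + a - b)).comp
    ((NSymm.phi k n ^ (a + b) : NSymm k n ≃ₐ[k] NSymm k n) : NSymm k n →ₐ[k] NSymm k n)

theorem act_inc (a b s : ℤ) (y : NSymm k n) : act k n a b (FreePow.inc k ℤ (NSymm k n) s y) =
    FreePow.inc k ℤ (NSymm k n) (s + a - b) ((NSymm.phi k n ^ (a + b)) y) :=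
  FreePow.lift_inc _ s y

theorem act_zero : act k n 0 0 = AlgHom.id k _ := FreePow.hom_ext fun s y => by
  rw [act_inc]; simp

theorem act_add (a b c d : ℤ) : act k n (a + c) (b + d) = (act k n a b).comp (act k n c d) :=
  FreePow.hom_ext fun s y => by
    rw [AlgHom.comp_apply, act_inc, act_inc, act_inc, ← AlgEquiv.mul_apply, ← zpow_add,
      show s + (a + c) - (b + d) = s + c - d + a - b by ring,
      show a + c + (b + d) = a + b + (c + d) by ring]

/-- The element `(a, b)` of `ℤ × ℤ` (written multiplicatively, `g^a h^b`) acts by `act a b`. -/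
instance : MulSemiringAction (Multiplicative (ℤ × ℤ)) (FNSymm k n) where
  smul p y := act k n p.toAdd.1 p.toAdd.2 y
  one_smul y := AlgHom.congr_fun (act_zero k n) y
  mul_smul _ _ y := AlgHom.congr_fun (act_add k n _ _ _ _) y
  smul_zero _ := map_zero (act k n _ _)
  smul_add _ := map_add (act k n _ _)
  smul_one _ := map_one (act k n _ _)
  smul_mul _ := map_mul (act k n _ _)

/-- The element `a` of `ℤ` acts by `g^a`; as `g h` acts trivially, this is the action of the quotient
of `ℤ × ℤ` by the relation `g h = 1`. -/
instance : MulSemiringAction (Multiplicative ℤ) (FNSymm k n) where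
  smul p y := act k n p.toAdd 0 y
  one_smul y := AlgHom.congr_fun (act_zero k n) y
  mul_smul _ _ y := AlgHom.congr_fun (act_add k n _ 0 _ 0) y
  smul_zero _ := map_zero (act k n _ _)
  smul_add _ := map_add (act k n _ _)
  smul_one _ := map_one (act k n _ _)
  smul_mul _ := map_mul (act k n _ _)

instance : SMulCommClass (Multiplicative (ℤ × ℤ)) k (FNSymm k n) where
  smul_comm _ c y := map_smul (act k n _ _) c y

instance : SMulCommClass (Multiplicative ℤ) k (FNSymm k n) where
  smul_comm _ c y := map_smul (act k n _ _) c y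

theorem phi_zpow (a : ℤ) : NSymm.phi k n ^ a = 1 ∨ NSymm.phi k n ^ a = NSymm.phi k n := by
  have h : NSymm.phi k n ^ (2 : ℤ) = 1 :=
    AlgEquiv.ext fun y => (NSymm.phi k n).apply_symm_apply y
  obtain ⟨c, rfl | rfl⟩ := Int.even_or_odd' a
  · left; rw [zpow_mul, h, one_zpow]
  · right; rw [zpow_add, zpow_mul, h, one_zpow, one_mul, zpow_one]

theorem comul_phi_zpow (a : ℤ) (y : NSymm k n) : comul (R := k) ((NSymm.phi k n ^ a) y) =
    TensorProduct.map (NSymm.phi k n ^ a).toLinearMap (NSymm.phi k n ^ a).toLinearMap (comul y) := by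
  obtain h | h := phi_zpow k n a <;> rw [h]
  · exact (LinearMap.congr_fun TensorProduct.map_id _).symm
  · exact NSymm.comul_phi k n y

theorem counit_phi_zpow (a : ℤ) (y : NSymm k n) :
    counit (R := k) ((NSymm.phi k n ^ a) y) = counit y := by
  obtain h | h := phi_zpow k n a <;> rw [h]
  · rfl
  · exact NSymm.counit_phi k n y

theorem comul_act (a b : ℤ) (y : FNSymm k n) : comul (R := k) (act k n a b y) =
    TensorProduct.map (act k n a b).toLinearMap (act k n a b).toLinearMap (comul y) := by
  have : (Bialgebra.comulAlgHom k _).comp (act k n a b) =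
      (Algebra.TensorProduct.map (act k n a b) (act k n a b)).comp (Bialgebra.comulAlgHom k _) :=
    FreePow.hom_ext fun s y => by
      simp only [AlgHom.comp_apply, Bialgebra.comulAlgHom_apply, act_inc, FreePow.comul_inc,
        comul_phi_zpow]
      generalize (comul y : NSymm k n ⊗[k] NSymm k n) = t
      induction t with
      | zero => simp
      | add p q hp hq => simp only [map_add, hp, hq]
      | tmul x y => simp [act_inc]
  exact AlgHom.congr_fun this y

theorem counit_act (a b : ℤ) (y : FNSymm k n) : counit (R := k) (act k n a b y) = counit y := by
  have : (Bialgebra.counitAlgHom k _).comp (act k n a b) = Bialgebra.counitAlgHom k _ :=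
    FreePow.hom_ext fun s y => by
      simp only [AlgHom.comp_apply, Bialgebra.counitAlgHom_apply, act_inc, FreePow.counit_inc,
        counit_phi_zpow]
  exact AlgHom.congr_fun this y

instance : BialgAction k (FNSymm k n) (Multiplicative (ℤ × ℤ)) where
  comul_smul _ y := comul_act k n _ _ y
  counit_smul _ y := counit_act k n _ _ y

instance : BialgAction k (FNSymm k n) (Multiplicative ℤ) where
  comul_smul _ y := comul_act k n _ _ y
  counit_smul _ y := counit_act k n _ _ y

end FNSymm

end FNSymm

end QG

end

noncomputable section

namespace QG

/-! ### Hopf envelopes, Hopf quotients and checks on generators -/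

section HopfGeneral

open Coalgebra LinearMap HopfAlgebra

variable {k : Type u} [Field k]

/-! Write `r = n + 1`, `E = Dmat r q`, let `a` be the generic matrix over `O_A(GL)`, and let `D` be
the quantum determinant, so that `a E aᵀ = E D`. Let `K` be either of the two Hopf quotients and `T`
the corresponding smash product. The inverse system turns out to be constant: a single map `K → T`
induces isomorphisms `K_m ≅ T` for every `m ≥ 1`, compatible with the transition maps, so `T` is the
limit (`sInftyLimit_of_bijective`).

The codeterminant is `D`. A bar 2-cocycle on `A(E)` that vanishes on the single relation is a
coboundary (`QuadAlg.exists_eq_barD₁`), and the coaction multiplies the value of a cocycle on the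
relation by `D`. Hence `D` is a homological codeterminant. A product of two derivations gives a
cocycle with nonzero value on the relation, whence uniqueness (`isHomCodet_qdetGL`,
`eq_qdetGL_of_isHomCodet`). Thus `D` becomes central in `O^c_A(GL)` and `1` in `O_A(SL)`.

Once `D` is central, `a E aᵀ = E D` forces `S²(a) = M a M⁻¹` with `M = E E⁻ᵀ = diag(B⁻ᵀ, B)`
(`map_antipode_sq_mul`). In `K_m` the matrix `a` therefore commutes with `M^m`. The blocks of `M`
have the single eigenvalues `q⁻¹` and `q`. Since `q^{2m} ≠ 1`, the off-diagonal blocks of `a`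
vanish. In characteristic zero, commuting with a power of an invertible scalar plus a nilpotent
implies commuting with the element itself, so the diagonal blocks commute with `Bᵀ` and `B`, hence
are Toeplitz (`exists_toeplitz`). Toeplitz matrices are power series truncated after degree `n`, and
the relation says that the two series `b`, `c` satisfy `b c = D`.

This is also a description of `T`. There `b_l = x_l^{[0]} g` and `c_l = x_l^{[-1]} h`; moving `g`
past copy `-1` applies `φ`, which replaces the series of the `x_l` by its inverse, so `b c = g h`.
Conversely, `x_l^{[0]} = b_l b_0⁻¹`, and the other copies are conjugates of copy `0` by powers of
`g`, up to `φ`. So `b`, `c` in `K_m` define a map `T → K_m` inverse to the induced one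
(`IsShiftAction.bijective_sQuotLift`). The map `K → T` factors through `K_m` because the antipode of
`T` is involutive. Both groups, `ℤ × ℤ` with `g h` central and `ℤ` with `g h = 1`, are treated
together through `IsShiftAction`. -/

/-- An algebra homomorphism from the Hopf envelope is determined by its restriction to the
bialgebra. -/
theorem HopfEnvelope.algHom_ext_ι {B : Type u} [Ring B] [Bialgebra k B] {Q : Type v} [Ring Q]
    [Algebra k Q] {F G : HopfEnvelope k B →ₐ[k] Q}
    (h : ∀ b, F (HopfEnvelope.ι k B b) = G (HopfEnvelope.ι k B b)) : F = G := by
  refine HopfEnvelope.algHom_ext fun i => ?_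
  induction i with
  | zero => exact h
  | succ i ih =>
    -- Copy `i + 1` is the convolution inverse of copy `i`, for the coalgebra structure flipped when
    -- `i` is odd. Algebra homomorphisms preserve convolution inverses, and these are unique, so
    -- agreement on copy `i` propagates to copy `i + 1`.
    let := twCoalgebra k B i
    have key (T T' : HopfEnvelope k B →ₐ[k] Q) :
        (WithConv.toConv (T.toLinearMap ∘ₗ HopfEnvelope.j k B (i + 1)) *
          WithConv.toConv (T.toLinearMap ∘ₗ HopfEnvelope.j k B i) = 1) ∧
        (WithConv.toConv (T.toLinearMap ∘ₗ HopfEnvelope.j k B i) *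
          WithConv.toConv (T.toLinearMap ∘ₗ HopfEnvelope.j k B (i + 1)) = 1) := by
      constructor
      · have h1 := algHom_comp_convMul_distrib T (WithConv.toConv (HopfEnvelope.j k B (i + 1)))
          (WithConv.toConv (HopfEnvelope.j k B i))
        rw [HopfEnvelope.j_conv_left] at h1
        apply WithConv.ext
        refine h1.symm.trans ?_
        ext x
        simp
      · have h1 := algHom_comp_convMul_distrib T (WithConv.toConv (HopfEnvelope.j k B i))
          (WithConv.toConv (HopfEnvelope.j k B (i + 1)))
        rw [HopfEnvelope.j_conv_right] at h1
        apply WithConv.ext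
        refine h1.symm.trans ?_
        ext x
        simp
    have e : F.toLinearMap ∘ₗ HopfEnvelope.j k B i = G.toLinearMap ∘ₗ HopfEnvelope.j k B i :=
      LinearMap.ext ih
    have h1 := (key F F).1
    have h2 := (key G G).2
    rw [e] at h1
    intro b
    exact LinearMap.congr_fun (WithConv.toConv_injective (left_inv_eq_right_inv h1 h2)) b

/-- The homomorphism of bialgebras induced on the quotient by an ideal that is also a coideal. -/
def quotLift {H : Type v} [Ring H] [Bialgebra k H] {T : Type w} [Ring T] [Bialgebra k T] (s : Set H)
    [((idealOf s).restrictScalars k).IsCoideal] (F : H →ₐc[k] T) (h : ∀ x ∈ s, F x = 0) :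
    (H ⧸ idealOf s) →ₐc[k] T :=
  BialgHom.ofAlgHom (Ideal.Quotient.liftₐ (idealOf s) (F : H →ₐ[k] T)
      fun _ hx => idealOf_map_eq_zero (F : H →+* T) h hx)
    (Ideal.Quotient.algHom_ext k (AlgHom.ext fun x => CoalgHomClass.counit_comp_apply F x))
    (Ideal.Quotient.algHom_ext k (AlgHom.ext fun x => by
      refine Eq.trans ?_ (CoalgHomClass.map_comp_comul_apply F x)
      change Algebra.TensorProduct.map _ _ (Algebra.TensorProduct.map
        (Ideal.Quotient.mkₐ k (idealOf s)) (Ideal.Quotient.mkₐ k (idealOf s)) (comul x)) = _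
      generalize (comul x : H ⊗[k] H) = t
      induction t with
      | zero => simp
      | add p q hp hq => simp only [map_add, hp, hq]
      | tmul x y => rfl))

/-- The projection to the quotient by an ideal that is also a coideal. -/
def quotProj {H : Type v} [Ring H] [Bialgebra k H] (s : Set H)
    [((idealOf s).restrictScalars k).IsCoideal] : H →ₐc[k] (H ⧸ idealOf s) :=
  BialgHom.ofAlgHom (Ideal.Quotient.mkₐ k (idealOf s)) (AlgHom.ext fun _ => rfl)
    (AlgHom.ext fun _ => rfl)

/-- The antipode is involutive if it is so on algebra generators. -/
theorem antipode_antipode_of_adjoin {H : Type v} [Ring H] [HopfAlgebra k H] {G : Set H}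
    (hG : Algebra.adjoin k G = ⊤) (h : ∀ x ∈ G, antipode k (antipode k x) = x) (x : H) :
    antipode k (antipode k x) = x := by
  have hx : x ∈ Algebra.adjoin k G := hG ▸ Algebra.mem_top
  induction hx using Algebra.adjoin_induction with
  | mem x hx => exact h x hx
  | algebraMap r => simp [Algebra.algebraMap_eq_smul_one, antipode_one]
  | add x y _ _ hx hy => simp only [map_add, hx, hy]
  | mul x y _ _ hx hy =>
    rw [antipode_mul_antidistrib, antipode_mul_antidistrib, hx, hy]

end HopfGeneral

/-! ### Limits of constant systems -/

section Limit

variable {k : Type u} [Field k] {H : Type u} [Ring H] [HopfAlgebra k H]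

/-- If a homomorphism of Hopf algebras induces isomorphisms on all the quotients in which a power of
the square of the antipode is trivial, then its target is the projective limit of these
quotients. -/
theorem sInftyLimit_of_bijective {T : Type u} [Ring T] [HopfAlgebra k T]
    (Φ : ∀ m : ℕ+, SQuot k H m →ₐc[k] T) (hΦ : ∀ m, Function.Bijective (Φ m))
    (hc : ∀ (m m' : ℕ+) (h : (m : ℕ) ∣ m') (x : SQuot k H m'), Φ m (sTrans k H h x) = Φ m' x) :
    (∃ (L : Type u) (_ : Ring L) (_ : HopfAlgebra k L) (π : ∀ m : ℕ+, L →ₐc[k] SQuot k H m),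
        IsSInftyLimit k π) ∧
      ∀ (L : Type u) [Ring L] [HopfAlgebra k L] (π : ∀ m : ℕ+, L →ₐc[k] SQuot k H m),
        IsSInftyLimit k π → Nonempty (L ≃ₐc[k] T) := by
  let e (m : ℕ+) : SQuot k H m ≃ₐc[k] T := BialgEquiv.ofBijective (Φ m) (hΦ m)
  have he (m : ℕ+) (x : T) : Φ m ((e m).symm x) = x := (e m).apply_symm_apply x
  have hcomp (m m' : ℕ+) (h : (m : ℕ) ∣ m') (x : T) :
      sTrans k H h ((e m').symm x) = (e m).symm x := by
    apply (hΦ m).1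
    rw [hc, he, he]
  have h1 (m : ℕ+) : ((1 : ℕ+) : ℕ) ∣ m := by simp
  constructor
  -- Since `1` divides every `m`, a compatible family of maps is determined by its component at `m =
  -- 1`; the factorisation through `T` is that component followed by `Φ 1`.
  · refine ⟨T, inferInstance, inferInstance, fun m => ((e m).symm : T →ₐc[k] SQuot k H m),
      hcomp, fun C _ _ _ τ hτ => ⟨((Φ 1 : SQuot k H (1 : ℕ+) →ₗc[k] T)).comp (τ 1), ?_, ?_⟩⟩
    · intro m x
      apply (hΦ m).1
      refine (he m _).trans ?_
      change Φ 1 (τ 1 x) = _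
      rw [← hc 1 m (h1 m), hτ]
    · intro t ht
      ext x
      change t x = Φ 1 (τ 1 x)
      rw [← ht 1 x]
      exact (he 1 _).symm
  · intro L _ _ π hπ
    -- For an arbitrary limit, `π 1` is an isomorphism. Its inverse `t` is the factorisation of the
    -- cone with vertex `SQuot k H 1` obtained by transporting along the isomorphisms with `T`.
    obtain ⟨t, ht, -⟩ := hπ.existsUnique_lift (SQuot k H (1 : ℕ+))
      (fun m => (((e m).symm : T →ₐc[k] SQuot k H m) : T →ₗc[k] SQuot k H m).comp
        (Φ 1 : SQuot k H (1 : ℕ+) →ₗc[k] T)) (fun m m' h x => hcomp m m' h _)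
    have hlast (x : L) : t (π 1 x) = x := by
      obtain ⟨s, -, hs'⟩ := hπ.existsUnique_lift L
        (fun m => (π m : L →ₗc[k] SQuot k H m)) (fun m m' h x => hπ.compat m m' h x)
      -- Both `t ∘ π 1` and the identity factor the limit cone through itself, so uniqueness
      -- identifies them.
      have e1 := hs' (t.comp (π 1 : L →ₗc[k] SQuot k H (1 : ℕ+))) (fun m x => by
        change π m (t (π 1 x)) = π m x
        rw [ht]
        apply (hΦ m).1
        refine (he m _).trans ?_
        change Φ 1 (π 1 x) = _
        rw [← hc 1 m (h1 m), hπ.compat])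
      have e2 := hs' (CoalgHom.id k L) (fun m x => rfl)
      exact DFunLike.congr_fun (e1.trans e2.symm) x
    have hfirst (x : SQuot k H (1 : ℕ+)) : π 1 (t x) = x := by
      rw [ht]
      exact (e 1).symm_apply_apply x
    exact ⟨(BialgEquiv.ofBijective (π 1) ⟨Function.LeftInverse.injective hlast,
      Function.RightInverse.surjective hfirst⟩).trans (e 1)⟩

end Limit

/-! ### The antipode of the smash product is involutive -/

section AntipodeInvolutive

open HopfAlgebra Finset

variable (k : Type u) [Field k] (n : ℕ)

/-- The inverse of a series with constant term `1` is two-sided. The antipode reverses products, so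
applying it to the recursion for `invSeq`, which expresses one order of multiplication, yields by
induction the identity `x · invSeq x = 1` solved for its leading term. -/
theorem NSymm.antipode_invSeq {i : ℕ} (hi : i ≤ n) :
    antipode k (invSeq (NSymm.x k n) i) = NSymm.x k n i := by
  induction i using Nat.strong_induction_on with
  | _ i ih =>
  cases i with
  | zero => rw [invSeq_zero]; exact antipode_one
  | succ m =>
    have h := sum_mul_invSeq (NSymm.x k n) rfl (m + 1)
    rw [← Nat.sum_antidiagonal_swap] at h
    simp only [Prod.fst_swap, Prod.snd_swap] at h
    rw [Nat.sum_antidiagonal_eq_sum_range_succ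
      (fun i j => NSymm.x k n j * invSeq (NSymm.x k n) i), sum_range_succ',
      if_neg (Nat.succ_ne_zero m), invSeq_zero, mul_one, tsub_zero] at h
    rw [invSeq_succ, map_neg, map_sum, neg_eq_iff_eq_neg, ← add_eq_zero_iff_eq_neg, ← h]
    congr 1
    refine sum_congr rfl fun j hj => ?_
    rw [mem_range] at hj
    rw [antipode_mul_antidistrib, NSymm.antipode_x k n (by omega), ih (m - j) (by omega) (by omega),
      show m + 1 - (j + 1) = m - j by omega]

theorem NSymm.antipode_antipode (y : NSymm k n) : antipode k (antipode k y) = y :=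
  antipode_antipode_of_adjoin (NSymm.adjoin_x k n) (by
    rintro _ ⟨i, hi, rfl⟩
    rw [NSymm.antipode_x k n hi, NSymm.antipode_invSeq k n hi]) y

theorem FreePow.antipode_antipode {I : Type} [DecidableEq I] {A : Type u} [Ring A] [HopfAlgebra k A]
    (h : ∀ a : A, antipode k (antipode k a) = a) (y : FreePow k I A) :
    antipode k (antipode k y) = y :=
  antipode_antipode_of_adjoin (FreePow.adjoin_inc k I A) (by
    rintro _ ⟨i, a, rfl⟩
    have key (a : A) : antipode k (FreePow.inc k I A i a) = FreePow.inc k I A i (antipode k a) :=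
      LinearMap.congr_fun (FreePow.antipodeOp_inc k I A i) a
    rw [key, key, h]) y

theorem Smash.antipode_antipode {A : Type u} [Ring A] [HopfAlgebra k A] {G : Type} [Group G]
    [MulSemiringAction G A] [SMulCommClass G k A] [BialgAction k A G]
    (h : ∀ a : A, antipode k (antipode k a) = a) (y : Smash A G) :
    antipode k (antipode k y) = y :=
  antipode_antipode_of_adjoin (Smash.adjoin_eq k A G) (by
    have keyA (a : A) : antipode k (Smash.inA k A G a) = Smash.inA k A G (antipode k a) :=
      Smash.antipodeOp_inA k A G a
    have keyG (g : G) : antipode k (Smash.inG A G g) = Smash.inG A G g⁻¹ :=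
      Smash.antipodeOp_inG k A G g
    rintro _ (⟨a, rfl⟩ | ⟨g, rfl⟩)
    · rw [keyA, keyA, h]
    · rw [keyG, keyG, inv_inv]) y

/-- A homomorphism to a Hopf algebra with involutive antipode kills the elements `S^{2m}(a) - a`. -/
theorem map_sPowRel_eq_zero {k : Type u} [Field k] {H : Type v} [Ring H] [HopfAlgebra k H]
    {T : Type w} [Ring T] [HopfAlgebra k T]
    (hT : ∀ y : T, antipode k (antipode k y) = y) (F : H →ₐc[k] T) (m : ℕ) :
    ∀ x ∈ sPowRel k H m, F x = 0 := by
  rintro _ ⟨a, rfl⟩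
  rw [map_sub, sub_eq_zero]
  induction m with
  | zero => simp
  | succ m ih =>
    rw [mul_add, mul_one, add_comm, pow_add, Module.End.mul_apply, pow_two, Module.End.mul_apply,
      HopfEnvelope.map_antipode, HopfEnvelope.map_antipode, hT, ih]

end AntipodeInvolutive

/-! ### The homological codeterminant is the quantum determinant -/

section Codeterminant

open LinearMap

variable {k : Type u} [Field k]

section BarExtension

variable {R : Type u} [Ring R] [Algebra k R] (ε : R →ₐ[k] k) {W : Type u} [AddCommGroup W]
  [Module k W]

/-- The operator `(x, y) ↦ (a x, ε(a) y - F(a ⊗ x))` on `R × W`. -/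
def barOp (F : R ⊗[k] R →ₗ[k] W) : R →ₗ[k] Module.End k (R × W) where
  toFun a := ((LinearMap.mulLeft k a).comp (LinearMap.fst k R W)).prod
    (ε a • LinearMap.snd k R W - (TensorProduct.mk k R R a |> F.comp).comp (LinearMap.fst k R W))
  map_add' a b := by
    ext x <;> simp [add_mul, add_smul]
    abel
  map_smul' c a := by
    ext x
    · simp
    · simp
    · simp
    · simp [mul_smul]

theorem barOp_apply (F : R ⊗[k] R →ₗ[k] W) (a : R) (p : R × W) :
    barOp ε F a p = (a * p.1, ε a • p.2 - F (a ⊗ₜ p.1)) := rfl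

/-- The operator `(x, y) ↦ (0, ε(x) w)` on `R × W`. -/
def barConst (w : W) : Module.End k (R × W) :=
  (0 : R × W →ₗ[k] R).prod ((LinearMap.toSpanSingleton k W w).comp
    (ε.toLinearMap.comp (LinearMap.fst k R W)))

theorem barConst_apply (w : W) (p : R × W) : barConst ε w p = (0, ε p.1 • w) := rfl

/-- These operators realise the extension of `R` by the trivial bimodule `W` attached to the cocycle
`-F`. The cocycle identity trades `ε(a) F(b ⊗ x) + F(a ⊗ bx)` for `F(ab ⊗ x) + ε(x) F(a ⊗ b)`, and
the last term is absorbed by `barConst`. A multiplicative section of this extension is a primitive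
of `F`. -/
theorem barOp_add_mul {F : R ⊗[k] R →ₗ[k] W}
    (hF : ∀ a b c : R, ε a • F (b ⊗ₜ c) - F ((a * b) ⊗ₜ c) + F (a ⊗ₜ (b * c)) -
      ε c • F (a ⊗ₜ b) = 0) (a b : R) (w w' : W) :
    (barOp ε F a + barConst ε w) * (barOp ε F b + barConst ε w') =
      barOp ε F (a * b) + barConst ε (ε a • w' + ε b • w - F (a ⊗ₜ b)) := by
  refine LinearMap.ext fun p => ?_
  have h := hF a b p.1
  simp only [Module.End.mul_apply, LinearMap.add_apply, barOp_apply, barConst_apply]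
  refine Prod.ext ?_ ?_
  · simp [mul_assoc]
  · simp only [Prod.mk_add_mk, add_zero, map_mul, smul_sub, smul_add]
    rw [← sub_eq_zero, ← neg_eq_zero, ← h]
    simp only [smul_smul, mul_comm (ε p.1)]
    abel

end BarExtension

section QuadAlg

variable {ι : Type} [Fintype ι] (E : Matrix ι ι k)

theorem QuadAlg.hom_ext {B : Type v} [Ring B] [Algebra k B] {F G : QuadAlg E →ₐ[k] B}
    (h : ∀ i, F (QuadAlg.v E i) = G (QuadAlg.v E i)) : F = G :=
  Ideal.Quotient.algHom_ext k (FreeAlgebra.hom_ext (funext h))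

theorem QuadAlg.adjoin_v : Algebra.adjoin k (Set.range (QuadAlg.v E)) = ⊤ := by
  have h1 : Algebra.adjoin k (Set.range (FreeAlgebra.ι k : ι → FreeAlgebra k ι)) = ⊤ :=
    FreeAlgebra.adjoin_range_ι k ι
  have h2 := congrArg (Subalgebra.map (Ideal.Quotient.mkₐ k (idealOf
    {∑ i, ∑ j, E i j • (FreeAlgebra.ι k i * FreeAlgebra.ι k j)}))) h1
  rw [AlgHom.map_adjoin, ← Set.range_comp, Algebra.map_top,
    (AlgHom.range_eq_top _).2 (Ideal.Quotient.mkₐ_surjective _ _)] at h2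
  exact h2

/-- A `2`-cocycle which vanishes on the relation of `A(E)` is a coboundary. -/
theorem QuadAlg.exists_eq_barD₁ {W : Type u} [AddCommGroup W] [Module k W]
    {F : QuadAlg E ⊗[k] QuadAlg E →ₗ[k] W}
    (hF : ∀ a b c : QuadAlg E, QuadAlg.aug E a • F (b ⊗ₜ c) - F ((a * b) ⊗ₜ c) +
      F (a ⊗ₜ (b * c)) - QuadAlg.aug E c • F (a ⊗ₜ b) = 0)
    (h0 : ∑ i, ∑ j, E i j • F (QuadAlg.v E i ⊗ₜ QuadAlg.v E j) = 0) :
    ∃ g : QuadAlg E →ₗ[k] W, ∀ a b, F (a ⊗ₜ b) = barD₁ (QuadAlg.aug E) g a b := by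
  set ε := QuadAlg.aug E
  have hε (i : ι) : ε (QuadAlg.v E i) = 0 := QuadAlg.lift_v E 0 _ i
  have hv (i j : ι) : barOp ε F (QuadAlg.v E i) * barOp ε F (QuadAlg.v E j) =
      barOp ε F (QuadAlg.v E i * QuadAlg.v E j) +
        barConst ε (- F (QuadAlg.v E i ⊗ₜ QuadAlg.v E j)) := by
    have h := barOp_add_mul ε hF (QuadAlg.v E i) (QuadAlg.v E j) 0 0
    have hz : barConst ε (0 : W) = 0 := by
      refine LinearMap.ext fun p => ?_
      rw [barConst_apply, smul_zero]; rfl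
    simpa [hz] using h
  -- The extension splits: the lifts `barOp ε F (v i)` satisfy the relation of `A(E)` because `F`
  -- vanishes on it.
  let T : QuadAlg E →ₐ[k] Module.End k (QuadAlg E × W) :=
    QuadAlg.lift E (fun i => barOp ε F (QuadAlg.v E i)) (by
      simp only [hv, smul_add, Finset.sum_add_distrib, ← map_smul, ← map_sum]
      rw [QuadAlg.rel, map_zero, zero_add]
      refine LinearMap.ext fun p => ?_
      simp only [LinearMap.sum_apply, LinearMap.smul_apply, barConst_apply]
      refine Prod.ext ?_ ?_
      · simp [Prod.fst_sum]
      · simp only [Prod.snd_sum, Prod.smul_snd, smul_neg, Finset.sum_neg_distrib,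
          smul_comm _ (ε p.1), ← Finset.smul_sum, h0]
        simp)
  have hT (a : QuadAlg E) : ∃ w, T a = barOp ε F a + barConst ε w := by
    have ha : a ∈ Algebra.adjoin k (Set.range (QuadAlg.v E)) := QuadAlg.adjoin_v E ▸ Algebra.mem_top
    induction ha using Algebra.adjoin_induction with
    | mem x hx =>
      obtain ⟨i, rfl⟩ := hx
      refine ⟨0, (QuadAlg.lift_v E _ _ i).trans ?_⟩
      refine LinearMap.ext fun p => ?_
      rw [LinearMap.add_apply, barConst_apply, smul_zero]
      exact (add_zero _).symm
    | algebraMap c =>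
      -- `barOp` is not unital unless `F` is normalised. The cocycle identity at `a = b = 1` gives
      -- `F(1 ⊗ x) = ε(x) F(1 ⊗ 1)`, and this constant compensates for it.
      refine ⟨c • F (1 ⊗ₜ 1), ?_⟩
      rw [AlgHom.commutes]
      refine LinearMap.ext fun p => ?_
      have h := hF 1 1 p.1
      rw [map_one, one_smul, one_mul, one_mul, sub_self, zero_add, sub_eq_zero] at h
      rw [LinearMap.add_apply, barOp_apply, barConst_apply, AlgHom.commutes,
        Algebra.algebraMap_eq_smul_one c, Algebra.algebraMap_eq_smul_one c,
        Algebra.algebraMap_eq_smul_one c, ← TensorProduct.smul_tmul', map_smul, h]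
      refine Prod.ext ?_ ?_
      · simp
      · simp [smul_comm c]
    | add x y _ _ hx hy =>
      obtain ⟨w, hw⟩ := hx
      obtain ⟨w', hw'⟩ := hy
      refine ⟨w + w', ?_⟩
      rw [map_add, hw, hw', map_add]
      refine LinearMap.ext fun p => ?_
      simp only [LinearMap.add_apply, barConst_apply, smul_add]
      refine Prod.ext ?_ ?_
      · simp
      · simp; abel
    | mul x y _ _ hx hy =>
      obtain ⟨w, hw⟩ := hx
      obtain ⟨w', hw'⟩ := hy
      exact ⟨_, by rw [map_mul, hw, hw', barOp_add_mul ε hF]⟩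
  -- Evaluated at `(1, 0)`, the second component of `barOp ε F a + barConst ε w` is `w - F(a ⊗ 1)`.
  -- Adding `F(a ⊗ 1)` recovers `w`, and linearly in `a`.
  let g : QuadAlg E →ₗ[k] W :=
    LinearMap.snd k _ W ∘ₗ LinearMap.applyₗ ((1, 0) : QuadAlg E × W) ∘ₗ T.toLinearMap +
      F ∘ₗ (TensorProduct.mk k _ _).flip 1
  have hg {a : QuadAlg E} {w : W} (h : T a = barOp ε F a + barConst ε w) : g a = w := by
    change (T a (1, 0)).2 + F (a ⊗ₜ 1) = w
    rw [h, LinearMap.add_apply, barOp_apply, barConst_apply]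
    simp
  have hTg (a : QuadAlg E) : T a = barOp ε F a + barConst ε (g a) := by
    obtain ⟨w, hw⟩ := hT a
    rw [hg hw, hw]
  refine ⟨g, fun a b => ?_⟩
  have h1 : g (a * b) = ε a • g b + ε b • g a - F (a ⊗ₜ b) :=
    hg (by rw [map_mul, hTg, hTg, barOp_add_mul ε hF])
  rw [barD₁, h1]
  abel

end QuadAlg

section Pairing

variable {R : Type u} [Ring R] [Algebra k R] (ε : R →ₐ[k] k) {H : Type u} [Ring H] [Algebra k H]

/-- The pairing `(x ⊗ h, y ⊗ h') ↦ f(x ⊗ y) h h'`. -/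
def tensorPairing (f : R ⊗[k] R →ₗ[k] k) : (R ⊗[k] H) ⊗[k] (R ⊗[k] H) →ₗ[k] H :=
  (TensorProduct.lid k H).toLinearMap ∘ₗ TensorProduct.map f (mul' k H) ∘ₗ
    (TensorProduct.tensorTensorTensorComm k R H R H).toLinearMap

theorem tensorPairing_tmul (f : R ⊗[k] R →ₗ[k] k) (x y : R) (h h' : H) :
    tensorPairing f ((x ⊗ₜ h) ⊗ₜ[k] (y ⊗ₜ h')) = f (x ⊗ₜ y) • (h * h') := by
  simp [tensorPairing]

variable (H) in
/-- The map `x ⊗ h ↦ ε(x) h`. -/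
def augTensor : R ⊗[k] H →ₐ[k] H :=
  Algebra.TensorProduct.lift ((Algebra.ofId k H).comp ε) (AlgHom.id k H)
    fun x _ => Algebra.commutes (ε x) _

theorem augTensor_tmul (x : R) (h : H) : augTensor ε H (x ⊗ₜ h) = ε x • h := by
  refine (Algebra.TensorProduct.lift_tmul _ _ _ _ _).trans ?_
  rw [Algebra.smul_def]; rfl

/-- The cocycle identity with coefficients extended to `H`. On pure tensors the factors from `H`
multiply to the same product in all four terms, so the identity reduces to the one for `f`. -/
theorem tensorPairing_cocycle {f : R ⊗[k] R →ₗ[k] k} (hf : IsBarCocycle₂ ε f)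
    (t s r : R ⊗[k] H) :
    augTensor ε H t * tensorPairing f (s ⊗ₜ r) - tensorPairing f ((t * s) ⊗ₜ r) +
      tensorPairing f (t ⊗ₜ (s * r)) - tensorPairing f (t ⊗ₜ s) * augTensor ε H r = 0 := by
  induction t with
  | zero => simp
  | add p q hp hq =>
    rw [← add_zero (0 : H)]
    nth_rewrite 1 [← hp]
    rw [← hq]
    simp only [map_add, add_mul, TensorProduct.add_tmul]
    abel
  | tmul x h =>
  induction s with
  | zero => simp
  | add p q hp hq =>
    rw [← add_zero (0 : H)]
    nth_rewrite 1 [← hp]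
    rw [← hq]
    simp only [map_add, add_mul, mul_add, TensorProduct.add_tmul, TensorProduct.tmul_add]
    abel
  | tmul y h' =>
  induction r with
  | zero => simp
  | add p q hp hq =>
    rw [← add_zero (0 : H)]
    nth_rewrite 1 [← hp]
    rw [← hq]
    simp only [map_add, mul_add, TensorProduct.tmul_add]
    abel
  | tmul z h'' =>
    simp only [Algebra.TensorProduct.tmul_mul_tmul, tensorPairing_tmul, augTensor_tmul,
      smul_mul_assoc, mul_smul_comm, smul_smul, mul_assoc]
    rw [← sub_smul, ← add_smul, ← sub_smul]
    have := hf x y z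
    rw [mul_comm (f (x ⊗ₜ y))] at this
    rw [mul_comm (f (y ⊗ₜ z)), this, zero_smul]

/-- Since `ρ` is multiplicative and respects augmentations, the coacted cochain is again a cocycle,
now with values in the trivial module `H`; so is `f` times the constant `D`. Their difference is put
in the form to which `QuadAlg.exists_eq_barD₁` applies. -/
theorem barCoact_sub_cocycle {f : R ⊗[k] R →ₗ[k] k} (hf : IsBarCocycle₂ ε f)
    {ρ : R →ₐ[k] R ⊗[k] H} (hρ : ∀ a, augTensor ε H (ρ a) = algebraMap k H (ε a)) (D : H)
    (a b c : R) :
    ε a • (barCoact ρ f - LinearMap.toSpanSingleton k H D ∘ₗ f) (b ⊗ₜ c) -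
        (barCoact ρ f - LinearMap.toSpanSingleton k H D ∘ₗ f) ((a * b) ⊗ₜ c) +
        (barCoact ρ f - LinearMap.toSpanSingleton k H D ∘ₗ f) (a ⊗ₜ (b * c)) -
      ε c • (barCoact ρ f - LinearMap.toSpanSingleton k H D ∘ₗ f) (a ⊗ₜ b) = 0 := by
  have hb (x y : R) : barCoact ρ f (x ⊗ₜ y) = tensorPairing f (ρ x ⊗ₜ ρ y) := rfl
  have h1 := tensorPairing_cocycle ε hf (ρ a) (ρ b) (ρ c)
  rw [hρ, hρ, ← map_mul, ← map_mul, ← Algebra.commutes, ← Algebra.smul_def,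
    ← Algebra.smul_def] at h1
  have h2 := congrArg (fun c => c • D) (hf a b c)
  simp only [zero_smul, sub_smul, add_smul] at h2
  rw [← sub_zero (0 : H)]
  nth_rewrite 1 [← h1]
  rw [← h2]
  simp only [LinearMap.sub_apply, LinearMap.comp_apply, LinearMap.toSpanSingleton_apply,
    smul_sub, smul_smul, mul_comm (f (a ⊗ₜ b)), hb]
  abel

end Pairing

section Codet

variable {ι : Type} [Fintype ι] [DecidableEq ι] (E : Matrix ι ι k)

/-- The quantum determinant in `O_A(M)`. -/
def qdet : OM E := (OM.exists_qdet E).choose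

theorem qdet_spec (p l : ι) : ∑ i, ∑ j, E i j • (OM.a E p i * OM.a E l j) = E p l • qdet E :=
  (OM.exists_qdet E).choose_spec p l

/-- The generator `a_{ij}` of `O_A(GL)`. -/
def aGL (i j : ι) : OGL E := HopfEnvelope.ι k (OM E) (OM.a E i j)

/-- The quantum determinant in `O_A(GL)`. -/
def qdetGL : OGL E := HopfEnvelope.ι k (OM E) (qdet E)

theorem qdetGL_spec (p l : ι) :
    ∑ i, ∑ j, E i j • (aGL E p i * aGL E l j) = E p l • qdetGL E := by
  have := congrArg (HopfEnvelope.ι k (OM E)) (qdet_spec E p l)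
  simp only [map_sum, map_smul, map_mul] at this
  exact this

/-- The counit and the comultiplication are applied to the defining identity of `qdet` at a nonzero
entry of `E`. The identity can be used in both tensor factors of the result, giving `D ⊗ D` times
that entry. -/
theorem isGroupLikeElem_qdet (hE : E ≠ 0) : IsGroupLikeElem k (qdet E) := by
  obtain ⟨p, l, hpl⟩ : ∃ p l, E p l ≠ 0 := by
    by_contra! h
    exact hE (Matrix.ext h)
  have hε (i j : ι) : Coalgebra.counit (R := k) (OM.a E i j) = if i = j then 1 else 0 :=
    FreeMat.counit_X k i j
  have hΔ (i j : ι) : Coalgebra.comul (R := k) (OM.a E i j) =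
      ∑ s, OM.a E i s ⊗ₜ[k] OM.a E s j := by
    change Algebra.TensorProduct.map _ _ (Coalgebra.comul (FreeMat.X k i j)) = _
    simp only [FreeMat.comul_X, map_sum, Algebra.TensorProduct.map_tmul]
    rfl
  have h := qdet_spec E p l
  constructor
  · have := congrArg (Coalgebra.counit (R := k)) h
    simp only [map_sum, map_smul, Bialgebra.counit_mul, hε, mul_ite, mul_one,
      mul_zero, smul_eq_mul, Finset.sum_ite_eq, Finset.mem_univ, if_true] at this
    exact mul_left_cancel₀ hpl (this.symm.trans (mul_one _).symm)
  · have := congrArg (Coalgebra.comul (R := k)) h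
    simp only [map_sum, map_smul, Bialgebra.comul_mul, hΔ, Finset.sum_mul_sum,
      Algebra.TensorProduct.tmul_mul_tmul, Finset.smul_sum] at this
    rw [sum_swap₄] at this
    have h2 (s t : ι) : ∑ i, ∑ j, E i j • ((OM.a E p s * OM.a E l t) ⊗ₜ[k]
        (OM.a E s i * OM.a E t j)) = (E s t • (OM.a E p s * OM.a E l t)) ⊗ₜ[k] qdet E := by
      rw [TensorProduct.smul_tmul, ← qdet_spec]
      simp only [TensorProduct.tmul_sum, TensorProduct.tmul_smul]
    simp only [h2, ← TensorProduct.sum_tmul] at this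
    rw [h, ← TensorProduct.smul_tmul'] at this
    exact (smul_right_injective _ hpl this).symm

theorem isGroupLikeElem_qdetGL (hE : E ≠ 0) : IsGroupLikeElem k (qdetGL E) :=
  (isGroupLikeElem_qdet E hE).map _

theorem coactGL_v (i : ι) :
    coactGL E (QuadAlg.v E i) = ∑ s, QuadAlg.v E s ⊗ₜ[k] aGL E s i := by
  rw [coactGL, AlgHom.comp_apply, QuadAlg.coactM, QuadAlg.lift_v, map_sum]
  rfl

/-- The coaction carries the relation `r` to `r ⊗ D`; this is the dual statement, for the value of a
cochain on `r`. -/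
theorem barCoact_rel (f : QuadAlg E ⊗[k] QuadAlg E →ₗ[k] k) :
    ∑ i, ∑ j, E i j • barCoact (coactGL E) f (QuadAlg.v E i ⊗ₜ QuadAlg.v E j) =
      (∑ i, ∑ j, E i j • f (QuadAlg.v E i ⊗ₜ QuadAlg.v E j)) • qdetGL E := by
  have h (i j : ι) : barCoact (coactGL E) f (QuadAlg.v E i ⊗ₜ QuadAlg.v E j) =
      ∑ s, ∑ t, f (QuadAlg.v E s ⊗ₜ QuadAlg.v E t) • (aGL E s i * aGL E t j) := by
    change tensorPairing f (coactGL E (QuadAlg.v E i) ⊗ₜ coactGL E (QuadAlg.v E j)) = _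
    simp only [coactGL_v, TensorProduct.sum_tmul, TensorProduct.tmul_sum, map_sum,
      tensorPairing_tmul]
    exact Finset.sum_comm
  simp only [h, Finset.smul_sum, Finset.sum_smul]
  rw [sum_swap₄]
  refine Finset.sum_congr rfl fun s _ => Finset.sum_congr rfl fun t _ => ?_
  rw [smul_eq_mul, mul_comm, mul_smul, ← qdetGL_spec]
  simp only [Finset.smul_sum]
  exact Finset.sum_congr rfl fun i _ => Finset.sum_congr rfl fun j _ => smul_comm _ _ _

theorem augTensor_coactGL (a : QuadAlg E) :
    augTensor (QuadAlg.aug E) (OGL E) (coactGL E a) = algebraMap k _ (QuadAlg.aug E a) := by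
  have : (augTensor (QuadAlg.aug E) (OGL E)).comp (coactGL E) =
      (Algebra.ofId k (OGL E)).comp (QuadAlg.aug E) := QuadAlg.hom_ext E fun i => by
    have hε (i : ι) : QuadAlg.aug E (QuadAlg.v E i) = 0 := QuadAlg.lift_v E 0 _ i
    rw [AlgHom.comp_apply, AlgHom.comp_apply, coactGL_v, map_sum, hε, map_zero]
    exact Finset.sum_eq_zero fun s _ => by rw [augTensor_tmul, hε, zero_smul]
  exact AlgHom.congr_fun this a

/-- The quantum determinant is the homological codeterminant. -/
theorem isHomCodet_qdetGL : IsHomCodet (QuadAlg.aug E) (coactGL E) (qdetGL E) := by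
  intro f hf
  obtain ⟨g, hg⟩ := QuadAlg.exists_eq_barD₁ E
    (barCoact_sub_cocycle (QuadAlg.aug E) hf (augTensor_coactGL E) (qdetGL E)) (by
      have := barCoact_rel E f
      simp only [LinearMap.sub_apply, LinearMap.comp_apply, LinearMap.toSpanSingleton_apply,
        smul_sub, Finset.sum_sub_distrib, this, Finset.sum_smul, smul_assoc, sub_self])
  refine ⟨g, fun a b => ?_⟩
  rw [← hg, LinearMap.sub_apply]
  change _ = f (a ⊗ₜ b) • qdetGL E + (_ - f (a ⊗ₜ b) • qdetGL E)
  abel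

/-- The homological codeterminant is unique. -/
theorem eq_qdetGL_of_isHomCodet (hE : E ≠ 0) {D : OGL E}
    (hD : IsHomCodet (QuadAlg.aug E) (coactGL E) D) : D = qdetGL E := by
  obtain ⟨p, l, hpl⟩ : ∃ p l, E p l ≠ 0 := by
    by_contra! h
    exact hE (Matrix.ext h)
  -- The derivation dual to `v p`, encoded as a homomorphism to the dual numbers. It exists because
  -- the relation is quadratic.
  let δ (p : ι) : QuadAlg E →ₐ[k] TrivSqZeroExt k k :=
    QuadAlg.lift E (fun i => TrivSqZeroExt.inr (if i = p then 1 else 0)) (by simp)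
  have hδv (p i : ι) : (δ p (QuadAlg.v E i)).snd = if i = p then 1 else 0 := by
    simp only [δ, QuadAlg.lift_v, TrivSqZeroExt.snd_inr]
  have hfst (p : ι) (a : QuadAlg E) : (δ p a).fst = QuadAlg.aug E a := by
    have : (TrivSqZeroExt.fstHom k k k).comp (δ p) = QuadAlg.aug E :=
      QuadAlg.hom_ext E fun i => by
        have hε (i : ι) : QuadAlg.aug E (QuadAlg.v E i) = 0 := QuadAlg.lift_v E 0 _ i
        simp only [δ, AlgHom.comp_apply, QuadAlg.lift_v, hε]
        exact TrivSqZeroExt.fst_inr k (if i = p then 1 else 0)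
    exact AlgHom.congr_fun this a
  -- The cup product of the derivations dual to `v p` and `v l`. It is a cocycle by the Leibniz
  -- rule, and its value on the relation is `E p l ≠ 0`.
  let f : QuadAlg E ⊗[k] QuadAlg E →ₗ[k] k := mul' k k ∘ₗ
    TensorProduct.map (TrivSqZeroExt.sndHom k k ∘ₗ (δ p).toLinearMap)
      (TrivSqZeroExt.sndHom k k ∘ₗ (δ l).toLinearMap)
  have hfa (a b : QuadAlg E) : f (a ⊗ₜ b) = (δ p a).snd * (δ l b).snd := rfl
  have hf : IsBarCocycle₂ (QuadAlg.aug E) f := fun a b c => by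
    simp only [hfa, map_mul, TrivSqZeroExt.snd_mul, hfst, smul_eq_mul, MulOpposite.smul_eq_mul_unop,
      MulOpposite.unop_op]
    ring
  have hfr : ∑ i, ∑ j, E i j • f (QuadAlg.v E i ⊗ₜ QuadAlg.v E j) = E p l := by
    simp [hfa, hδv]
  obtain ⟨g, hg⟩ := hD f hf
  have h1 := barCoact_rel E f
  have hε (i : ι) : QuadAlg.aug E (QuadAlg.v E i) = 0 := QuadAlg.lift_v E 0 _ i
  -- On generators the coboundary of `g` is `-g(v i * v j)`. Summed against `E` this is minus the
  -- value of `g` at the relation, which is zero in `A(E)`.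
  simp only [hg, barD₁, hε, zero_smul, add_zero, zero_sub, smul_add, Finset.sum_add_distrib,
    smul_neg, Finset.sum_neg_distrib, ← map_smul g, ← map_sum g, QuadAlg.rel, map_zero,
    neg_zero] at h1
  have h2 : ∑ i, ∑ j, E i j • f (QuadAlg.v E i ⊗ₜ QuadAlg.v E j) • D = E p l • D := by
    rw [← hfr]
    simp only [Finset.sum_smul, smul_assoc]
  rw [hfr, h2] at h1
  exact smul_right_injective _ hpl h1

end Codet

end Codeterminant

/-! ### Scalars plus nilpotents, and their commutants -/

section UnipotentCommutant

variable {k : Type u} [Field k] {R : Type v} [Ring R] [Algebra k R]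

/-- Eigenvalues multiply: `PQ - pq = (P - p) Q + p (Q - q)` is a sum of two commuting nilpotents. -/
theorem isNilpotent_mul_sub {P Q : R} (h : Commute P Q) {p q : k}
    (hP : IsNilpotent (P - algebraMap k R p)) (hQ : IsNilpotent (Q - algebraMap k R q)) :
    IsNilpotent (P * Q - algebraMap k R (p * q)) := by
  have e : P * Q - algebraMap k R (p * q) =
      (P - algebraMap k R p) * Q + algebraMap k R p * (Q - algebraMap k R q) := by
    rw [map_mul]; noncomm_ring
  have hp (x : R) : Commute (algebraMap k R p) x := Algebra.commutes p x
  have hq (x : R) : Commute (algebraMap k R q) x := Algebra.commutes q x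
  have h1 : Commute (P - algebraMap k R p) Q := h.sub_left (hp Q)
  have h2 : Commute (P - algebraMap k R p) (Q - algebraMap k R q) := h1.sub_right (hq _).symm
  rw [e]
  refine Commute.isNilpotent_add ?_ (h1.isNilpotent_mul_right hP) ((hp _).isNilpotent_mul_left hQ)
  refine Commute.mul_left ?_ ?_
  · exact Commute.mul_right (hp _).symm h2
  · exact Commute.mul_right (hp _).symm ((Commute.refl Q).sub_right (hq _).symm)

theorem isNilpotent_pow_sub {P : R} {p : k} (hP : IsNilpotent (P - algebraMap k R p)) (m : ℕ) :
    IsNilpotent (P ^ m - algebraMap k R (p ^ m)) := by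
  induction m with
  | zero => simp
  | succ m ih =>
    rw [pow_succ, pow_succ]
    exact isNilpotent_mul_sub ((Commute.refl P).pow_left m) ih hP

theorem isNilpotent_mulLeft_sub {P : R} {p : k} (hP : IsNilpotent (P - algebraMap k R p)) :
    IsNilpotent (LinearMap.mulLeft k P - algebraMap k (Module.End k R) p) := by
  have : LinearMap.mulLeft k P - algebraMap k (Module.End k R) p =
      LinearMap.mulLeft k (P - algebraMap k R p) := by
    ext x
    simp [Module.algebraMap_end_apply, sub_mul, Algebra.smul_def]
  rw [this]
  exact (LinearMap.isNilpotent_mulLeft_iff k _).2 hP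

theorem isNilpotent_mulRight_sub {P : R} {p : k} (hP : IsNilpotent (P - algebraMap k R p)) :
    IsNilpotent (LinearMap.mulRight k P - algebraMap k (Module.End k R) p) := by
  have : LinearMap.mulRight k P - algebraMap k (Module.End k R) p =
      LinearMap.mulRight k (P - algebraMap k R p) := by
    ext x
    simp [Module.algebraMap_end_apply, mul_sub, Algebra.smul_def, Algebra.commutes]
  rw [this]
  exact (LinearMap.isNilpotent_mulRight_iff k _).2 hP

theorem isUnit_of_isNilpotent_sub {P : R} {p : k} (hp : p ≠ 0)
    (hP : IsNilpotent (P - algebraMap k R p)) : IsUnit P := by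
  have h := IsNilpotent.isUnit_add_left_of_commute hP
    ((IsUnit.mk0 p hp).map (algebraMap k R)) (Algebra.commutes p _).symm
  simpa using h

/-- Left multiplication by `P` and right multiplication by `Q` commute, so `X ↦ P X Q` is the scalar
`p q` plus a nilpotent. As `p q ≠ 1`, subtracting the identity leaves an invertible operator. No
finiteness of `R` over `k` is involved. -/
theorem eq_zero_of_mul_mul_eq {P Q X : R} {p q : k} (hP : IsNilpotent (P - algebraMap k R p))
    (hQ : IsNilpotent (Q - algebraMap k R q)) (hpq : p * q ≠ 1) (h : P * X * Q = X) : X = 0 := by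
  have hc : Commute (LinearMap.mulLeft k P) (LinearMap.mulRight k Q) :=
    LinearMap.ext fun x => (mul_assoc P x Q).symm
  have hn := isNilpotent_mul_sub hc (isNilpotent_mulLeft_sub hP) (isNilpotent_mulRight_sub hQ)
  have hu : IsUnit (LinearMap.mulLeft k P * LinearMap.mulRight k Q - 1) := by
    refine isUnit_of_isNilpotent_sub (k := k) (sub_ne_zero.2 hpq) ?_
    rw [map_sub, map_one, sub_sub_sub_cancel_right]
    exact hn
  obtain ⟨U, hU⟩ := hu
  have hX : (U : Module.End k R) X = 0 := by
    rw [hU]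
    simp [← mul_assoc, h]
  have := congrArg ((U⁻¹ : (Module.End k R)ˣ) : Module.End k R) hX
  rwa [← Module.End.mul_apply, Units.inv_mul, map_zero] at this

/-- In characteristic `0`, an element which commutes with a power of a nonzero scalar plus a
nilpotent element commutes with this element itself. -/
theorem commute_of_commute_pow [CharZero k] {P X : R} {p : k} (hp : p ≠ 0)
    (hP : IsNilpotent (P - algebraMap k R p)) {m : ℕ} (hm : 0 < m) (h : P ^ m * X = X * P ^ m) :
    P * X = X * P := by
  set A := LinearMap.mulLeft k P
  set B := LinearMap.mulRight k P
  have hc : Commute A B := LinearMap.ext fun x => (mul_assoc P x P).symm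
  have hA := isNilpotent_mulLeft_sub hP
  have hB := isNilpotent_mulRight_sub hP
  -- With `A`, `B` the left and right multiplications by `P`, `A^m - B^m` is `A - B` times `∑ A^i
  -- B^(m-1-i)`. Each summand is `p^(m-1)` plus a nilpotent `t i`, so the sum is `m p^(m-1)` plus a
  -- nilpotent; it is invertible in characteristic zero, and can be cancelled.
  let t (i : ℕ) : Module.End k R := A ^ i * B ^ (m - 1 - i) - algebraMap k _ (p ^ (m - 1))
  have ht {i : ℕ} (hi : i ∈ Finset.range m) : IsNilpotent (t i) := by
    have := isNilpotent_mul_sub (hc.pow_pow i (m - 1 - i)) (isNilpotent_pow_sub hA i)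
      (isNilpotent_pow_sub hB (m - 1 - i))
    rw [Finset.mem_range] at hi
    rwa [← pow_add, show i + (m - 1 - i) = m - 1 by omega] at this
  have htt (i j : ℕ) : Commute (t i) (t j) := by
    have h1 : Commute (A ^ i * B ^ (m - 1 - i)) (A ^ j * B ^ (m - 1 - j)) :=
      Commute.mul_left (((Commute.refl A).pow_pow i j).mul_right (hc.pow_pow _ _))
        ((hc.symm.pow_pow _ _).mul_right ((Commute.refl B).pow_pow _ _))
    have h2 (x : Module.End k R) : Commute (algebraMap k _ (p ^ (m - 1))) x := Algebra.commutes _ x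
    exact (h1.sub_left (h2 _)).sub_right (h2 _).symm
  have hs : IsNilpotent (∑ i ∈ Finset.range m, t i) :=
    Commute.isNilpotent_sum (fun i hi => ht hi) fun i j _ _ => htt i j
  have hu : IsUnit (∑ i ∈ Finset.range m, A ^ i * B ^ (m - 1 - i)) := by
    refine isUnit_of_isNilpotent_sub (k := k) (p := m * p ^ (m - 1))
      (mul_ne_zero (Nat.cast_ne_zero.2 hm.ne') (pow_ne_zero _ hp)) ?_
    simpa [t, Finset.sum_sub_distrib] using hs
  have hg := hc.geom_sum₂_mul m
  obtain ⟨U, hU⟩ := hu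
  rw [← hU] at hg
  have hX : (U : Module.End k R) ((A - B) X) = 0 := by
    rw [← Module.End.mul_apply, hg, LinearMap.sub_apply, LinearMap.pow_mulLeft,
      LinearMap.pow_mulRight, LinearMap.mulLeft_apply, LinearMap.mulRight_apply, h, sub_self]
  have := congrArg ((U⁻¹ : (Module.End k R)ˣ) : Module.End k R) hX
  rw [← Module.End.mul_apply, Units.inv_mul, map_zero] at this
  exact sub_eq_zero.1 this

end UnipotentCommutant

/-! ### Scalar matrices over a noncommutative algebra -/

section ScalarMatrices

open Matrix

variable {k : Type u} [Field k] {R : Type v} [Ring R] [Algebra k R] {ι : Type} [Fintype ι]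
  [DecidableEq ι]

variable (R) in
/-- The inclusion of the matrices with scalar entries. -/
def scal : Matrix ι ι k →ₐ[k] Matrix ι ι R := (Algebra.ofId k R).mapMatrix

theorem scal_apply (A : Matrix ι ι k) (i j : ι) : scal R A i j = algebraMap k R (A i j) := rfl

theorem scal_mul_apply (A : Matrix ι ι k) (X : Matrix ι ι R) (i j : ι) :
    (scal R A * X) i j = ∑ s, A i s • X s j := by
  simp only [Matrix.mul_apply, scal_apply, Algebra.smul_def]

theorem mul_scal_apply (A : Matrix ι ι k) (X : Matrix ι ι R) (i j : ι) :
    (X * scal R A) i j = ∑ s, A s j • X i s := by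
  simp only [Matrix.mul_apply, scal_apply, Algebra.smul_def, Algebra.commutes]

/-- Transposition reverses matrix products only when the entries of the factors commute; here one
factor has central entries. -/
theorem transpose_scal_mul (A : Matrix ι ι k) (X : Matrix ι ι R) :
    (scal R A * X)ᵀ = Xᵀ * scal R Aᵀ := by
  ext i j
  simp only [transpose_apply, scal_mul_apply, mul_scal_apply]

theorem transpose_mul_scal (A : Matrix ι ι k) (X : Matrix ι ι R) :
    (X * scal R A)ᵀ = scal R Aᵀ * Xᵀ := by
  ext i j
  simp only [transpose_apply, scal_mul_apply, mul_scal_apply]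

theorem isNilpotent_scal_sub {A : Matrix ι ι k} {q : k}
    (h : IsNilpotent (A - algebraMap k _ q)) :
    IsNilpotent (scal R A - algebraMap k (Matrix ι ι R) q) := by
  have := h.map (scal (ι := ι) R)
  rwa [map_sub, AlgHom.commutes] at this

/-- Cayley–Hamilton: the matrix is upper triangular with constant diagonal `q`, so its
characteristic polynomial is `(X - q)^r`. -/
theorem isNilpotent_Bmat_sub (r : ℕ) (q : k) :
    IsNilpotent (Bmat r q - algebraMap k (Matrix (Fin r) (Fin r) k) q) := by
  have ht : (Bmat r q).BlockTriangular id := fun i j hij => by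
    have h1 : j < i := hij
    have h2 : (j : ℕ) < i := h1
    rw [Bmat, Matrix.of_apply, if_neg h1.ne', if_neg (by omega)]
  have h := Matrix.aeval_self_charpoly (Bmat r q)
  rw [Matrix.charpoly_of_isUpperTriangular _ ht] at h
  simp only [Bmat, Matrix.of_apply, if_true, Finset.prod_const, map_pow, map_sub,
    Polynomial.aeval_X, Polynomial.aeval_C] at h
  exact ⟨_, h⟩

theorem isNilpotent_transpose_sub {A : Matrix ι ι k} {q : k}
    (h : IsNilpotent (A - algebraMap k _ q)) : IsNilpotent (Aᵀ - algebraMap k _ q) := by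
  obtain ⟨n, hn⟩ := h
  refine ⟨n, ?_⟩
  have : Aᵀ - algebraMap k _ q = (A - algebraMap k _ q)ᵀ := by
    rw [Matrix.transpose_sub, Matrix.algebraMap_eq_diagonal, Matrix.diagonal_transpose]
  rw [this, ← Matrix.transpose_pow, hn, Matrix.transpose_zero]

/-- A matrix that commutes with a nilpotent upper Jordan block is upper triangular Toeplitz. -/
theorem toeplitz_of_commute_Bmat {n : ℕ} {q : k} {X : Matrix (Fin (n + 1)) (Fin (n + 1)) R}
    (h : scal R (Bmat (n + 1) q) * X = X * scal R (Bmat (n + 1) q)) (i j : Fin (n + 1)) :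
    X i j = if h : i ≤ j then X 0 ⟨j - i, by omega⟩ else 0 := by
  -- Comparing entries of both products, the terms with `q` cancel. What remains is `X (i+1) (j+1) =
  -- X i j`, together with `X (i+1) 0 = 0` from the first column; induction on the row finishes.
  have hL (i : ℕ) (hi : i + 1 < n + 1) (j : Fin (n + 1)) :
      (scal R (Bmat (n + 1) q) * X) ⟨i, by omega⟩ j = q • X ⟨i, by omega⟩ j + X ⟨i + 1, hi⟩ j := by
    rw [scal_mul_apply, Finset.sum_eq_add (⟨i, by omega⟩ : Fin (n + 1)) ⟨i + 1, hi⟩]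
    · simp [Bmat]
    · simp
    · rintro c - ⟨h1, h2⟩
      have : (i : ℕ) + 1 ≠ c := fun h => h2 (Fin.ext h.symm)
      simp [Bmat, h1.symm, this]
    · simp
    · simp
  have hR0 (i : Fin (n + 1)) : (X * scal R (Bmat (n + 1) q)) i 0 = q • X i 0 := by
    rw [mul_scal_apply, Finset.sum_eq_single 0]
    · simp [Bmat]
    · rintro c - h1
      simp [Bmat, h1]
    · simp
  have hR (i : Fin (n + 1)) (j : ℕ) (hj : j + 1 < n + 1) :
      (X * scal R (Bmat (n + 1) q)) i ⟨j + 1, hj⟩ =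
        q • X i ⟨j + 1, hj⟩ + X i ⟨j, by omega⟩ := by
    rw [mul_scal_apply, Finset.sum_eq_add (⟨j + 1, hj⟩ : Fin (n + 1)) ⟨j, by omega⟩]
    · simp [Bmat]
    · simp
    · rintro c - ⟨h1, h2⟩
      have : (c : ℕ) ≠ j := fun h => h2 (Fin.ext h)
      simp [Bmat, h1, this]
    · simp
    · simp
  obtain ⟨i, hi⟩ := i
  induction i generalizing j with
  | zero => simp
  | succ i ih =>
    have h1 := hL i hi j
    obtain ⟨j, hj⟩ := j
    rw [h] at h1
    cases j with
    | zero =>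
      have h2 := hR0 ⟨i, by omega⟩
      have h3 := h2.symm.trans h1
      have h4 : X ⟨i + 1, hi⟩ ⟨0, hj⟩ = 0 := by
        simpa using h3.symm
      rw [h4, dif_neg]
      exact fun h => Nat.not_succ_le_zero i h
    | succ j =>
      rw [hR] at h1
      have h2 := add_left_cancel h1
      rw [← h2, ih]
      simp only [Fin.mk_le_mk, Nat.add_le_add_iff_right, Nat.add_sub_add_right]

end ScalarMatrices

open Finset Matrix

/-! ### Toeplitz matrices as truncated power series -/

section Toeplitz

variable {R : Type v} [Ring R]

/-- The Cauchy product of two sequences. -/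
def cauchyMul (u v : ℕ → R) (l : ℕ) : R := ∑ p ∈ antidiagonal l, u p.1 * v p.2

/-- The upper triangular Toeplitz matrix of a sequence. -/
def upToeplitz (r : ℕ) (u : ℕ → R) : Matrix (Fin r) (Fin r) R :=
  Matrix.of fun i j => if i ≤ j then u (j - i) else 0

/-- The indices `s` between `i` and `j` correspond to the pairs `(s - i, j - s)` on the antidiagonal
of `j - i`. A general summand `f` lets the same count serve products, products of transposes, and
comultiplications. -/
theorem sum_toeplitz {r : ℕ} {M : Type w} [AddCommMonoid M] (f : ℕ → ℕ → M) (i j : Fin r) :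
    ∑ s : Fin r, (if i ≤ s ∧ s ≤ j then f (s - i) (j - s) else 0) =
      if i ≤ j then ∑ p ∈ antidiagonal ((j : ℕ) - i), f p.1 p.2 else 0 := by
  by_cases h : i ≤ j
  · have h' : (i : ℕ) ≤ j := h
    rw [if_pos h, ← sum_filter]
    refine sum_bij' (fun s _ => ((s : ℕ) - i, (j : ℕ) - s))
      (fun p hp => ⟨i + p.1, by
        have := HasAntidiagonal.mem_antidiagonal.1 hp
        omega⟩) ?_ ?_ ?_ ?_ ?_
    · intro s hs
      simp only [mem_filter, Fin.le_def] at hs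
      simp only [HasAntidiagonal.mem_antidiagonal]
      omega
    · intro p hp
      simp only [HasAntidiagonal.mem_antidiagonal] at hp
      simp only [mem_filter, Fin.le_def, mem_univ, true_and]
      omega
    · intro s hs
      simp only [mem_filter, Fin.le_def] at hs
      ext
      simp only
      omega
    · intro p hp
      simp only [HasAntidiagonal.mem_antidiagonal] at hp
      ext
      · simp
      · simp only; omega
    · intro s hs; rfl
  · rw [if_neg h]
    exact sum_eq_zero fun s _ => if_neg fun hs => h (hs.1.trans hs.2)

theorem upToeplitz_mul (r : ℕ) (u v : ℕ → R) :
    upToeplitz r u * upToeplitz r v = upToeplitz r (cauchyMul u v) := by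
  ext i j
  rw [Matrix.mul_apply]
  simp only [upToeplitz, Matrix.of_apply, ite_zero_mul_ite_zero]
  exact sum_toeplitz (fun a b => u a * v b) i j

/-- The factors keep their order, although the entries need not commute: lower triangular Toeplitz
matrices are another representation of power series, not an anti-representation. Only the pairs on
the antidiagonal are swapped. -/
theorem transpose_upToeplitz_mul (r : ℕ) (u v : ℕ → R) :
    (upToeplitz r u)ᵀ * (upToeplitz r v)ᵀ = (upToeplitz r (cauchyMul u v))ᵀ := by
  ext i j
  rw [Matrix.mul_apply]
  simp only [upToeplitz, Matrix.of_apply, Matrix.transpose_apply, ite_zero_mul_ite_zero]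
  simp only [and_comm (b := j ≤ _)]
  refine (sum_toeplitz (fun a b => u b * v a) j i).trans ?_
  congr 1
  rw [cauchyMul, ← Nat.sum_antidiagonal_swap]
  rfl

theorem upToeplitz_congr {n : ℕ} {u v : ℕ → R} (h : ∀ l ≤ n, u l = v l) :
    upToeplitz (n + 1) u = upToeplitz (n + 1) v := by
  ext i j
  simp only [upToeplitz, Matrix.of_apply]
  rw [h _ (by omega)]

theorem upToeplitz_single {n : ℕ} (d : R) :
    upToeplitz (n + 1) (fun l => if l = 0 then d else 0) = Matrix.scalar (Fin (n + 1)) d := by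
  ext i j
  simp only [upToeplitz, Matrix.of_apply, Matrix.scalar_apply, Matrix.diagonal_apply]
  by_cases h : i = j
  · simp [h]
  · rw [if_neg h]
    split_ifs with h1 h2
    · exact absurd (le_antisymm h1 (by rw [Fin.le_def]; omega)) h
    · rfl
    · rfl

variable {k : Type u} [Field k] [Algebra k R]

theorem scal_Bmat (r : ℕ) (q : k) : scal R (Bmat r q) =
    upToeplitz r (fun l => algebraMap k R (if l = 0 then q else if l = 1 then 1 else 0)) := by
  ext i j
  simp only [scal_apply, upToeplitz, Bmat, Matrix.of_apply]
  rw [← map_zero (algebraMap k R), ← apply_ite (algebraMap k R)]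
  congr 1
  simp only [Fin.ext_iff, Fin.le_def]
  split_ifs <;> first | rfl | omega

/-- As a power series `Bmat` is `q + t`, whose coefficients are central. -/
theorem Bmat_mul_upToeplitz (r : ℕ) (q : k) (u : ℕ → R) :
    scal R (Bmat r q) * upToeplitz r u = upToeplitz r u * scal R (Bmat r q) := by
  rw [scal_Bmat, upToeplitz_mul, upToeplitz_mul]
  congr 1
  ext l
  rw [cauchyMul, cauchyMul, ← Nat.sum_antidiagonal_swap]
  exact sum_congr rfl fun p _ => Algebra.commutes _ _

theorem fromBlocks_scal {ι : Type} [Fintype ι] [DecidableEq ι] (A B C D : Matrix ι ι k) :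
    scal R (Matrix.fromBlocks A B C D) =
      Matrix.fromBlocks (scal R A) (scal R B) (scal R C) (scal R D) :=
  Matrix.fromBlocks_map A B C D _

theorem relation_apply {ι : Type} [Fintype ι] [DecidableEq ι] (E : Matrix ι ι k)
    (A : Matrix ι ι R) (p l : ι) :
    (A * scal R E * Aᵀ) p l = ∑ i, ∑ j, E i j • (A p i * A l j) := by
  rw [Matrix.mul_apply]
  simp only [mul_scal_apply, Matrix.transpose_apply, Finset.sum_mul, smul_mul_assoc]
  exact sum_comm

/-- Block diagonal Toeplitz matrices satisfy the relations of the quantum group. -/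
theorem relation_of_toeplitz {n : ℕ} (q : k) {b c : ℕ → R} {d : R}
    (hbc : ∀ l ≤ n, cauchyMul b c l = if l = 0 then d else 0)
    (hcb : ∀ l ≤ n, cauchyMul c b l = if l = 0 then d else 0) :
    Matrix.fromBlocks (upToeplitz (n + 1) b)ᵀ 0 0 (upToeplitz (n + 1) c) *
        scal R (Dmat (n + 1) q) *
      (Matrix.fromBlocks (upToeplitz (n + 1) b)ᵀ 0 0 (upToeplitz (n + 1) c))ᵀ =
      scal R (Dmat (n + 1) q) * Matrix.scalar _ d := by
  have hd : Matrix.scalar (Fin (n + 1) ⊕ Fin (n + 1)) d =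
      Matrix.fromBlocks (Matrix.scalar _ d) 0 0 (Matrix.scalar _ d) := by
    simp [Matrix.scalar_apply, Matrix.fromBlocks_diagonal]
  -- Only the off-diagonal blocks survive. The upper right one is the transposed Toeplitz matrix of
  -- `b c`; the lower left one is `B` times the Toeplitz matrix of `c b`, after `B` has been moved
  -- to the left.
  rw [Dmat, fromBlocks_scal, hd, Matrix.fromBlocks_transpose, Matrix.fromBlocks_multiply,
    Matrix.fromBlocks_multiply, Matrix.fromBlocks_multiply, ← Bmat_mul_upToeplitz]
  simp only [map_zero, map_one, Matrix.transpose_zero, Matrix.transpose_transpose, mul_zero,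
    zero_mul, add_zero, zero_add, mul_one, one_mul, Matrix.mul_assoc, upToeplitz_mul,
    transpose_upToeplitz_mul]
  rw [upToeplitz_congr hbc, upToeplitz_congr hcb, upToeplitz_single, Matrix.scalar_apply,
    Matrix.diagonal_transpose]

end Toeplitz

/-! ### The square of the antipode as a conjugation -/

section SquareAntipode

open HopfAlgebra

variable {k : Type u} [Field k] {ι : Type} [Fintype ι] [DecidableEq ι] {K : Type u} [Ring K]
  [HopfAlgebra k K]

/-- For a matrix corepresentation with `a E aᵀ = E D` and `E = M Eᵀ`, where `D` is central and
group-like, the square of the antipode is the conjugation with `M`. -/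
theorem map_antipode_sq_mul {a : Matrix ι ι K} {D : K}
    (hΔ : ∀ i j, Coalgebra.comul (R := k) (a i j) = ∑ s, a i s ⊗ₜ[k] a s j)
    (hε : ∀ i j, Coalgebra.counit (R := k) (a i j) = if i = j then 1 else 0)
    (hD : IsGroupLikeElem k D) (hc : ∀ y, D * y = y * D) {E M E' : Matrix ι ι k}
    (hM : E = M * Eᵀ) (hE : Eᵀ * E' = 1)
    (ha : a * scal K E * aᵀ = scal K E * Matrix.scalar ι D) :
    (a.map (antipode k)).map (antipode k) * scal K M = scal K M * a := by
  have hcC (X : Matrix ι ι K) : Matrix.scalar ι D * X = X * Matrix.scalar ι D := by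
    ext i j
    simp [Matrix.scalar_apply, hc]
  set s := a.map (antipode k) with hs
  set s2 := s.map (antipode k) with hs2
  have h1 : s * a = 1 := by
    ext i j
    have := mul_antipode_rTensor_comul_apply (R := k) (a i j)
    rw [hΔ, hε, map_sum, map_sum] at this
    simp only [LinearMap.rTensor_tmul, LinearMap.mul'_apply] at this
    rw [Matrix.mul_apply, Matrix.one_apply]
    refine this.trans ?_
    split_ifs <;> simp
  -- The matrix `s = S(a)` is a left inverse of `a`. Multiplying the relation by it isolates `aᵀ`.
  -- The next two identities come from this one: `h4` by applying the antipode entrywise, where the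
  -- reversal of products brings out `D⁻¹`, and `h5` by transposing.
  have h3 : scal K E * aᵀ = s * scal K E * Matrix.scalar ι D := by
    rw [mul_assoc, ← ha, mul_assoc, ← mul_assoc s, h1, one_mul]
  have h4 : Matrix.scalar ι D * (scal K E * sᵀ) = s2 * scal K E := by
    ext i j
    have h5 := congrFun (congrFun h3 i) j
    rw [scal_mul_apply, Matrix.scalar_apply, Matrix.mul_diagonal, mul_scal_apply] at h5
    have h6 := congrArg (antipode k) h5
    rw [antipode_mul_antidistrib, map_sum, map_sum] at h6
    simp only [map_smul] at h6
    rw [Matrix.scalar_apply, Matrix.diagonal_mul, scal_mul_apply, mul_scal_apply]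
    refine (congrArg (D * ·) h6).trans ?_
    rw [← mul_assoc, hD.mul_antipode_cancel, one_mul]
    rfl
  have h5 : a * scal K Eᵀ = scal K Eᵀ * sᵀ * Matrix.scalar ι D := by
    have h6 := congrArg Matrix.transpose h3
    have h7 : (s * scal K E * Matrix.scalar ι D)ᵀ = (s * scal K E)ᵀ * Matrix.scalar ι D := by
      ext i j
      simp [Matrix.scalar_apply]
    rwa [transpose_scal_mul, Matrix.transpose_transpose, h7, transpose_mul_scal] at h6
  -- With `E = M Eᵀ`: `s2 M Eᵀ = s2 E = D E sᵀ = M (Eᵀ sᵀ D) = M a Eᵀ`, where centrality of `D` is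
  -- used; then `Eᵀ` is cancelled by its right inverse `E'`.
  have h6 : s2 * scal K M * scal K Eᵀ = scal K M * a * scal K Eᵀ := by
    rw [mul_assoc s2, ← map_mul, ← hM, ← h4, mul_assoc (scal K M), h5, hcC]
    nth_rewrite 1 [hM]
    rw [map_mul]
    simp only [mul_assoc]
  have h7 := congrArg (· * scal K E') h6
  simpa only [mul_assoc, ← map_mul, hE, map_one, mul_one] using h7

/-- Linear maps applied entrywise pass through scalar matrices, so the conjugation formula for `S²`
can be iterated. -/
theorem map_antipode_pow_mul {a : Matrix ι ι K} {M : Matrix ι ι k}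
    (h : (a.map (antipode k)).map (antipode k) * scal K M = scal K M * a) (m : ℕ) :
    a.map (antipode k ^ (2 * m) : K →ₗ[k] K) * scal K M ^ m = scal K M ^ m * a := by
  have hl (f : K →ₗ[k] K) (X : Matrix ι ι K) : (X * scal K M).map f = X.map f * scal K M := by
    ext i j
    simp [mul_scal_apply]
  have hr (f : K →ₗ[k] K) (X : Matrix ι ι K) : (scal K M * X).map f = scal K M * X.map f := by
    ext i j
    simp [scal_mul_apply]
  induction m with
  | zero =>
    rw [mul_zero, pow_zero, pow_zero, mul_one, one_mul]
    rfl
  | succ m ih =>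
    have h1 := congrArg (fun X => Matrix.map X (antipode k ^ (2 * m) : K →ₗ[k] K)) h
    simp only [hl, hr] at h1
    have h2 : a.map (antipode k ^ (2 * (m + 1)) : K →ₗ[k] K) =
        ((a.map (antipode k)).map (antipode k)).map (antipode k ^ (2 * m) : K →ₗ[k] K) := by
      rw [mul_add, mul_one, pow_add]
      rfl
    rw [h2, pow_succ', ← mul_assoc, h1, mul_assoc, ih, mul_assoc]

end SquareAntipode

/-! ### The shape of a matrix commuting with a power of `E E⁻ᵀ` -/

section BlockDiagonal

variable {k : Type u} [Field k] {R : Type v} [Ring R] [Algebra k R]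

theorem isUnit_Bmat {r : ℕ} {q : k} (hq : q ≠ 0) : IsUnit (Bmat r q) :=
  isUnit_of_isNilpotent_sub hq (isNilpotent_Bmat_sub r q)

theorem transpose_Bmat_inv {r : ℕ} {q : k} (hq : q ≠ 0) :
    (Bmat r q)ᵀ * ((Bmat r q)ᵀ)⁻¹ = 1 ∧ ((Bmat r q)ᵀ)⁻¹ * (Bmat r q)ᵀ = 1 := by
  have h : IsUnit ((Bmat r q)ᵀ).det :=
    (Matrix.isUnit_iff_isUnit_det _).1
      (isUnit_of_isNilpotent_sub hq (isNilpotent_transpose_sub (isNilpotent_Bmat_sub r q)))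
  exact ⟨Matrix.mul_nonsing_inv _ h, Matrix.nonsing_inv_mul _ h⟩

/-- The matrix `E E⁻ᵀ` for `E = Dmat r q`. -/
def asym (r : ℕ) (q : k) : Matrix (Fin r ⊕ Fin r) (Fin r ⊕ Fin r) k :=
  Matrix.fromBlocks ((Bmat r q)ᵀ)⁻¹ 0 0 (Bmat r q)

theorem Dmat_eq_asym_mul {r : ℕ} {q : k} (hq : q ≠ 0) : Dmat r q = asym r q * (Dmat r q)ᵀ := by
  rw [asym, Dmat, Matrix.fromBlocks_transpose, Matrix.fromBlocks_multiply]
  simp [(transpose_Bmat_inv hq).2]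

theorem transpose_Dmat_mul {r : ℕ} {q : k} (hq : q ≠ 0) :
    (Dmat r q)ᵀ * Matrix.fromBlocks 0 1 ((Bmat r q)ᵀ)⁻¹ 0 = 1 := by
  rw [Dmat, Matrix.fromBlocks_transpose, Matrix.fromBlocks_multiply]
  simp [(transpose_Bmat_inv hq).1]

/-- A matrix that satisfies the relation of the quantum group and commutes with a power of `E E⁻ᵀ`
is a block diagonal matrix with two Toeplitz blocks, which are inverse to each other up to `D`. -/
theorem exists_toeplitz [CharZero k] {n : ℕ} {q : k} (hq₀ : q ≠ 0) (hq : ∀ m : ℕ, 0 < m → q ^ m ≠ 1)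
    {a : Matrix (Fin (n + 1) ⊕ Fin (n + 1)) (Fin (n + 1) ⊕ Fin (n + 1)) R} {d : R}
    {E : Matrix (Fin (n + 1) ⊕ Fin (n + 1)) (Fin (n + 1) ⊕ Fin (n + 1)) k}
    (hE : E = Dmat (n + 1) q) (ha : a * scal R E * aᵀ = scal R E * Matrix.scalar _ d)
    {m : ℕ} (hm : 0 < m) (hc : a * scal R (asym (n + 1) q) ^ m = scal R (asym (n + 1) q) ^ m * a) :
    ∃ b c : ℕ → R, a = Matrix.fromBlocks (upToeplitz (n + 1) b)ᵀ 0 0 (upToeplitz (n + 1) c) ∧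
      (∀ l ≤ n, cauchyMul b c l = if l = 0 then d else 0) ∧ c 0 * b 0 = d := by
  subst hE
  set B := Bmat (n + 1) q
  have hB : IsNilpotent (scal R B - algebraMap k _ q) :=
    isNilpotent_scal_sub (isNilpotent_Bmat_sub _ q)
  have hBt : IsNilpotent (scal R Bᵀ - algebraMap k _ q) :=
    isNilpotent_scal_sub (isNilpotent_transpose_sub (isNilpotent_Bmat_sub _ q))
  have hqm : q ^ m * q ^ m ≠ 1 := by
    rw [← pow_add]
    exact hq _ (by omega)
  obtain ⟨hI1, hI2⟩ := transpose_Bmat_inv (r := n + 1) hq₀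
  have hJ : ∀ m : ℕ, scal R Bᵀ ^ m * scal R (Bᵀ)⁻¹ ^ m = 1 ∧
      scal R (Bᵀ)⁻¹ ^ m * scal R Bᵀ ^ m = 1 := by
    intro m
    have h1 : scal R Bᵀ * scal R (Bᵀ)⁻¹ = 1 := by rw [← map_mul, hI1, map_one]
    have h2 : scal R (Bᵀ)⁻¹ * scal R Bᵀ = 1 := by rw [← map_mul, hI2, map_one]
    have hcm : Commute (scal R Bᵀ) (scal R (Bᵀ)⁻¹) := h1.trans h2.symm
    exact ⟨by rw [← hcm.mul_pow, h1, one_pow], by rw [← hcm.symm.mul_pow, h2, one_pow]⟩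
  obtain ⟨hJ1, hJ2⟩ := hJ m
  obtain ⟨a11, a12, a21, a22, rfl⟩ : ∃ a11 a12 a21 a22, a = Matrix.fromBlocks a11 a12 a21 a22 :=
    ⟨_, _, _, _, (Matrix.fromBlocks_toBlocks a).symm⟩
  have hpow : scal R (asym (n + 1) q) ^ m =
      Matrix.fromBlocks (scal R (Bᵀ)⁻¹ ^ m) 0 0 (scal R B ^ m) := by
    rw [asym, fromBlocks_scal, map_zero, Matrix.fromBlocks_diagonal_pow]
  rw [hpow, Matrix.fromBlocks_multiply, Matrix.fromBlocks_multiply, Matrix.fromBlocks_inj] at hc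
  simp only [mul_zero, zero_mul, add_zero, zero_add] at hc
  obtain ⟨h11, h12, h21, h22⟩ := hc
  -- The off-diagonal conditions read `(Bᵀ)^m a12 B^m = a12` and, below, `B^m a21 (Bᵀ)^m = a21`. The
  -- operators on the left have the single eigenvalue `q^(2m) ≠ 1`.
  have z12 : a12 = 0 := by
    refine eq_zero_of_mul_mul_eq (isNilpotent_pow_sub hBt m) (isNilpotent_pow_sub hB m) hqm ?_
    rw [mul_assoc, h12, ← mul_assoc, hJ1, one_mul]
  have z21 : a21 = 0 := by
    refine eq_zero_of_mul_mul_eq (isNilpotent_pow_sub hB m) (isNilpotent_pow_sub hBt m) hqm ?_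
    rw [← h21, mul_assoc, hJ2, mul_one]
  subst z12 z21
  have c22 := commute_of_commute_pow hq₀ hB hm h22.symm
  -- The upper left block commutes with the power of the inverse `B⁻ᵀ`, hence with that of `Bᵀ`.
  -- Commutation with `Bᵀ` itself is then transposed, so that this block too becomes upper
  -- triangular Toeplitz.
  have c11 : scal R Bᵀ * a11 = a11 * scal R Bᵀ := by
    refine commute_of_commute_pow hq₀ hBt hm ?_
    calc _ = scal R Bᵀ ^ m * (a11 * scal R (Bᵀ)⁻¹ ^ m) * scal R Bᵀ ^ m := by
          rw [mul_assoc, mul_assoc, hJ2, mul_one]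
      _ = _ := by rw [h11, ← mul_assoc, hJ1, one_mul]
  have c11' : scal R B * a11ᵀ = a11ᵀ * scal R B := by
    have := congrArg Matrix.transpose c11
    rwa [transpose_scal_mul, transpose_mul_scal, Matrix.transpose_transpose, eq_comm] at this
  have htoep {X : Matrix (Fin (n + 1)) (Fin (n + 1)) R} (hX : scal R B * X = X * scal R B) :
      X = upToeplitz (n + 1) fun l => if h : l < n + 1 then X 0 ⟨l, h⟩ else 0 := by
    ext i j
    rw [toeplitz_of_commute_Bmat hX]
    simp only [upToeplitz, Matrix.of_apply]
    split_ifs <;> first | rfl | omega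
  have e11 := htoep c11'
  have e22 := htoep c22
  set b : ℕ → R := fun l => if h : l < n + 1 then a11ᵀ 0 ⟨l, h⟩ else 0
  set c : ℕ → R := fun l => if h : l < n + 1 then a22 0 ⟨l, h⟩ else 0
  have e11' : a11 = (upToeplitz (n + 1) b)ᵀ := by rw [← e11, Matrix.transpose_transpose]
  have hd : Matrix.scalar (Fin (n + 1) ⊕ Fin (n + 1)) d =
      Matrix.fromBlocks (Matrix.scalar _ d) 0 0 (Matrix.scalar _ d) := by
    simp [Matrix.scalar_apply, Matrix.fromBlocks_diagonal]
  refine ⟨b, c, by rw [← e11', ← e22], ?_⟩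
  rw [e11', e22, Dmat, fromBlocks_scal, hd, Matrix.fromBlocks_transpose,
    Matrix.fromBlocks_multiply, Matrix.fromBlocks_multiply, Matrix.fromBlocks_multiply,
    ← Bmat_mul_upToeplitz, Matrix.fromBlocks_inj] at ha
  simp only [map_zero, map_one, Matrix.transpose_zero, Matrix.transpose_transpose, mul_zero,
    zero_mul, add_zero, zero_add, mul_one, one_mul, Matrix.mul_assoc, upToeplitz_mul,
    transpose_upToeplitz_mul] at ha
  -- The upper right block says `b c = d` as truncated series. The lower left block says `B (c b) =
  -- B d`; after cancelling the invertible `B`, only its constant coefficient is recorded.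
  obtain ⟨-, h1, h2, -⟩ := ha
  constructor
  · intro l hl
    have := congrFun (congrFun h1 ⟨l, by omega⟩) 0
    simp only [upToeplitz, Matrix.transpose_apply, Matrix.of_apply, Fin.zero_le, if_true,
      Matrix.scalar_apply, Matrix.diagonal_apply] at this
    simpa [Fin.ext_iff] using this
  · obtain ⟨U, hU⟩ := (isUnit_Bmat (r := n + 1) hq₀).map (scal (ι := Fin (n + 1)) R)
    rw [← hU] at h2
    have h3 := U.isUnit.mul_left_cancel h2
    have := congrFun (congrFun h3 0) 0
    simpa [upToeplitz, cauchyMul] using this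

end BlockDiagonal

/-! ### Homomorphisms out of `O_A(GL)` -/

section Corepresentations

variable {k : Type u} [Field k] {ι : Type} [Fintype ι] [DecidableEq ι] (E : Matrix ι ι k)

theorem comul_aGL (i j : ι) :
    Coalgebra.comul (R := k) (aGL E i j) = ∑ s, aGL E i s ⊗ₜ[k] aGL E s j := by
  have hΔ : Coalgebra.comul (R := k) (OM.a E i j) = ∑ s, OM.a E i s ⊗ₜ[k] OM.a E s j := by
    change Algebra.TensorProduct.map _ _ (Coalgebra.comul (FreeMat.X k i j)) = _
    simp only [FreeMat.comul_X, map_sum, Algebra.TensorProduct.map_tmul]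
    rfl
  rw [aGL, ← CoalgHomClass.map_comp_comul_apply, hΔ, map_sum]
  rfl

theorem counit_aGL (i j : ι) :
    Coalgebra.counit (R := k) (aGL E i j) = if i = j then 1 else 0 :=
  (CoalgHomClass.counit_comp_apply (HopfEnvelope.ι k (OM E)) _).trans (FreeMat.counit_X k i j)

/-- Although the envelope is generated by all the copies `j i`, a bialgebra maps epimorphically to
its Hopf envelope, so the entries `a_{ij}` of the first copy suffice even for algebra homomorphisms.
-/
theorem OGL_algHom_ext {Q : Type v} [Ring Q] [Algebra k Q] {F G : OGL E →ₐ[k] Q}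
    (h : ∀ i j, F (aGL E i j) = G (aGL E i j)) : F = G := by
  refine HopfEnvelope.algHom_ext_ι fun b => ?_
  have : F.comp (HopfEnvelope.ι k (OM E) : OM E →ₐ[k] OGL E) =
      G.comp (HopfEnvelope.ι k (OM E) : OM E →ₐ[k] OGL E) :=
    Ideal.Quotient.algHom_ext k (FreeMat.hom_ext k h)
  exact AlgHom.congr_fun this b

variable {T : Type u} [Ring T] [HopfAlgebra k T]

/-- A matrix corepresentation of a Hopf algebra `T` that satisfies the relation is given by a
homomorphism from `O_A(GL)` to `T`. -/
theorem exists_OGL_hom {A : Matrix ι ι T} {D : T}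
    (hΔ : ∀ i j, Coalgebra.comul (R := k) (A i j) = ∑ s, A i s ⊗ₜ[k] A s j)
    (hε : ∀ i j, Coalgebra.counit (R := k) (A i j) = if i = j then 1 else 0)
    (hA : A * scal T E * Aᵀ = scal T E * Matrix.scalar ι D) :
    ∃ F : OGL E →ₐc[k] T, ∀ i j, F (aGL E i j) = A i j := by
  let f : FreeMat k ι →ₐc[k] T := BialgHom.ofAlgHom (FreeMat.lift k fun i j => A i j)
    (FreeMat.hom_ext k fun i j => by
      simp [hε])
    (FreeMat.hom_ext k fun i j => by
      simp only [AlgHom.comp_apply, Bialgebra.comulAlgHom_apply, FreeMat.comul_X, map_sum,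
        Algebra.TensorProduct.map_tmul, FreeMat.lift_X, hΔ])
  have hf (i j : ι) : f (FreeMat.X k i j) = A i j :=
    FreeMat.lift_X k (fun i j => A i j) i j
  have hA' (p l : ι) : ∑ i, ∑ j, E i j • (A p i * A l j) = E p l • D := by
    rw [← relation_apply, hA, Matrix.scalar_apply, Matrix.mul_diagonal, scal_apply,
      Algebra.smul_def]
  -- Under `f` a defining relation given by `d` goes to `∑ d p l • E p l • D`, which vanishes
  -- because `d` is orthogonal to `E`.
  let g : OM E →ₐc[k] T := quotLift (maninRel E) f (by
    rintro _ ⟨d, hd, rfl⟩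
    simp only [map_sum, map_smul, map_mul, hf, hA', smul_smul, ← Finset.sum_smul, hd, zero_smul])
  obtain ⟨F, hF, -⟩ := HopfEnvelope.existsUnique_lift g
  exact ⟨F, fun i j => (hF _).trans (hf i j)⟩

theorem relation_aGL :
    Matrix.of (aGL E) * scal (OGL E) E * (Matrix.of (aGL E))ᵀ =
      scal (OGL E) E * Matrix.scalar ι (qdetGL E) := by
  ext p l
  rw [relation_apply, Matrix.scalar_apply, Matrix.mul_diagonal, scal_apply, ← Algebra.smul_def]
  exact qdetGL_spec E p l

theorem relation_map {R : Type v} {Q : Type w} [Ring R] [Algebra k R] [Ring Q] [Algebra k Q]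
    (F : R →ₐ[k] Q) {A : Matrix ι ι R} {D : R}
    (hA : A * scal R E * Aᵀ = scal R E * Matrix.scalar ι D) :
    A.map F * scal Q E * (A.map F)ᵀ = scal Q E * Matrix.scalar ι (F D) := by
  have h1 : scal Q E = (scal R E).map F := by
    ext i j
    simp [scal_apply]
  have h2 : Matrix.scalar ι (F D) = (Matrix.scalar ι D).map F := by
    ext i j
    simp [Matrix.scalar_apply, Matrix.diagonal_apply, apply_ite F]
  rw [h1, h2, ← Matrix.transpose_map, ← Matrix.map_mul, ← Matrix.map_mul, hA, Matrix.map_mul]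

/-- The matrix relation determines its scalar factor: one nonzero entry of `E` is enough to compare
`F (qdetGL E)` with `D`. -/
theorem map_qdetGL {F : OGL E →ₐ[k] T} {A : Matrix ι ι T} {D : T} (hE : E ≠ 0)
    (hF : ∀ i j, F (aGL E i j) = A i j)
    (hA : A * scal T E * Aᵀ = scal T E * Matrix.scalar ι D) : F (qdetGL E) = D := by
  obtain ⟨p, l, hpl⟩ : ∃ p l, E p l ≠ 0 := by
    by_contra! h
    exact hE (Matrix.ext h)
  have h := relation_map E F (relation_aGL E)
  have h1 : (Matrix.of (aGL E)).map F = A := Matrix.ext hF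
  rw [h1, hA] at h
  have h2 := congrFun (congrFun h p) l
  rw [Matrix.scalar_apply, Matrix.mul_diagonal, Matrix.scalar_apply, Matrix.mul_diagonal,
    scal_apply, ← Algebra.smul_def, ← Algebra.smul_def] at h2
  exact (smul_right_injective _ hpl h2).symm

end Corepresentations

/-- In the quotients of a Hopf quotient of `O_A(GL)` with central quantum determinant, the generic
matrix is block diagonal with Toeplitz blocks. -/
theorem exists_toeplitz_sQuot {k : Type u} [Field k] [CharZero k] {n : ℕ} {q : k} (hq₀ : q ≠ 0)
    (hq : ∀ m : ℕ, 0 < m → q ^ m ≠ 1)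
    {E : Matrix (Fin (n + 1) ⊕ Fin (n + 1)) (Fin (n + 1) ⊕ Fin (n + 1)) k}
    (hE : E = Dmat (n + 1) q) (hE₀ : E ≠ 0) {K : Type u} [Ring K] [HopfAlgebra k K]
    (p : OGL E →ₐc[k] K)
    (hp : ∀ y, p (qdetGL E) * y = y * p (qdetGL E)) {m : ℕ} (hm : 0 < m) :
    ∃ b c : ℕ → SQuot k K m,
      (∀ i j, Ideal.Quotient.mk (idealOf (sPowRel k K m)) (p (aGL E i j)) =
        Matrix.fromBlocks (upToeplitz (n + 1) b)ᵀ 0 0 (upToeplitz (n + 1) c) i j) ∧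
      (∀ l ≤ n, cauchyMul b c l =
        if l = 0 then Ideal.Quotient.mk (idealOf (sPowRel k K m)) (p (qdetGL E)) else 0) ∧
      c 0 * b 0 = Ideal.Quotient.mk (idealOf (sPowRel k K m)) (p (qdetGL E)) := by
  set A : Matrix _ _ K := (Matrix.of (aGL E)).map (p : OGL E →ₐ[k] K)
  have hA : A * scal K E * Aᵀ = scal K E * Matrix.scalar _ (p (qdetGL E)) :=
    relation_map E (p : OGL E →ₐ[k] K) (relation_aGL E)
  have h1 := map_antipode_pow_mul (map_antipode_sq_mul (a := A)
    (fun i j => by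
      change Coalgebra.comul (R := k) (p (aGL E i j)) = _
      rw [← CoalgHomClass.map_comp_comul_apply, comul_aGL, map_sum]
      rfl)
    (fun i j => (CoalgHomClass.counit_comp_apply p _).trans (counit_aGL E i j))
    ((isGroupLikeElem_qdetGL E hE₀).map p) hp
    (hE ▸ Dmat_eq_asym_mul hq₀) (hE ▸ transpose_Dmat_mul hq₀) hA) m
  set π := Ideal.Quotient.mkₐ k (idealOf (sPowRel k K m))
  have hπ (X : Matrix (Fin (n + 1) ⊕ Fin (n + 1)) (Fin (n + 1) ⊕ Fin (n + 1)) k) :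
      (scal K X).map π = scal _ X := by
    ext i j
    simp [scal_apply]
  have h2 := congrArg (fun X => Matrix.map X π) h1
  simp only [Matrix.map_mul, ← map_pow, hπ] at h2
  rw [map_pow] at h2
  -- In the quotient `S^{2m}` is the identity, so conjugation by `M^m` fixes the generic matrix.
  have h3 : (A.map (HopfAlgebra.antipode k ^ (2 * m) : K →ₗ[k] K)).map π = A.map π := by
    ext i j
    exact mk_antipode_pow k K m (A i j)
  rw [h3] at h2
  obtain ⟨b, c, hbc, h4, h5⟩ := exists_toeplitz hq₀ hq hE (relation_map E π hA) hm h2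
  exact ⟨b, c, fun i j => congrFun (congrFun hbc i) j, h4, h5⟩

/-! ### Toeplitz matrices as matrix corepresentations -/

section Comultiplication

variable {k : Type u} [Field k] {T : Type u} [Ring T] [Bialgebra k T] {n : ℕ} {u : ℕ → T}

theorem ite_tmul_ite {P Q : Prop} [Decidable P] [Decidable Q] (x y : T) :
    (if P then x else 0) ⊗ₜ[k] (if Q then y else 0) = if P ∧ Q then x ⊗ₜ[k] y else 0 := by
  split_ifs <;> simp_all

theorem comul_upToeplitz
    (hu : ∀ l ≤ n, Coalgebra.comul (R := k) (u l) = ∑ p ∈ antidiagonal l, u p.1 ⊗ₜ[k] u p.2)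
    (i j : Fin (n + 1)) : Coalgebra.comul (R := k) (upToeplitz (n + 1) u i j) =
      ∑ s, upToeplitz (n + 1) u i s ⊗ₜ[k] upToeplitz (n + 1) u s j := by
  simp only [upToeplitz, Matrix.of_apply, ite_tmul_ite]
  rw [sum_toeplitz (fun a b => u a ⊗ₜ[k] u b), apply_ite (Coalgebra.comul (R := k)),
    hu _ (by omega), map_zero]

/-- The sum over the antidiagonal is symmetric under exchanging the tensor factors, so the
transposed Toeplitz matrix is multiplicative as well. -/
theorem comul_transpose_upToeplitz
    (hu : ∀ l ≤ n, Coalgebra.comul (R := k) (u l) = ∑ p ∈ antidiagonal l, u p.1 ⊗ₜ[k] u p.2)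
    (i j : Fin (n + 1)) : Coalgebra.comul (R := k) ((upToeplitz (n + 1) u)ᵀ i j) =
      ∑ s, (upToeplitz (n + 1) u)ᵀ i s ⊗ₜ[k] (upToeplitz (n + 1) u)ᵀ s j := by
  simp only [upToeplitz, Matrix.of_apply, Matrix.transpose_apply, ite_tmul_ite]
  simp only [and_comm (b := j ≤ _)]
  rw [sum_toeplitz (fun a b => u b ⊗ₜ[k] u a), apply_ite (Coalgebra.comul (R := k)),
    hu _ (by omega), map_zero, ← Nat.sum_antidiagonal_swap]
  rfl

theorem counit_upToeplitz
    (hu : ∀ l ≤ n, Coalgebra.counit (R := k) (u l) = if l = 0 then 1 else 0) (i j : Fin (n + 1)) :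
    Coalgebra.counit (R := k) (upToeplitz (n + 1) u i j) = if i = j then 1 else 0 := by
  simp only [upToeplitz, Matrix.of_apply]
  rw [apply_ite (Coalgebra.counit (R := k)), hu _ (by omega), map_zero]
  simp only [Fin.le_def, Fin.ext_iff]
  split_ifs <;> first | rfl | omega

/-- A block diagonal matrix of two Toeplitz blocks. -/
def blockToeplitz (n : ℕ) {R : Type v} [Ring R] (b c : ℕ → R) :
    Matrix (Fin (n + 1) ⊕ Fin (n + 1)) (Fin (n + 1) ⊕ Fin (n + 1)) R :=
  Matrix.fromBlocks (upToeplitz (n + 1) b)ᵀ 0 0 (upToeplitz (n + 1) c)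

theorem comul_blockToeplitz {v : ℕ → T}
    (hu : ∀ l ≤ n, Coalgebra.comul (R := k) (u l) = ∑ p ∈ antidiagonal l, u p.1 ⊗ₜ[k] u p.2)
    (hv : ∀ l ≤ n, Coalgebra.comul (R := k) (v l) = ∑ p ∈ antidiagonal l, v p.1 ⊗ₜ[k] v p.2)
    (i j : Fin (n + 1) ⊕ Fin (n + 1)) :
    Coalgebra.comul (R := k) (blockToeplitz n u v i j) =
      ∑ s, blockToeplitz n u v i s ⊗ₜ[k] blockToeplitz n u v s j := by
  rw [Fintype.sum_sum_type]
  rcases i with i | i <;> rcases j with j | j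
  · simp only [blockToeplitz, Matrix.fromBlocks_apply₁₁, Matrix.fromBlocks_apply₁₂,
      Matrix.zero_apply, TensorProduct.zero_tmul, Finset.sum_const_zero, add_zero]
    exact comul_transpose_upToeplitz (hu) i j
  · simp [blockToeplitz]
  · simp [blockToeplitz]
  · simp only [blockToeplitz, Matrix.fromBlocks_apply₂₂, Matrix.fromBlocks_apply₂₁,
      Matrix.zero_apply, TensorProduct.zero_tmul, Finset.sum_const_zero, zero_add]
    exact comul_upToeplitz (hv) i j

theorem counit_blockToeplitz {v : ℕ → T}
    (hu : ∀ l ≤ n, Coalgebra.counit (R := k) (u l) = if l = 0 then 1 else 0)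
    (hv : ∀ l ≤ n, Coalgebra.counit (R := k) (v l) = if l = 0 then 1 else 0)
    (i j : Fin (n + 1) ⊕ Fin (n + 1)) :
    Coalgebra.counit (R := k) (blockToeplitz n u v i j) = if i = j then 1 else 0 := by
  rcases i with i | i <;> rcases j with j | j
  · simp only [blockToeplitz, Matrix.fromBlocks_apply₁₁, Matrix.transpose_apply, Sum.inl.injEq]
    rw [counit_upToeplitz (hu)]
    simp only [eq_comm]
  · simp [blockToeplitz]
  · simp [blockToeplitz]
  · simp only [blockToeplitz, Matrix.fromBlocks_apply₂₂, Sum.inr.injEq]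
    exact counit_upToeplitz (hv) i j

end Comultiplication

/-! ### Shift actions and the universal block matrix of the smash product -/

section ShiftAction

variable {k : Type u} [Field k] {n : ℕ} {Γ : Type} [CommGroup Γ]
  [MulSemiringAction Γ (FNSymm k n)]

variable (k n) in
/-- A commutative group acts on `FNSymm` through a shift of degree `deg`, and it is generated by an
element `g` of degree `1` and an element `h` of degree `-1`. -/
structure IsShiftAction (deg : Γ → ℤ) (g h : Γ) : Prop where
  smul_inc : ∀ (w : Γ) (s : ℤ) (y : NSymm k n), w • FreePow.inc k ℤ (NSymm k n) s y =
    FreePow.inc k ℤ (NSymm k n) (s + deg w) ((NSymm.phi k n ^ deg w) y)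
  deg_zpow : ∀ s : ℤ, deg (g ^ s) = s
  deg_right : deg h = -1
  closure_eq : Subgroup.closure {g, h} = ⊤

theorem NSymm.phi_phi (y : NSymm k n) : NSymm.phi k n (NSymm.phi k n y) = y :=
  (NSymm.phi k n).apply_symm_apply y

theorem NSymm.phi_sq : NSymm.phi k n ^ (2 : ℤ) = 1 := AlgEquiv.ext NSymm.phi_phi

theorem NSymm.phi_neg_one : NSymm.phi k n ^ (-1 : ℤ) = NSymm.phi k n := by
  rw [show (-1 : ℤ) = 1 - 2 by norm_num, _root_.zpow_sub, NSymm.phi_sq, zpow_one, inv_one, mul_one]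

variable {deg : Γ → ℤ} {g h : Γ}

theorem IsShiftAction.smul_left (hΓ : IsShiftAction k n deg g h) (y : NSymm k n) :
    g • FreePow.inc k ℤ (NSymm k n) (-1) y =
    FreePow.inc k ℤ (NSymm k n) 0 (NSymm.phi k n y) := by
  have h1 : deg g = 1 := by simpa using hΓ.deg_zpow 1
  rw [hΓ.smul_inc, h1, zpow_one]; rfl

theorem IsShiftAction.smul_right (hΓ : IsShiftAction k n deg g h)
    (y : NSymm k n) : h • FreePow.inc k ℤ (NSymm k n) 0 y =
    FreePow.inc k ℤ (NSymm k n) (-1) (NSymm.phi k n y) := by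
  rw [hΓ.smul_inc, hΓ.deg_right, NSymm.phi_neg_one]; rfl

variable [SMulCommClass Γ k (FNSymm k n)]

variable (k n) in
/-- The elements `x_l^{[s]} w` of the smash product. -/
def smashGen (s : ℤ) (w : Γ) (l : ℕ) : Smash (FNSymm k n) Γ :=
  Smash.inA k (FNSymm k n) Γ (FreePow.inc k ℤ (NSymm k n) s (NSymm.x k n l)) *
    Smash.inG (FNSymm k n) Γ w

theorem smashGen_zero (s : ℤ) (w : Γ) : smashGen k n s w 0 = Smash.inG (FNSymm k n) Γ w := by
  rw [smashGen, NSymm.x, map_one, map_one, one_mul]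

/-- By hypothesis `w` carries copy `t` to copy `s` with a twist by `φ`. Moving `w` to the right
turns the second series into `invSeq` of the first one inside the same copy, and the product
collapses to its constant term. -/
theorem cauchyMul_smashGen {s t : ℤ} {w w' : Γ}
    (h : ∀ y : NSymm k n, w • FreePow.inc k ℤ (NSymm k n) t y =
      FreePow.inc k ℤ (NSymm k n) s (NSymm.phi k n y)) {l : ℕ} (hl : l ≤ n) :
    cauchyMul (smashGen k n s w) (smashGen k n t w') l =
      if l = 0 then Smash.inG (FNSymm k n) Γ (w * w') else 0 := by
  have key (a b : ℕ) (hb : b ≤ n) : smashGen k n s w a * smashGen k n t w' b =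
      Smash.inA k (FNSymm k n) Γ (FreePow.inc k ℤ (NSymm k n) s
        (NSymm.x k n a * invSeq (NSymm.x k n) b)) * Smash.inG (FNSymm k n) Γ (w * w') := by
    rw [smashGen, smashGen, mul_assoc, ← mul_assoc (Smash.inG _ _ w), Smash.inG_mul_inA, h,
      NSymm.phi_x k n hb, map_mul, map_mul, map_mul]
    simp only [mul_assoc]
  rw [cauchyMul, sum_congr rfl fun p hp =>
    key p.1 p.2 ((NSymm.snd_le_of_mem hp).trans hl), ← Finset.sum_mul, ← map_sum, ← map_sum,
    sum_mul_invSeq _ rfl]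
  split_ifs <;> simp

variable (k n) in
/-- The block diagonal matrix corepresentation of the smash product. -/
def smashMat (g h : Γ) :
    Matrix (Fin (n + 1) ⊕ Fin (n + 1)) (Fin (n + 1) ⊕ Fin (n + 1)) (Smash (FNSymm k n) Γ) :=
  blockToeplitz n (smashGen k n 0 g) (smashGen k n (-1) h)

theorem IsShiftAction.relation (hΓ : IsShiftAction k n deg g h) (q : k) :
    smashMat k n g h * scal _ (Dmat (n + 1) q) * (smashMat k n g h)ᵀ =
      scal _ (Dmat (n + 1) q) * Matrix.scalar _ (Smash.inG (FNSymm k n) Γ (g * h)) :=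
  relation_of_toeplitz q (fun _ hl => cauchyMul_smashGen hΓ.smul_left hl)
    (fun _ hl => (cauchyMul_smashGen hΓ.smul_right hl).trans (by rw [mul_comm h g]))

/-- Homomorphisms from the smash product are determined by their values on the entries of the
matrix corepresentation. -/
theorem IsShiftAction.algHom_ext (hΓ : IsShiftAction k n deg g h)
    {Q : Type v} [Ring Q] [Algebra k Q]
    {F F' : Smash (FNSymm k n) Γ →ₐ[k] Q}
    (h1 : ∀ l ≤ n, F (smashGen k n 0 g l) = F' (smashGen k n 0 g l))
    (h2 : F (smashGen k n (-1) h 0) = F' (smashGen k n (-1) h 0)) : F = F' := by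
  -- The values at index `0` are those on `g` and `h`, which generate `Γ`.
  have hG : (F : Smash (FNSymm k n) Γ →* Q).comp (Smash.inG (FNSymm k n) Γ) =
      (F' : Smash (FNSymm k n) Γ →* Q).comp (Smash.inG (FNSymm k n) Γ) := by
    refine MonoidHom.eq_of_eqOn_dense hΓ.closure_eq ?_
    rintro _ (rfl | rfl)
    · have := h1 0 (Nat.zero_le _)
      rwa [smashGen_zero] at this
    · rwa [smashGen_zero] at h2
  have hG' (w : Γ) : F (Smash.inG _ _ w) = F' (Smash.inG _ _ w) := DFunLike.congr_fun hG w
  have h0 (y : NSymm k n) : F (Smash.inA k _ Γ (FreePow.inc k ℤ _ 0 y)) =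
      F' (Smash.inA k _ Γ (FreePow.inc k ℤ _ 0 y)) := by
    have : (F.comp (Smash.inA k _ Γ)).comp (FreePow.inc k ℤ _ 0) =
        (F'.comp (Smash.inA k _ Γ)).comp (FreePow.inc k ℤ _ 0) := NSymm.hom_ext fun l hl => by
      have e : Smash.inA k _ Γ (FreePow.inc k ℤ _ 0 (NSymm.x k n l)) =
          smashGen k n 0 g l * Smash.inG _ _ g⁻¹ := by
        rw [smashGen, mul_assoc, ← map_mul, mul_inv_cancel, map_one, mul_one]
      simp only [AlgHom.comp_apply, e, map_mul, h1 l hl, hG']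
    exact AlgHom.congr_fun this y
  refine Smash.hom_ext (fun a => ?_) hG'
  have : F.comp (Smash.inA k _ Γ) = F'.comp (Smash.inA k _ Γ) := FreePow.hom_ext fun s y => by
    -- Copy `s` is the conjugate of copy `0` by `g ^ s`, up to the automorphism `φ^s`, so agreement
    -- on copy `0` and on `Γ` suffices.
    obtain ⟨z, rfl⟩ := (NSymm.phi k n ^ s : NSymm k n ≃ₐ[k] NSymm k n).surjective y
    have e : FreePow.inc k ℤ _ s ((NSymm.phi k n ^ s : NSymm k n ≃ₐ[k] NSymm k n) z) =
        g ^ s • FreePow.inc k ℤ _ 0 z := by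
      rw [hΓ.smul_inc, hΓ.deg_zpow, zero_add]
    have e' (a : FNSymm k n) : Smash.inA k _ Γ (g ^ s • a) =
        Smash.inG _ _ (g ^ s) * Smash.inA k _ Γ a * Smash.inG _ _ (g ^ s)⁻¹ := by
      rw [Smash.inG_mul_inA, mul_assoc, ← map_mul, mul_inv_cancel, map_one, mul_one]
    rw [e, AlgHom.comp_apply, AlgHom.comp_apply, e', map_mul, map_mul, map_mul, map_mul, h0, hG',
      hG']
  exact AlgHom.congr_fun this a

variable [BialgAction k (FNSymm k n) Γ]

theorem comul_smashGen (s : ℤ) (w : Γ) {l : ℕ} (hl : l ≤ n) :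
    Coalgebra.comul (R := k) (smashGen k n s w l) =
      ∑ p ∈ antidiagonal l, smashGen k n s w p.1 ⊗ₜ[k] smashGen k n s w p.2 := by
  have h1 := Smash.comulHom_inA k (FNSymm k n) Γ (FreePow.inc k ℤ (NSymm k n) s (NSymm.x k n l))
  have h2 := Smash.comulHom_inG k (FNSymm k n) Γ w
  rw [FreePow.comul_inc, NSymm.comul_x k n hl] at h1
  rw [smashGen, Bialgebra.comul_mul]
  refine (congrArg₂ (· * ·) h1 h2).trans ?_
  simp only [map_sum, TensorProduct.map_tmul, Finset.sum_mul, Algebra.TensorProduct.tmul_mul_tmul]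
  rfl

theorem counit_smashGen (s : ℤ) (w : Γ) {l : ℕ} (hl : l ≤ n) :
    Coalgebra.counit (R := k) (smashGen k n s w l) = if l = 0 then 1 else 0 := by
  have h1 := Smash.counitHom_inA k (FNSymm k n) Γ (FreePow.inc k ℤ (NSymm k n) s (NSymm.x k n l))
  have h2 := Smash.counitHom_inG k (FNSymm k n) Γ w
  rw [FreePow.counit_inc, NSymm.counit_x k n hl] at h1
  rw [smashGen, Bialgebra.counit_mul]
  exact (congrArg₂ (· * ·) h1 h2).trans (mul_one _)

end ShiftAction

/-! ### Homomorphisms out of the smash product -/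

section SmashHom

variable {k : Type u} [Field k] {n : ℕ} {Γ : Type} [CommGroup Γ]
  [MulSemiringAction Γ (FNSymm k n)] [SMulCommClass Γ k (FNSymm k n)] {deg : Γ → ℤ} {g h : Γ}
  {Q : Type v} [Ring Q] [Algebra k Q]

/-- The right inverse of a sequence with respect to the Cauchy product is unique. -/
theorem eq_invSeq_of_cauchyMul {u v : ℕ → Q} (hu : u 0 = 1)
    (h : ∀ l ≤ n, cauchyMul u v l = if l = 0 then 1 else 0) {l : ℕ} (hl : l ≤ n) :
    v l = invSeq u l := by
  induction l using Nat.strong_induction_on with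
  | _ l ih =>
    have h1 := (h l hl).trans (sum_mul_invSeq u hu l).symm
    have hm : (0, l) ∈ antidiagonal l := by simp
    rw [cauchyMul, ← add_sum_erase _ _ hm, ← add_sum_erase _ _ hm] at h1
    rw [sum_congr rfl fun p hp => ?_] at h1
    · have := add_right_cancel h1
      simpa [hu] using this
    · obtain ⟨h2, h3⟩ := mem_erase.1 hp
      rw [HasAntidiagonal.mem_antidiagonal] at h3
      have : p.2 ≠ l := fun h4 => h2 (Prod.ext (by simp only; omega) h4)
      rw [ih p.2 (by omega) (by omega)]

theorem map_invSeq {R : Type u} [Ring R] {R' : Type u} [Ring R'] (f : R →+* R') (u : ℕ → R)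
    (l : ℕ) :
    f (invSeq u l) = invSeq (fun i => f (u i)) l := by
  induction l using Nat.strong_induction_on with
  | _ l ih =>
    cases l with
    | zero => rw [invSeq_zero, invSeq_zero, map_one]
    | succ m =>
      rw [invSeq_succ, invSeq_succ, map_neg, map_sum]
      congr 1
      refine sum_congr rfl fun j hj => ?_
      rw [map_mul, ih (m - j) (by omega)]

variable (k) in
/-- The conjugation with a unit. -/
def conjHom (U : Qˣ) : Q →ₐ[k] Q where
  toFun y := U * y * (U⁻¹ : Qˣ)
  map_one' := by simp
  map_mul' x y := by simp [mul_assoc]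
  map_zero' := by simp
  map_add' x y := by simp [mul_add, add_mul]
  commutes' c := by rw [← Algebra.commutes, mul_assoc, Units.mul_inv, mul_one]

theorem conjHom_apply (U : Qˣ) (y : Q) : conjHom k U y = U * y * (U⁻¹ : Qˣ) := rfl

theorem conjHom_mul (U V : Qˣ) (y : Q) : conjHom k (U * V) y = conjHom k U (conjHom k V y) := by
  simp [conjHom_apply, mul_assoc]

/-- A homomorphism is forced on copy `s` by its value on copy `0`: precompose with `φ^s` and
conjugate by `γ g ^ s`. Equivariance under all of `Γ` holds because `γ w` acts by conjugation only
through the degree of `w`. -/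
theorem IsShiftAction.exists_hom (hΓ : IsShiftAction k n deg g h) (f : NSymm k n →ₐ[k] Q)
    (γ : Γ →* Qˣ) (hγ : ∀ w y, conjHom k (γ w) y = conjHom k (γ g ^ deg w) y) :
    ∃ Ψ : Smash (FNSymm k n) Γ →ₐ[k] Q, (∀ w, Ψ (Smash.inG _ _ w) = γ w) ∧
      ∀ y, Ψ (Smash.inA k _ Γ (FreePow.inc k ℤ _ 0 y)) = f y := by
  let F : FNSymm k n →ₐ[k] Q := FreePow.lift fun s =>
    ((conjHom k (γ g ^ s)).comp f).comp
      ((NSymm.phi k n ^ s : NSymm k n ≃ₐ[k] NSymm k n) : NSymm k n →ₐ[k] NSymm k n)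
  have hF (s : ℤ) (y : NSymm k n) : F (FreePow.inc k ℤ _ s y) =
      conjHom k (γ g ^ s) (f ((NSymm.phi k n ^ s) y)) := FreePow.lift_inc _ s y
  have key (w : Γ) (a : FNSymm k n) : conjHom k (γ w) (F a) = F (w • a) := by
    have : (conjHom k (γ w)).comp F = F.comp (MulSemiringAction.toAlgHom k (FNSymm k n) w) :=
      FreePow.hom_ext fun s y => by
        -- The twist by `φ ^ deg w` occurs twice, once in the action and once in the definition of
        -- `F`, and cancels since `φ² = 1`.
        have hphi : NSymm.phi k n ^ (s + deg w) * NSymm.phi k n ^ deg w = NSymm.phi k n ^ s := by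
          rw [← _root_.zpow_add, show s + deg w + deg w = s + 2 * deg w by ring, _root_.zpow_add,
            _root_.zpow_mul, NSymm.phi_sq, _root_.one_zpow, mul_one]
        rw [AlgHom.comp_apply, AlgHom.comp_apply, MulSemiringAction.toAlgHom_apply, hΓ.smul_inc,
          hF, hF, ← AlgEquiv.mul_apply, hphi, hγ, ← conjHom_mul, ← _root_.zpow_add, add_comm]
    exact AlgHom.congr_fun this a
  refine ⟨Smash.lift F ((Units.coeHom Q).comp γ) fun w a => ?_, fun w => Smash.lift_inG _ _ _ w,
    fun y => ?_⟩
  · rw [← key, conjHom_apply]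
    change (γ w : Q) * F a = _ * (γ w : Q)
    rw [mul_assoc, Units.inv_mul, mul_one]
  · rw [Smash.lift_inA, hF, _root_.zpow_zero, _root_.zpow_zero, conjHom_apply]
    simp

end SmashHom

/-! ### Each quotient is the smash product -/

section Bijectivity

variable {k : Type u} [Field k] {n : ℕ} {Γ : Type} [CommGroup Γ]
  [MulSemiringAction Γ (FNSymm k n)] [SMulCommClass Γ k (FNSymm k n)] {deg : Γ → ℤ} {g h : Γ}
  {Q : Type u} [Ring Q] [Algebra k Q]

/-- The elements `x_l` of copy `0` are sent to `b_l b_0⁻¹`. The values on the second series are then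
automatic: up to the central unit `d` it is the inverse of the first, and inverses of series are
unique. -/
theorem IsShiftAction.exists_hom_of_cauchyMul (hΓ : IsShiftAction k n deg g h) {b c : ℕ → Q}
    {d : Q} (hbc : ∀ l ≤ n, cauchyMul b c l = if l = 0 then d else 0) (hd : IsUnit d)
    (hdc : ∀ y, d * y = y * d) (γ : Γ →* Qˣ) (hg : γ g = b 0) (hh : γ h = c 0)
    (hγ : ∀ w y, conjHom k (γ w) y = conjHom k (γ g ^ deg w) y) :
    ∃ Ψ : Smash (FNSymm k n) Γ →ₐ[k] Q, (∀ l ≤ n, Ψ (smashGen k n 0 g l) = b l) ∧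
      ∀ l ≤ n, Ψ (smashGen k n (-1) h l) = c l := by
  obtain ⟨d, rfl⟩ := hd
  have hdi (y : Q) : (d⁻¹ : Qˣ) * y = y * (d⁻¹ : Qˣ) :=
    ((show Commute (d : Q) y from hdc y).units_inv_left).eq
  let X : ℕ → Q := fun l => b l * ((γ g)⁻¹ : Qˣ)
  have hX0 : X 0 = 1 := by simp only [X]; rw [← hg, Units.mul_inv]
  let f : NSymm k n →ₐ[k] Q := NSymm.lift X
  have hf {l : ℕ} (hl : l ≤ n) : f (NSymm.x k n l) = X l := NSymm.lift_x k n hX0 hl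
  obtain ⟨Ψ, hΨG, hΨA⟩ := hΓ.exists_hom f γ hγ
  refine ⟨Ψ, fun l hl => ?_, fun l hl => ?_⟩
  · rw [smashGen, map_mul, hΨG, hΨA, hf hl]
    simp [X]
  -- Writing the group element first moves the generator from copy `-1` to copy `0`, where `f` is
  -- known, at the cost of replacing `x` by `invSeq x`.
  · have e : smashGen k n (-1) h l = Smash.inG _ _ h *
        Smash.inA k _ Γ (FreePow.inc k ℤ _ 0 (invSeq (NSymm.x k n) l)) := by
      rw [Smash.inG_mul_inA, hΓ.smul_right, ← NSymm.phi_x k n hl, NSymm.phi_phi, smashGen]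
    -- The inverse of `X = b b_0⁻¹` is `b_0 c d⁻¹`, as `b c = d`.
    let v : ℕ → Q := fun l => b 0 * c l * (d⁻¹ : Qˣ)
    have hv : ∀ l ≤ n, cauchyMul X v l = if l = 0 then 1 else 0 := fun l hl => by
      have e2 : cauchyMul X v l = cauchyMul b c l * (d⁻¹ : Qˣ) := by
        rw [cauchyMul, cauchyMul, Finset.sum_mul]
        refine sum_congr rfl fun p _ => ?_
        simp only [X, v, ← hg, mul_assoc, Units.inv_mul_cancel_left]
      rw [e2, hbc l hl]
      split_ifs <;> simp
    -- The elements `x_i` are zero for `i > n` while `X i` need not be, so the two sequences, and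
    -- hence their inverses, are compared only up to index `n`.
    have hfx : invSeq (fun i => f (NSymm.x k n i)) l = invSeq X l := by
      refine (eq_invSeq_of_cauchyMul (u := X) (n := n) hX0 (fun j hj => ?_) hl)
      rw [cauchyMul, ← sum_mul_invSeq (fun i => f (NSymm.x k n i))
        ((hf (Nat.zero_le n)).trans hX0) j]
      exact sum_congr rfl fun p hp => by rw [hf ((NSymm.fst_le_of_mem hp).trans hj)]
    have h0 : c 0 * b 0 = d := by
      have h1 : b 0 * c 0 = d := by simpa [cauchyMul] using hbc 0 (Nat.zero_le _)
      have h2 : (γ g * γ h : Q) = d := by rw [hg, hh, h1]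
      rw [← hh, ← hg, ← Units.val_mul, ← map_mul, mul_comm h g, map_mul, Units.val_mul, h2]
    rw [e, map_mul, hΨG, hΨA, hh]
    have := map_invSeq (f : NSymm k n →+* Q) (NSymm.x k n) l
    refine (congrArg (c 0 * ·) (this.trans (hfx.trans
      (eq_invSeq_of_cauchyMul hX0 hv hl).symm))).trans ?_
    simp only [v]
    rw [mul_assoc (b 0), ← mul_assoc, h0, ← hdi, ← mul_assoc, Units.mul_inv, one_mul]

variable [BialgAction k (FNSymm k n) Γ]

theorem smash_antipode_antipode (y : Smash (FNSymm k n) Γ) :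
    HopfAlgebra.antipode k (HopfAlgebra.antipode k y) = y :=
  Smash.antipode_antipode k (FreePow.antipode_antipode k (NSymm.antipode_antipode k n)) y

/-- The homomorphism to the smash product induced on the quotients. -/
def sQuotLift {K : Type u} [Ring K] [HopfAlgebra k K] (Φ : K →ₐc[k] Smash (FNSymm k n) Γ) (m : ℕ) :
    SQuot k K m →ₐc[k] Smash (FNSymm k n) Γ :=
  quotLift (sPowRel k K m) Φ (map_sPowRel_eq_zero smash_antipode_antipode Φ m)

theorem sQuotLift_mk {K : Type u} [Ring K] [HopfAlgebra k K] (Φ : K →ₐc[k] Smash (FNSymm k n) Γ)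
    (m : ℕ) (x : K) :
    sQuotLift Φ m (Ideal.Quotient.mk (idealOf (sPowRel k K m)) x) = Φ x := rfl

/-- The Toeplitz series found in the quotient define a map `Ψ` back from the smash product, and both
composites are the identity on matrix entries. The hypothesis `hγ` isolates what depends on the
group: two units with product `p (qdetGL E)` must extend to a representation of `Γ` whose
conjugation action depends only on the degree. -/
theorem IsShiftAction.bijective_sQuotLift [CharZero k] (hΓ : IsShiftAction k n deg g h) {q : k}
    (hq₀ : q ≠ 0) (hq : ∀ m : ℕ, 0 < m → q ^ m ≠ 1)
    {E : Matrix (Fin (n + 1) ⊕ Fin (n + 1)) (Fin (n + 1) ⊕ Fin (n + 1)) k}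
    (hE : E = Dmat (n + 1) q) (hE₀ : E ≠ 0) {K : Type u} [Ring K] [HopfAlgebra k K]
    (p : OGL E →ₐc[k] K) (hp : Function.Surjective p)
    (hD : ∀ y, p (qdetGL E) * y = y * p (qdetGL E))
    (Φ : K →ₐc[k] Smash (FNSymm k n) Γ) (hΦ : ∀ i j, Φ (p (aGL E i j)) = smashMat k n g h i j)
    {m : ℕ} (hm : 0 < m)
    (hγ : ∀ G H : (SQuot k K m)ˣ,
      (G * H : SQuot k K m) = Ideal.Quotient.mk (idealOf (sPowRel k K m)) (p (qdetGL E)) →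
      (∀ y, (G * H : SQuot k K m) * y = y * (G * H : SQuot k K m)) →
      ∃ γ : Γ →* (SQuot k K m)ˣ, γ g = G ∧ γ h = H ∧
        ∀ w y, conjHom k (γ w) y = conjHom k (γ g ^ deg w) y) :
    Function.Bijective (sQuotLift Φ m) := by
  obtain ⟨b, c, ha, hbc, hcb⟩ := exists_toeplitz_sQuot hq₀ hq hE hE₀ p hD hm
  set d := Ideal.Quotient.mk (idealOf (sPowRel k K m)) (p (qdetGL E))
  have hbc0 : b 0 * c 0 = d := by simpa [cauchyMul] using hbc 0 (Nat.zero_le _)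
  have hdc (y : SQuot k K m) : d * y = y * d := by
    obtain ⟨y, rfl⟩ := Ideal.Quotient.mk_surjective y
    rw [← map_mul, hD, map_mul]
  have hd : IsUnit d := ((isGroupLikeElem_qdetGL E hE₀).isUnit.map p).map _
  obtain ⟨du, hdu⟩ := hd
  have hdi (y : SQuot k K m) : (du⁻¹ : (SQuot k K m)ˣ) * y = y * (du⁻¹ : (SQuot k K m)ˣ) :=
    ((show Commute (du : SQuot k K m) y from hdu ▸ hdc y).units_inv_left).eq
  -- Both `b 0 * c 0` and `c 0 * b 0` equal the central unit `d`, so each factor is a unit with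
  -- inverse the other one times `d⁻¹`.
  let G : (SQuot k K m)ˣ := ⟨b 0, c 0 * (du⁻¹ : (SQuot k K m)ˣ),
    by rw [← mul_assoc, hbc0, ← hdu, Units.mul_inv],
    by rw [mul_assoc, hdi, ← mul_assoc, hcb, ← hdu, Units.mul_inv]⟩
  let H : (SQuot k K m)ˣ := ⟨c 0, b 0 * (du⁻¹ : (SQuot k K m)ˣ),
    by rw [← mul_assoc, hcb, ← hdu, Units.mul_inv],
    by rw [mul_assoc, hdi, ← mul_assoc, hbc0, ← hdu, Units.mul_inv]⟩
  obtain ⟨γ, hγg, hγh, hγc⟩ := hγ G H hbc0 (fun y => hbc0 ▸ hdc y)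
  obtain ⟨Ψ, hΨb, hΨc⟩ := hΓ.exists_hom_of_cauchyMul hbc ⟨du, hdu⟩ hdc γ
    (by rw [hγg]) (by rw [hγh]) hγc
  have hΨ (i j) : Ψ (smashMat k n g h i j) = Ideal.Quotient.mk (idealOf (sPowRel k K m))
      (p (aGL E i j)) := by
    rw [ha]
    rcases i with i | i <;> rcases j with j | j
    · simp only [smashMat, blockToeplitz, Matrix.fromBlocks_apply₁₁, Matrix.transpose_apply,
        upToeplitz, Matrix.of_apply, apply_ite Ψ, map_zero, hΨb ((i : ℕ) - j) (by omega)]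
    · simp [smashMat, blockToeplitz]
    · simp [smashMat, blockToeplitz]
    · simp only [smashMat, blockToeplitz, Matrix.fromBlocks_apply₂₂,
        upToeplitz, Matrix.of_apply, apply_ite Ψ, map_zero, hΨc ((j : ℕ) - i) (by omega)]
  have hleft : Function.LeftInverse Ψ (sQuotLift Φ m) := by
    have e : (Ψ.comp (sQuotLift Φ m : SQuot k K m →ₐ[k] Smash (FNSymm k n) Γ)).comp
        ((Ideal.Quotient.mkₐ k (idealOf (sPowRel k K m))).comp (p : OGL E →ₐ[k] K)) =
        (Ideal.Quotient.mkₐ k (idealOf (sPowRel k K m))).comp (p : OGL E →ₐ[k] K) :=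
      OGL_algHom_ext E fun i j => by
        refine Eq.trans ?_ (hΨ i j)
        rw [← hΦ]
        rfl
    intro x
    obtain ⟨x, rfl⟩ := Ideal.Quotient.mk_surjective x
    obtain ⟨x, rfl⟩ := hp x
    exact AlgHom.congr_fun e x
  have hright : Function.RightInverse Ψ (sQuotLift Φ m) := by
    have hb (i j) : sQuotLift Φ m (Matrix.fromBlocks (upToeplitz (n + 1) b)ᵀ 0 0
        (upToeplitz (n + 1) c) i j) = smashMat k n g h i j := by
      rw [← ha, sQuotLift_mk, hΦ]
    have e : (sQuotLift Φ m : SQuot k K m →ₐ[k] Smash (FNSymm k n) Γ).comp Ψ = AlgHom.id k _ := by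
      -- Only the first column of the upper left block, which is the series `b` because this block
      -- is transposed, and the corner of the other block are needed.
      refine hΓ.algHom_ext (fun l hl => ?_) ?_
      · have := hb (Sum.inl ⟨l, by omega⟩) (Sum.inl 0)
        simp only [smashMat, blockToeplitz, Matrix.fromBlocks_apply₁₁, Matrix.transpose_apply,
          upToeplitz, Matrix.of_apply, Fin.zero_le, if_true, Fin.val_zero, tsub_zero] at this
        rw [AlgHom.comp_apply, hΨb l hl]
        exact this
      · have := hb (Sum.inr 0) (Sum.inr 0)
        simp only [smashMat, blockToeplitz, Matrix.fromBlocks_apply₂₂,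
          upToeplitz, Matrix.of_apply, le_refl, if_true, Fin.val_zero, tsub_zero] at this
        rw [AlgHom.comp_apply, hΨc 0 (Nat.zero_le _)]
        exact this
    exact AlgHom.congr_fun e
  exact ⟨hleft.injective, hright.surjective⟩

end Bijectivity

/-! ### The limits for `O^c_A(GL)` and `O_A(SL)` -/

section Main

variable {k : Type u} [Field k]

theorem Dmat_ne_zero (n : ℕ) (q : k) : Dmat (n + 1) q ≠ 0 := fun h => by
  have := congrFun (congrFun h (Sum.inl 0)) (Sum.inr 0)
  simp [Dmat] at this

/-- The projective limit for a Hopf quotient of `O_A(GL)` in which the quantum determinant is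
central. -/
theorem IsShiftAction.sInftyLimit [CharZero k] {n : ℕ} {Γ : Type} [CommGroup Γ]
    [MulSemiringAction Γ (FNSymm k n)] [SMulCommClass Γ k (FNSymm k n)]
    [BialgAction k (FNSymm k n) Γ] {deg : Γ → ℤ} {g h : Γ} (hΓ : IsShiftAction k n deg g h) {q : k}
    (hq₀ : q ≠ 0) (hq : ∀ m : ℕ, 0 < m → q ^ m ≠ 1)
    {E : Matrix (Fin (n + 1) ⊕ Fin (n + 1)) (Fin (n + 1) ⊕ Fin (n + 1)) k}
    (hE : E = Dmat (n + 1) q) {K : Type u} [Ring K] [HopfAlgebra k K] (p : OGL E →ₐc[k] K)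
    (hp : Function.Surjective p) (hD : ∀ y, p (qdetGL E) * y = y * p (qdetGL E))
    (hΦ : ∀ F : OGL E →ₐc[k] Smash (FNSymm k n) Γ,
      F (qdetGL E) = Smash.inG (FNSymm k n) Γ (g * h) →
        ∃ Φ : K →ₐc[k] Smash (FNSymm k n) Γ, ∀ x, Φ (p x) = F x)
    (hγ : ∀ (Q : Type u) [Ring Q] [Algebra k Q] (F : K →ₐ[k] Q) (G H : Qˣ),
      (G * H : Q) = F (p (qdetGL E)) → (∀ y, (G * H : Q) * y = y * (G * H : Q)) →
      ∃ γ : Γ →* Qˣ, γ g = G ∧ γ h = H ∧ ∀ w y, conjHom k (γ w) y = conjHom k (γ g ^ deg w) y) :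
    (∃ (L : Type u) (_ : Ring L) (_ : HopfAlgebra k L) (π : ∀ m : ℕ+, L →ₐc[k] SQuot k K m),
        IsSInftyLimit k π) ∧
      ∀ (L : Type u) [Ring L] [HopfAlgebra k L] (π : ∀ m : ℕ+, L →ₐc[k] SQuot k K m),
        IsSInftyLimit k π → Nonempty (L ≃ₐc[k] Smash (FNSymm k n) Γ) := by
  have hE₀ : E ≠ 0 := hE ▸ Dmat_ne_zero n q
  have hrel : smashMat k n g h * scal _ E * (smashMat k n g h)ᵀ =
      scal _ E * Matrix.scalar _ (Smash.inG (FNSymm k n) Γ (g * h)) := by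
    rw [hE]
    exact hΓ.relation q
  obtain ⟨F, hF⟩ := exists_OGL_hom E (comul_blockToeplitz (n := n)
    (fun l hl => comul_smashGen 0 g hl) (fun l hl => comul_smashGen (-1) h hl))
    (counit_blockToeplitz
      (fun l hl => counit_smashGen 0 g hl) (fun l hl => counit_smashGen (-1) h hl))
    hrel
  have hFD : F (qdetGL E) = Smash.inG (FNSymm k n) Γ (g * h) :=
    map_qdetGL E (F := (F : OGL E →ₐ[k] Smash (FNSymm k n) Γ)) hE₀ hF hrel
  obtain ⟨Φ, hΦF⟩ := hΦ F hFD
  refine sInftyLimit_of_bijective (fun m => sQuotLift Φ m) (fun m =>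
    hΓ.bijective_sQuotLift hq₀ hq hE hE₀ p hp hD Φ (fun i j => (hΦF _).trans (hF i j)) m.pos
      (hγ _ (Ideal.Quotient.mkₐ k (idealOf (sPowRel k K m))))) ?_
  -- All the isomorphisms are induced by the one map `Φ`, so compatibility holds on representatives
  -- by definition.
  intro m m' hm x
  obtain ⟨x, rfl⟩ := Ideal.Quotient.mk_surjective x
  rfl

/-- The element `g^a h^b` acts with the twist `φ^(a+b)`, while a shift of degree `a - b` requires
`φ^(a-b)`; the two agree because `φ² = 1`. -/
theorem isShiftAction_int_prod (n : ℕ) :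
    IsShiftAction k n (fun w : Multiplicative (ℤ × ℤ) => w.toAdd.1 - w.toAdd.2)
      (Multiplicative.ofAdd (1, 0)) (Multiplicative.ofAdd (0, 1)) where
  smul_inc w s y := by
    refine (FNSymm.act_inc k n w.toAdd.1 w.toAdd.2 s y).trans ?_
    rw [show w.toAdd.1 + w.toAdd.2 = w.toAdd.1 - w.toAdd.2 + 2 * w.toAdd.2 by ring,
      _root_.zpow_add, _root_.zpow_mul, NSymm.phi_sq, _root_.one_zpow, mul_one, add_sub_assoc]
  deg_zpow s := by simp [← ofAdd_zsmul]
  deg_right := by simp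
  closure_eq := by
    rw [eq_top_iff]
    intro w _
    have : w = Multiplicative.ofAdd ((1, 0) : ℤ × ℤ) ^ w.toAdd.1 *
        Multiplicative.ofAdd ((0, 1) : ℤ × ℤ) ^ w.toAdd.2 := by
      rw [← ofAdd_zsmul, ← ofAdd_zsmul, ← ofAdd_add]
      apply Multiplicative.toAdd.injective
      ext <;> simp
    exact Subgroup.mem_closure_pair.2 ⟨_, _, this.symm⟩

theorem isShiftAction_int (n : ℕ) :
    IsShiftAction k n (fun w : Multiplicative ℤ => w.toAdd)
      (Multiplicative.ofAdd 1) (Multiplicative.ofAdd (-1)) where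
  smul_inc w s y := by
    refine (FNSymm.act_inc k n w.toAdd 0 s y).trans ?_
    rw [add_zero, sub_zero]
  deg_zpow s := by simp [← ofAdd_zsmul]
  deg_right := by simp
  closure_eq := by
    rw [eq_top_iff]
    intro w _
    have : w = Multiplicative.ofAdd (1 : ℤ) ^ w.toAdd := by
      rw [← ofAdd_zsmul]
      apply Multiplicative.toAdd.injective
      simp
    exact Subgroup.mem_closure_pair.2 ⟨w.toAdd, 0, by rw [_root_.zpow_zero, mul_one, ← this]⟩

/-- Two units whose product is central define a homomorphism from `ℤ × ℤ`, such that `(a, b)` acts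
by conjugation as the power of the first unit with exponent `a - b`. -/
theorem exists_hom_int_prod {Q : Type v} [Ring Q] [Algebra k Q] (G H : Qˣ)
    (hc : ∀ y, (G * H : Q) * y = y * (G * H : Q)) :
    ∃ γ : Multiplicative (ℤ × ℤ) →* Qˣ, γ (Multiplicative.ofAdd (1, 0)) = G ∧
      γ (Multiplicative.ofAdd (0, 1)) = H ∧ ∀ w y, conjHom k (γ w) y =
        conjHom k (γ (Multiplicative.ofAdd (1, 0)) ^ (w.toAdd.1 - w.toAdd.2)) y := by
  -- Centrality of `G H` gives `G H G⁻¹ = G⁻¹ G H = H`.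
  have hGH : Commute G H := by
    have := hc (G⁻¹ : Qˣ)
    rw [← mul_assoc, Units.inv_mul, one_mul] at this
    exact mul_inv_eq_iff_eq_mul.1 (Units.ext this)
  let γ : Multiplicative (ℤ × ℤ) →* Qˣ :=
    { toFun := fun w => G ^ w.toAdd.1 * H ^ w.toAdd.2
      map_one' := by simp
      map_mul' := fun w w' => by
        have := (hGH.zpow_zpow w'.toAdd.1 w.toAdd.2).eq
        simp only [toAdd_mul, Prod.fst_add, Prod.snd_add, _root_.zpow_add]
        rw [mul_assoc, mul_assoc, ← mul_assoc (G ^ w'.toAdd.1), this, mul_assoc] }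
  have hγ1 : γ (Multiplicative.ofAdd (1, 0)) = G := by simp [γ]
  have hγ2 : γ (Multiplicative.ofAdd (0, 1)) = H := by simp [γ]
  refine ⟨γ, hγ1, hγ2, fun w y => ?_⟩
  have hz (b : ℤ) (y : Q) : conjHom k ((G * H) ^ b) y = y := by
    have h1 : Commute ((G * H : Qˣ) : Q) y := hc y
    have h2 : Commute (((G * H) ^ b : Qˣ) : Q) y := h1.units_zpow_left b
    rw [conjHom_apply, h2.eq, mul_assoc, Units.mul_inv, mul_one]
  -- Splitting off powers of the central element `G H`, which conjugate trivially, leaves the power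
  -- of `G` whose exponent is the degree.
  have hw : γ w = G ^ (w.toAdd.1 - w.toAdd.2) * (G * H) ^ w.toAdd.2 := by
    rw [hGH.mul_zpow, ← mul_assoc, ← _root_.zpow_add, sub_add_cancel]
    rfl
  rw [hw, conjHom_mul, hz, hγ1]

theorem exists_hom_int {Q : Type v} [Ring Q] [Algebra k Q] (G H : Qˣ) (hGH : (G * H : Q) = 1) :
    ∃ γ : Multiplicative ℤ →* Qˣ, γ (Multiplicative.ofAdd 1) = G ∧
      γ (Multiplicative.ofAdd (-1)) = H ∧ ∀ w y, conjHom k (γ w) y =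
        conjHom k (γ (Multiplicative.ofAdd 1) ^ w.toAdd) y := by
  have h : G * H = 1 := Units.ext hGH
  refine ⟨zpowersHom Qˣ G, by simp, ?_, fun w y => ?_⟩
  · rw [zpowersHom_apply, toAdd_ofAdd, _root_.zpow_neg_one, inv_eq_of_mul_eq_one_right h]
  · rw [zpowersHom_apply, zpowersHom_apply, toAdd_ofAdd, _root_.zpow_one]

/-- The product of the generators is central in the smash product. -/
theorem IsShiftAction.inG_mul_comm {n : ℕ} {Γ : Type} [CommGroup Γ]
    [MulSemiringAction Γ (FNSymm k n)] [SMulCommClass Γ k (FNSymm k n)] {deg : Γ → ℤ} {g h : Γ}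
    (hΓ : IsShiftAction k n deg g h) (y : Smash (FNSymm k n) Γ) :
    Smash.inG (FNSymm k n) Γ (g * h) * y = y * Smash.inG (FNSymm k n) Γ (g * h) := by
  -- The degrees `1` and `-1` cancel, and the two twists compose to `φ² = 1`.
  have htriv (a : FNSymm k n) : (g * h) • a = a := by
    have : MulSemiringAction.toAlgHom k (FNSymm k n) (g * h) = AlgHom.id k _ :=
      FreePow.hom_ext fun s y => by
        have h1 : deg g = 1 := by simpa using hΓ.deg_zpow 1
        rw [MulSemiringAction.toAlgHom_apply, mul_smul, hΓ.smul_inc, hΓ.smul_inc, hΓ.deg_right, h1,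
          NSymm.phi_neg_one, _root_.zpow_one, NSymm.phi_phi, neg_add_cancel_right]
        rfl
    exact AlgHom.congr_fun this a
  have hy : y ∈ Algebra.adjoin k ({y : Smash (FNSymm k n) Γ | ∃ a, y = Smash.inA k _ Γ a} ∪
      {y | ∃ g, y = Smash.inG _ Γ g}) := Smash.adjoin_eq k (FNSymm k n) Γ ▸ Algebra.mem_top
  induction hy using Algebra.adjoin_induction with
  | mem x hx =>
    obtain ⟨a, rfl⟩ | ⟨w, rfl⟩ := hx
    · rw [Smash.inG_mul_inA, htriv]
    · rw [← map_mul, ← map_mul, mul_comm]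
  | algebraMap c => exact (Algebra.commutes c _).symm
  | add x y _ _ hx hy => rw [mul_add, add_mul, hx, hy]
  | mul x y _ _ hx hy => rw [← mul_assoc, hx, mul_assoc, hy, mul_assoc]

section QuotientsOfOGL

variable {n : ℕ} (q : k)

/-- The ideal is defined through all group-like codeterminants, and `qdetGL` is one of them. That
there are no others is needed only for mapping out of the quotient. -/
theorem mk_qdetGL_mul_OcGL (y : OcGL (Dmat (n + 1) q)) :
    quotProj (k := k) _ (qdetGL (Dmat (n + 1) q)) * y =
      y * quotProj (k := k) _ (qdetGL (Dmat (n + 1) q)) := by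
  obtain ⟨y, rfl⟩ := Ideal.Quotient.mk_surjective y
  have h := mk_eq_zero_of_mem (s := centralRel k (IsHomCodet (QuadAlg.aug (Dmat (n + 1) q))
    (coactGL (Dmat (n + 1) q)))) ⟨qdetGL _, y, isGroupLikeElem_qdetGL _ (Dmat_ne_zero n q),
      isHomCodet_qdetGL _, rfl⟩
  rw [map_sub, sub_eq_zero, map_mul, map_mul] at h
  exact h.symm

theorem mk_qdetGL_OSL :
    quotProj (k := k) (trivialRel k (IsHomCodet (QuadAlg.aug (Dmat (n + 1) q))
      (coactGL (Dmat (n + 1) q)))) (qdetGL (Dmat (n + 1) q)) = 1 := by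
  have h := mk_eq_zero_of_mem (s := trivialRel k (IsHomCodet (QuadAlg.aug (Dmat (n + 1) q))
    (coactGL (Dmat (n + 1) q)))) ⟨qdetGL _, isGroupLikeElem_qdetGL _ (Dmat_ne_zero n q),
      isHomCodet_qdetGL _, rfl⟩
  rw [map_sub, sub_eq_zero, map_one] at h
  exact h

end QuotientsOfOGL

end Main

end QG

end

theorem mainTheorem7 (k : Type u) [Field k] [IsAlgClosed k] [CharZero k] (r : ℕ) (hr : 1 ≤ r)
    (q : k) (hq₀ : q ≠ 0) (hq : ∀ m : ℕ, 0 < m → q ^ m ≠ 1) :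
    ((∃ (L : Type u) (_ : Ring L) (_ : HopfAlgebra k L)
        (π : ∀ m : ℕ+, L →ₐc[k] QG.SQuot k (QG.OcGL (QG.Dmat r q)) m), QG.IsSInftyLimit k π) ∧
      ∀ (L : Type u) [Ring L] [HopfAlgebra k L]
        (π : ∀ m : ℕ+, L →ₐc[k] QG.SQuot k (QG.OcGL (QG.Dmat r q)) m), QG.IsSInftyLimit k π →
          Nonempty (L ≃ₐc[k] QG.Smash (QG.FNSymm k (r - 1)) (Multiplicative (ℤ × ℤ)))) ∧
    ((∃ (L : Type u) (_ : Ring L) (_ : HopfAlgebra k L)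
        (π : ∀ m : ℕ+, L →ₐc[k] QG.SQuot k (QG.OSL (QG.Dmat r q)) m), QG.IsSInftyLimit k π) ∧
      ∀ (L : Type u) [Ring L] [HopfAlgebra k L]
        (π : ∀ m : ℕ+, L →ₐc[k] QG.SQuot k (QG.OSL (QG.Dmat r q)) m), QG.IsSInftyLimit k π →
          Nonempty (L ≃ₐc[k] QG.Smash (QG.FNSymm k (r - 1)) (Multiplicative ℤ))) := by
  obtain ⟨n, rfl⟩ : ∃ n, r = n + 1 := ⟨r - 1, by omega⟩
  have hE₀ := QG.Dmat_ne_zero n q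
  constructor
  · refine (QG.isShiftAction_int_prod n).sInftyLimit hq₀ hq rfl (QG.quotProj _)
      Ideal.Quotient.mk_surjective (QG.mk_qdetGL_mul_OcGL q) (fun F hF => ?_)
      (fun Q _ _ F G H _ hc => QG.exists_hom_int_prod G H hc)
    refine ⟨QG.quotLift _ F ?_, fun x => rfl⟩
    -- By uniqueness of the codeterminant every such relation concerns `qdetGL`, whose image `g h`
    -- is central in the smash product.
    rintro _ ⟨D, a, -, hD, rfl⟩
    rw [QG.eq_qdetGL_of_isHomCodet _ hE₀ hD, map_sub, map_mul, map_mul, hF, sub_eq_zero]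
    exact ((QG.isShiftAction_int_prod n).inG_mul_comm _).symm
  · refine (QG.isShiftAction_int n).sInftyLimit hq₀ hq rfl (QG.quotProj _)
      Ideal.Quotient.mk_surjective (fun y => ?_) (fun F hF => ?_) (fun Q _ _ F G H hGH hc => ?_)
    · rw [QG.mk_qdetGL_OSL, one_mul, mul_one]
    · refine ⟨QG.quotLift _ F ?_, fun x => rfl⟩
      -- Here `g = 1` and `h = -1` in `ℤ`, so the image `g h` of the unique codeterminant is the
      -- identity.
      rintro _ ⟨D, -, hD, rfl⟩
      rw [QG.eq_qdetGL_of_isHomCodet _ hE₀ hD, map_sub, map_one, hF, sub_eq_zero, ← ofAdd_add,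
        add_neg_cancel, ofAdd_zero, map_one]
    · rw [QG.mk_qdetGL_OSL, map_one] at hGH
      exact QG.exists_hom_int G H hGH
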